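/- Let $T>0$, let $N\ge 1$ be an integer, and let $w\in C^\infty(\mathbb R)$ be even, nonnegative and $T$-periodic, with $w(0)=0$, $w''(0)>0$ and $w(z)>0$ for $z\notin T\mathbb Z$. For $\varepsilon>0$ put $W_\varepsilon=\varepsilon^{-2}w$. For $0\le\Omega<\omega_\perp$, $g\ge 0$ and $r^2=x^2+y^2$ let $$Q(\Psi)=\int_{\mathbb R^2\times]-\frac{NT}2,\frac{NT}2[}\Big(\tfrac12|\nabla\Psi-i\Omega(-y,x,0)\Psi|^2-\tfrac12\Omega^2r^2|\Psi|^2+\big(\tfrac12\omega_\perp^2r^2+W_\varepsilon(z)\big)|\Psi|^2+g|\Psi|^4\Big)\,dx\,dy\,dz ,$$ and let $E^{per,N}_\Omega$ be the infimum of $Q(\Psi)$ over all $\Psi\in H^1_{loc}(\mathbb R^3;\mathbb C)$ that are $NT$-periodic in $z$ and satisfy, on the cell $\mathbb R^2\times]-\frac{NT}2,\frac{NT}2[$, $\Psi\in H^1$, $r\Psi\in L^2$ and $\int|\Psi|^2=1$. Let $\psi_\perp(x,y)=(\omega_\perp/\pi)^{1/2}e^{-\omega_\perp r^2/2}$ and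 $\widehat g=g\int_{\mathbb R^2}|\psi_\perp|^4\,dx\,dy=\frac{g\,\omega_\perp}{2\pi}$, and let $$m_A^N=m_A^N(\varepsilon,\widehat g)=\inf\Big\{\int_{-NT/2}^{NT/2}\big(\tfrac12|\phi'|^2+W_\varepsilon|\phi|^2+\widehat g\,|\phi|^4\big)dz\;:\;\phi\in H^1(\mathbb R/NT\mathbb Z;\mathbb C),\ \int_{-NT/2}^{NT/2}|\phi|^2=1\Big\}.$$ Write $\delta_\perp=\omega_\perp-\Omega$. (a) If $m_A^N\,\delta_\perp^{-1}\ll1$ and $g(2\omega_\perp-\Omega)\,m_A^N\,\delta_\perp^{-3/2}\ll1$, then $E^{per,N}_\Omega=\omega_\perp+m_A^N\,(1+o(1))$. Precisely: for all $\varepsilon_0>0$ and $\eta>0$ there is $\kappa>0$, depending only on $T,N,w,\varepsilon_0,\eta$, such that for all $\varepsilon\in\,]0,\varepsilon_0]$, $0\le\Omega<\omega_\perp$ and $g\ge0$ with $m_A^N\,\delta_\perp^{-1}\le\kappa$ and $g(2\omega_\perp-\Omega)\,m_A^N\,\delta_\perp^{-3/2}\le\kappa$ one has $|E^{per,N}_\Omega-\omega_\perp-m_A^N|\le\eta\,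 m_A^N$. (b) There is a constant $C>0$, depending only on $T,N,w$, such that for all $\varepsilon\in\,]0,1]$, all $\Omega\ge0$ and $\omega_\perp$ with $\delta_\perp\ge1$, and all $g\ge0$, there is a number $r_A$ with $$E^{per,N}_\Omega=\omega_\perp+m_A^N\,(1-C\,r_A),\qquad 0\le r_A\le g^{1/4}\delta_\perp^{-1/8}\Big(\frac{\delta_\perp+\omega_\perp}{\delta_\perp}\Big)^{1/4}(m_A^N)^{1/4}+m_A^N\,\delta_\perp^{-1}.$$ -/

import Mathlib

open MeasureTheory Set
open scoped ContDiff

namespace OpticalLattice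

noncomputable section

/-! ### Weak derivatives -/

/-- `v` is the weak (distributional) derivative of the locally integrable function `u` in the
direction `e`. -/
def HasWeakDeriv {E : Type*} [NormedAddCommGroup E] [NormedSpace ℝ E] [MeasureSpace E]
    (u : E → ℂ) (e : E) (v : E → ℂ) : Prop :=
  LocallyIntegrable u ∧ LocallyIntegrable v ∧
    ∀ χ : E → ℝ, ContDiff ℝ ∞ χ → HasCompactSupport χ →
      ∫ p, (fderiv ℝ χ p e) • u p = - ∫ p, χ p • v p

open Classical in
/-- The weak derivative of `u` in the direction `e` (a representative of it; it is unique almost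
everywhere), and `0` if there is none. -/
def weakDeriv {E : Type*} [NormedAddCommGroup E] [NormedSpace ℝ E] [MeasureSpace E]
    (u : E → ℂ) (e : E) : E → ℂ :=
  if h : ∃ v, HasWeakDeriv u e v then h.choose else 0

/-! ### The lattice potential -/

/-- The profile `w` of the optical lattice: smooth, even, nonnegative, `T`-periodic, with
nondegenerate minima, equal to `0`, exactly at the points of `T ℤ`. -/
structure IsLatticeProfile (T : ℝ) (w : ℝ → ℝ) : Prop where
  smooth : ContDiff ℝ ∞ w
  even : ∀ z, w (-z) = w z
  nonneg : ∀ z, 0 ≤ w z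
  periodic : ∀ z, w (z + T) = w z
  zero : w 0 = 0
  nondegenerate : 0 < iteratedDeriv 2 w 0
  pos : ∀ z, (¬ ∃ k : ℤ, z = k * T) → 0 < w z

/-- The optical lattice potential `W_ε = w / ε²`. -/
def latticePotential (w : ℝ → ℝ) (ε z : ℝ) : ℝ := 1 / ε ^ 2 * w z

/-! ### The three-dimensional periodic problem -/

/-- One periodicity cell `ℝ² × ]-L/2, L/2[`; points of `ℝ³` are written `(x, y, z)`. -/
def cell3 (L : ℝ) : Set (ℝ × ℝ × ℝ) := {p | p.2.2 ∈ Ioo (-(L / 2)) (L / 2)}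

/-- The natural form domain: functions on `ℝ³` which are `L`-periodic in `z`, are in `H¹` of the
cell `ℝ² × ]-L/2, L/2[` with weak derivatives taken on all of `ℝ³` (so that there is no jump at
the ends of the cell), and with `√(x² + y²) Ψ` square integrable on the cell. -/
structure MemFormDomain3 (L : ℝ) (Ψ : ℝ × ℝ × ℝ → ℂ) : Prop where
  periodic : ∀ᵐ p : ℝ × ℝ × ℝ, Ψ (p.1, p.2.1, p.2.2 + L) = Ψ p
  memLp : MemLp Ψ 2 (volume.restrict (cell3 L))
  deriv_x : ∃ v, HasWeakDeriv Ψ (1, 0, 0) v ∧ MemLp v 2 (volume.restrict (cell3 L))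
  deriv_y : ∃ v, HasWeakDeriv Ψ (0, 1, 0) v ∧ MemLp v 2 (volume.restrict (cell3 L))
  deriv_z : ∃ v, HasWeakDeriv Ψ (0, 0, 1) v ∧ MemLp v 2 (volume.restrict (cell3 L))
  weighted : MemLp (fun p : ℝ × ℝ × ℝ => (√(p.1 ^ 2 + p.2.1 ^ 2) : ℂ) * Ψ p) 2
    (volume.restrict (cell3 L))

/-- `|∇Ψ - i (Ω × r) Ψ|²` at the point `p`, where `Ω × r = Ω (-y, x, 0)`. -/
def magneticKinetic (Om : ℝ) (Ψ : ℝ × ℝ × ℝ → ℂ) (p : ℝ × ℝ × ℝ) : ℝ :=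
  ‖weakDeriv Ψ (1, 0, 0) p - Complex.I * (Om * (-p.2.1) : ℝ) * Ψ p‖ ^ 2
    + ‖weakDeriv Ψ (0, 1, 0) p - Complex.I * (Om * p.1 : ℝ) * Ψ p‖ ^ 2
    + ‖weakDeriv Ψ (0, 0, 1) p‖ ^ 2

/-- The rotating Gross-Pitaevskii functional on one cell of length `L`, with transverse trapping
frequency `om`, rotational velocity `Om` and coupling constant `g`. -/
def energy3 (w : ℝ → ℝ) (L ε om Om g : ℝ) (Ψ : ℝ × ℝ × ℝ → ℂ) : ℝ :=
  ∫ p in cell3 L,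
    (1 / 2 * magneticKinetic Om Ψ p
      - 1 / 2 * Om ^ 2 * (p.1 ^ 2 + p.2.1 ^ 2) * ‖Ψ p‖ ^ 2
      + (1 / 2 * om ^ 2 * (p.1 ^ 2 + p.2.1 ^ 2) + latticePotential w ε p.2.2) * ‖Ψ p‖ ^ 2
      + g * ‖Ψ p‖ ^ 4)

/-- The ground state energy of the `NT`-periodic problem: the infimum of the functional over the
`L²`-normalized functions of the form domain. -/
def groundEnergy3 (w : ℝ → ℝ) (T : ℝ) (N : ℕ) (ε om Om g : ℝ) : ℝ :=
  sInf (energy3 w (N * T) ε om Om g ''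
    {Ψ | MemFormDomain3 (N * T) Ψ ∧ ∫ p in cell3 (N * T), ‖Ψ p‖ ^ 2 = 1})

/-! ### The one-dimensional longitudinal problem -/

/-- The Sobolev space `H¹(ℝ / L ℤ)`, realized by `L`-periodic functions on the line. -/
structure MemH1Per (L : ℝ) (φ : ℝ → ℂ) : Prop where
  periodic : ∀ᵐ z : ℝ, φ (z + L) = φ z
  memLp : MemLp φ 2 (volume.restrict (Ioo (-(L / 2)) (L / 2)))
  deriv : ∃ v, HasWeakDeriv φ 1 v ∧ MemLp v 2 (volume.restrict (Ioo (-(L / 2)) (L / 2)))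

/-- The longitudinal functional on one cell of length `L`, with coupling constant `gh`. -/
def energyA (w : ℝ → ℝ) (L ε gh : ℝ) (φ : ℝ → ℂ) : ℝ :=
  ∫ z in Ioo (-(L / 2)) (L / 2),
    (1 / 2 * ‖weakDeriv φ 1 z‖ ^ 2 + latticePotential w ε z * ‖φ z‖ ^ 2 + gh * ‖φ z‖ ^ 4)

/-- The infimum `m_A^N(ε, gh)` of the longitudinal functional over the `L²`-normalized functions
of `H¹(ℝ / NT ℤ)`. -/
def mA (w : ℝ → ℝ) (T : ℝ) (N : ℕ) (ε gh : ℝ) : ℝ :=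
  sInf (energyA w (N * T) ε gh ''
    {φ | MemH1Per (N * T) φ ∧ ∫ z in Ioo (-(N * T / 2)) (N * T / 2), ‖φ z‖ ^ 2 = 1})

/-- The normalized ground state of the transverse harmonic oscillator. -/
def psiPerp (om : ℝ) (q : ℝ × ℝ) : ℝ :=
  √(om / Real.pi) * Real.exp (-(om / 2) * (q.1 ^ 2 + q.2 ^ 2))

/-- The coupling constant of the longitudinal functional. -/
def gHat (g om : ℝ) : ℝ := g * ∫ q : ℝ × ℝ, |psiPerp om q| ^ 4

/-- Explicitly, the longitudinal coupling constant is `g om / (2 π)`. -/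
theorem gHat_eq (g om : ℝ) (hom : 0 < om) : gHat g om = g * om / (2 * Real.pi) := by
  have hpi := Real.pi_pos
  have h1 : ∀ q : ℝ × ℝ, |psiPerp om q| ^ 4 =
      (om / Real.pi) ^ 2 *
        (Real.exp (-(2 * om) * q.1 ^ 2) * Real.exp (-(2 * om) * q.2 ^ 2)) := by
    intro q
    have hs : √(om / Real.pi) ^ 4 = (om / Real.pi) ^ 2 := by
      rw [show √(om / Real.pi) ^ 4 = (√(om / Real.pi) ^ 2) ^ 2 by ring,
        Real.sq_sqrt (by positivity)]
    rw [psiPerp, abs_of_nonneg (by positivity), mul_pow, hs, ← Real.exp_nat_mul, ← Real.exp_add]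
    congr 2
    push_cast
    ring
  have hsq : √(Real.pi / (2 * om)) * √(Real.pi / (2 * om)) = Real.pi / (2 * om) :=
    Real.mul_self_sqrt (by positivity)
  simp only [gHat, h1]
  rw [integral_const_mul, MeasureTheory.Measure.volume_eq_prod,
    MeasureTheory.integral_prod_mul (fun x : ℝ => Real.exp (-(2 * om) * x ^ 2))
      (fun x : ℝ => Real.exp (-(2 * om) * x ^ 2)), integral_gaussian, hsq]
  field_simp

end

end OpticalLattice

open OpticalLattice

/-!
Write `d = om - Om`, `L = N T` and `m = mA w T N ε (gHat g om)`. The transverse oscillator has the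
ground state `psiPerp om` of energy `om`, which rotation does not affect, separated from the rest of
its spectrum by a gap of order `d`. When `m` is small compared with `d`, a minimizer must be close
to a product `psiPerp om (x, y) φ(z)`, and the energy of such a product is exactly
`om + energyA φ`. The latter identity, `MemH1Per.energy3_gaussianMul`, gives the upper bound
`E ≤ om + m` with no error term. All the work is in the lower bound.

For a smooth normalized `Ψ` with bounded transverse support, put
`D = (∂ₓ + om x, ∂ᵧ + om y)` and `h = ½ ∫ |D Ψ|²`.

* Integration by parts identifies `h` with the excess of the oscillator energy without rotation
  over `om`, and `om` times the angular momentum is at most `h`, because `|(D_x + i D_y) Ψ|² ≥ 0`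
  and the Jacobian of `Ψ` integrates to zero. So the rotating transverse energy is at least
  `om + (d / om) h` (`Nice.transverse_lower_bound`).
* Let `φ(z) = ∫ psiPerp Ψ dx dy` be the profile of `Ψ` and `b = Ψ - psiPerp φ` the orthogonal
  remainder. A Hardy-type inequality yields the spectral gap `∫ |b|² ≤ (8 / om) h`, in one variable
  (`gap_one`), then in two (`gap_two`), then on the cell (`Nice.integral_gap`). Together with
  Pythagoras for `∫ |∂_z Ψ|²` and `∫ W |Ψ|²` (`Nice.integral_pythagoras`) this shows that, if the
  energy of `Ψ` is at most `om + m`, then `∫ |b|² ≲ m / d`, `∫ |∂_z b|² ≲ m` and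
  `∫ |∇_⊥ b|² ≲ om m / d`.
* An anisotropic Gagliardo-Nirenberg inequality (`Regular.pow_four`) turns these into a bound for
  `∫ |b|⁴`. Since `|psiPerp φ| ≤ |Ψ| + |b|`, the quartic energy of `φ` is at most `(1 + t)³` times
  that of `Ψ` plus `(1 + 1 / t)³` times that of `b`, for every `t > 0` (`add_pow_four_le`). As `φ`
  has mass `1 - ∫ |b|²`, the longitudinal functional at `φ` is at least `(1 - ∫ |b|²)² m`
  (`sq_mul_mA_le`).

`excess_lower_bound` collects these estimates: for `0 < t ≤ 1` the energy of `Ψ` is at least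
`om + m (1 - 16 m / d - 7 t - 5760 t⁻³ Z)`, where
`Z = g om m d^(-3/2) (1 + d^(-1/2) / L)` (`Nice.lower_bound`).

The bound passes to the whole form domain by density (`FormData.exists_formTendsto`): cutoffs in the
transverse variables and mollification approximate in the norm of the quadratic form, and
`Regular.pow_four`, applied to differences, gives convergence in `L⁴` as well
(`FormTendsto.pow_four`). In particular, members of the form domain are in `L⁴`, so the Bochner
integral defining the energy is the sum of its parts and no term is lost to non-integrability.

It remains to choose `t`. For the asymptotic statement `t` depends on `η` only, and the part of `Z`
which contains `1 / L` is controlled by `gHat g om ≤ L m` (`gHat_le_mul_mA`). For the quantitative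
statement `t` is the fourth root of `Z` up to a constant (`le_of_forall_lower_bound`).
-/

namespace OpticalLattice

noncomputable section

open Filter Topology ENNReal NNReal
open scoped Convolution

set_option linter.unusedSectionVars false

/-! ### The `L²` seminorm -/

theorem eLpNorm_two_sq {α : Type*} [MeasurableSpace α] (μ : Measure α) (f : α → ℂ) :
    eLpNorm f 2 μ ^ 2 = ∫⁻ x, ‖f x‖ₑ ^ 2 ∂μ := by
  have h := eLpNorm_nnreal_pow_eq_lintegral (f := f) (μ := μ) (p := 2) (by norm_num)
  simp only [NNReal.coe_ofNat, ENNReal.coe_ofNat, ENNReal.rpow_ofNat] at h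
  exact h

/-! ### Calculus of weak derivatives -/

section WeakDerivatives

variable {E : Type*} [NormedAddCommGroup E] [NormedSpace ℝ E] [MeasureSpace E] [BorelSpace E]
  [FiniteDimensional ℝ E]

theorem HasWeakDeriv.ae_unique {u v v' : E → ℂ} {e : E} (h : HasWeakDeriv u e v)
    (h' : HasWeakDeriv u e v') : v =ᵐ[volume] v' := by
  refine ae_eq_of_integral_contDiff_smul_eq h.2.1 h'.2.1 fun χ hχ hc => ?_
  have h1 := h.2.2 χ hχ hc
  rw [h'.2.2 χ hχ hc] at h1
  exact (neg_injective h1).symm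

theorem HasWeakDeriv.weakDeriv_ae_eq {u v : E → ℂ} {e : E} (h : HasWeakDeriv u e v) :
    weakDeriv u e =ᵐ[volume] v := by
  have hex : ∃ v, HasWeakDeriv u e v := ⟨v, h⟩
  rw [weakDeriv, dif_pos hex]
  exact hex.choose_spec.ae_unique h

theorem HasWeakDeriv.congr {u u' v v' : E → ℂ} {e : E} (h : HasWeakDeriv u e v)
    (hu : u =ᵐ[volume] u') (hv : v =ᵐ[volume] v') : HasWeakDeriv u' e v' := by
  refine ⟨h.1.congr hu, h.2.1.congr hv, fun χ hχ hc => ?_⟩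
  have h1 := h.2.2 χ hχ hc
  have e1 : ∫ p, (fderiv ℝ χ p e) • u' p = ∫ p, (fderiv ℝ χ p e) • u p :=
    integral_congr_ae (hu.mono fun p hp => by simp only [hp])
  have e2 : ∫ p, χ p • v' p = ∫ p, χ p • v p :=
    integral_congr_ae (hv.mono fun p hp => by simp only [hp])
  rw [e1, e2, h1]

theorem integrable_smul_of_hasCompactSupport {χ : E → ℝ} (hχ : Continuous χ)
    (hc : HasCompactSupport χ) {u : E → ℂ} (hu : LocallyIntegrable u) :
    Integrable (fun p => χ p • u p) :=
  hu.integrable_smul_left_of_hasCompactSupport hχ hc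

/-- Leibniz rule for a weakly differentiable function times a smooth function. -/
theorem HasWeakDeriv.smul_contDiff {u v : E → ℂ} {e : E} (h : HasWeakDeriv u e v) {θ : E → ℝ}
    (hθ : ContDiff ℝ ∞ θ) :
    HasWeakDeriv (fun p => θ p • u p) e (fun p => θ p • v p + (fderiv ℝ θ p e) • u p) := by
  have hθc := hθ.continuous
  have hθ' : Continuous fun p => fderiv ℝ θ p e :=
    (hθ.continuous_fderiv (by simp)).clm_apply continuous_const
  have mul_loc : ∀ {a : E → ℝ} {f : E → ℂ}, Continuous a → LocallyIntegrable f →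
      LocallyIntegrable (fun p => a p • f p) := by
    intro a f ha hf
    exact hf.continuous_smul ha
  refine ⟨mul_loc hθc h.1, (mul_loc hθc h.2.1).add (mul_loc hθ' h.1), fun χ hχ hc => ?_⟩
  have h1 := h.2.2 (fun p => χ p * θ p) (hχ.mul hθ) hc.mul_right
  have hd : ∀ p, fderiv ℝ (fun p => χ p * θ p) p e
      = χ p * fderiv ℝ θ p e + θ p * fderiv ℝ χ p e := by
    intro p
    rw [fderiv_fun_mul (hχ.differentiable (by simp) p) (hθ.differentiable (by simp) p)]
    simp
  have hχ' : Continuous fun p => fderiv ℝ χ p e :=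
    (hχ.continuous_fderiv (by simp)).clm_apply continuous_const
  have hχc' : HasCompactSupport fun p => fderiv ℝ χ p e := hc.fderiv_apply (𝕜 := ℝ) e
  have i1 : Integrable (fun p => (fderiv ℝ χ p e) • (θ p • u p)) :=
    integrable_smul_of_hasCompactSupport hχ' hχc' (mul_loc hθc h.1)
  have i2 : Integrable (fun p => χ p • ((fderiv ℝ θ p e) • u p)) :=
    integrable_smul_of_hasCompactSupport hχ.continuous hc (mul_loc hθ' h.1)
  have i3 : Integrable (fun p => χ p • (θ p • v p)) :=
    integrable_smul_of_hasCompactSupport hχ.continuous hc (mul_loc hθc h.2.1)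
  have e1 : ∫ p, (fderiv ℝ (fun p => χ p * θ p) p e) • u p
      = (∫ p, χ p • ((fderiv ℝ θ p e) • u p)) + ∫ p, (fderiv ℝ χ p e) • (θ p • u p) := by
    rw [← integral_add i2 i1]
    refine integral_congr_ae (Eventually.of_forall fun p => ?_)
    simp only [hd, add_smul, mul_smul]
    rw [smul_comm (θ p)]
  have e2 : ∫ p, χ p • (θ p • v p + (fderiv ℝ θ p e) • u p)
      = (∫ p, χ p • (θ p • v p)) + ∫ p, χ p • ((fderiv ℝ θ p e) • u p) := by
    rw [← integral_add i3 i2]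
    simp only [smul_add]
  rw [e1] at h1
  simp only [mul_smul] at h1
  rw [e2, neg_add, ← h1]
  ring

variable [(volume : Measure E).IsAddHaarMeasure]

/-- A smooth function is weakly differentiable, with its classical derivative. -/
theorem HasWeakDeriv.of_contDiff {u : E → ℂ} (hu : ContDiff ℝ 1 u) (e : E) :
    HasWeakDeriv u e (fun p => fderiv ℝ u p e) := by
  have hu' : Continuous fun p => fderiv ℝ u p e :=
    (hu.continuous_fderiv (by simp)).clm_apply continuous_const
  refine ⟨hu.continuous.locallyIntegrable, hu'.locallyIntegrable, fun χ hχ hc => ?_⟩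
  have hχ' : Continuous fun p => fderiv ℝ χ p e :=
    (hχ.continuous_fderiv (by simp)).clm_apply continuous_const
  have hχc' : HasCompactSupport fun p => fderiv ℝ χ p e := hc.fderiv_apply (𝕜 := ℝ) e
  rw [integral_smul_fderiv_eq_neg_fderiv_smul_of_integrable, neg_neg]
  · exact integrable_smul_of_hasCompactSupport hχ' hχc' hu.continuous.locallyIntegrable
  · exact integrable_smul_of_hasCompactSupport hχ.continuous hc hu'.locallyIntegrable
  · exact integrable_smul_of_hasCompactSupport hχ.continuous hc hu.continuous.locallyIntegrable
  · exact fun p _ => hχ.differentiable (by simp) p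
  · exact fun p _ => hu.differentiable (by simp) p

theorem locallyIntegrable_comp_add_right {u : E → ℂ} (hu : LocallyIntegrable u) (a : E) :
    LocallyIntegrable fun p => u (p + a) := by
  rw [locallyIntegrable_iff] at hu ⊢
  intro K hK
  have hK' : IsCompact ((fun p => p + a) '' K) := hK.image (by fun_prop)
  have h := hu _ hK'
  have hmp : MeasurePreserving (fun p : E => p + a) volume volume :=
    measurePreserving_add_right volume a
  exact (hmp.integrableOn_image (measurableEmbedding_addRight a)).1 h

theorem HasWeakDeriv.comp_add_right {u v : E → ℂ} {e : E} (h : HasWeakDeriv u e v) (a : E) :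
    HasWeakDeriv (fun p => u (p + a)) e (fun p => v (p + a)) := by
  refine ⟨locallyIntegrable_comp_add_right h.1 a, locallyIntegrable_comp_add_right h.2.1 a,
    fun χ hχ hc => ?_⟩
  have h1 := h.2.2 (fun p => χ (p + -a)) (hχ.comp (contDiff_id.add contDiff_const))
    (hc.comp_homeomorph (Homeomorph.addRight (-a)))
  have e1 := integral_add_right_eq_self (μ := volume)
    (fun p => (fderiv ℝ (fun p => χ (p + -a)) p e) • u p) a
  have e2 := integral_add_right_eq_self (μ := volume) (fun p => χ (p + -a) • v p) a
  rw [← e1, ← e2] at h1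
  simpa [fderiv_comp_add_right] using h1

/-! ### Mollification -/

/-- The mollification of `u` by a normalized bump function. -/
def mollify (φ : ContDiffBump (0 : E)) (u : E → ℂ) : E → ℂ :=
  φ.normed volume ⋆[ContinuousLinearMap.lsmul ℝ ℝ, volume] u

theorem mollify_apply (φ : ContDiffBump (0 : E)) (u : E → ℂ) (x : E) :
    mollify φ u x = ∫ t, φ.normed volume t • u (x - t) := rfl

theorem contDiff_mollify (φ : ContDiffBump (0 : E)) {u : E → ℂ} (hu : LocallyIntegrable u) :
    ContDiff ℝ ∞ (mollify φ u) :=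
  φ.hasCompactSupport_normed.contDiff_convolution_left _ φ.contDiff_normed hu

/-- Mollification turns weak derivatives into classical ones. -/
theorem fderiv_mollify (φ : ContDiffBump (0 : E)) {u v : E → ℂ} {e : E}
    (h : HasWeakDeriv u e v) (x : E) :
    fderiv ℝ (mollify φ u) x e = mollify φ v x := by
  have hd := (φ.hasCompactSupport_normed (μ := volume)).hasFDerivAt_convolution_left
    (ContinuousLinearMap.lsmul ℝ ℝ) (μ := volume) (φ.contDiff_normed (n := 1)) h.1 x
  have hs : HasCompactSupport (fderiv ℝ (φ.normed volume)) :=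
    φ.hasCompactSupport_normed.fderiv ℝ
  have hcf : Continuous (fderiv ℝ (φ.normed volume)) :=
    (φ.contDiff_normed (n := 1)).continuous_fderiv (by simp)
  have hdiff : Differentiable ℝ (φ.normed volume) :=
    (φ.contDiff_normed (n := 1)).differentiable (by simp)
  unfold mollify
  rw [hd.fderiv, convolution_eq_swap, ContinuousLinearMap.integral_apply,
    convolution_eq_swap]
  · simp only [ContinuousLinearMap.precompL_apply, ContinuousLinearMap.lsmul_apply]
    have h1 := h.2.2 (fun t => φ.normed volume (x - t))
      (φ.contDiff_normed.comp (contDiff_const.sub contDiff_id))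
      (φ.hasCompactSupport_normed.comp_homeomorph (Homeomorph.subLeft x))
    have h2 : ∀ t, fderiv ℝ (fun t => φ.normed volume (x - t)) t e
        = - fderiv ℝ (φ.normed volume) (x - t) e := by
      intro t
      have := ((hdiff (x - t)).hasFDerivAt.comp t ((hasFDerivAt_const x t).sub
        (hasFDerivAt_id t))).fderiv
      rw [show fderiv ℝ (fun t => φ.normed volume (x - t)) t = _ from this]
      simp
    simp only [h2, neg_smul, integral_neg] at h1
    exact neg_injective h1
  · have := hs.convolutionExists_left
      ((ContinuousLinearMap.lsmul ℝ ℝ : ℝ →L[ℝ] ℂ →L[ℝ] ℂ).precompL E) (μ := volume) hcf h.1 x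
    exact this.integrable_swap

theorem lintegral_normed (φ : ContDiffBump (0 : E)) :
    ∫⁻ t, ENNReal.ofReal (φ.normed volume t) = 1 := by
  rw [← ofReal_integral_eq_lintegral_ofReal φ.integrable_normed
    (Eventually.of_forall φ.nonneg_normed), φ.integral_normed, ENNReal.ofReal_one]

/-- Jensen's inequality for the average defining a mollification. -/
theorem enorm_mollify_sub_sq_le (φ : ContDiffBump (0 : E)) {u : E → ℂ}
    (hu : LocallyIntegrable u) (x : E) :
    ‖mollify φ u x - u x‖ₑ ^ 2
      ≤ ∫⁻ t, ENNReal.ofReal (φ.normed volume t) * ‖u (x - t) - u x‖ₑ ^ 2 := by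
  set P : Measure E := volume.withDensity fun t => ENNReal.ofReal (φ.normed volume t) with hP
  have hm : Measurable fun t => ENNReal.ofReal (φ.normed volume t) :=
    (φ.continuous_normed (μ := volume)).measurable.ennreal_ofReal
  have : IsProbabilityMeasure P := ⟨by
    rw [hP, withDensity_apply _ MeasurableSet.univ, Measure.restrict_univ, lintegral_normed]⟩
  have hce := (φ.hasCompactSupport_normed (μ := volume)).convolutionExists_left
    (ContinuousLinearMap.lsmul ℝ ℝ : ℝ →L[ℝ] ℂ →L[ℝ] ℂ) (μ := volume) φ.continuous_normed hu x
  have hint : Integrable (fun t => φ.normed volume t • u (x - t)) := hce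
  have hint2 : Integrable (fun t => φ.normed volume t • u x) :=
    φ.integrable_normed.smul_const _
  have hmeas : AEStronglyMeasurable (fun t => u (x - t) - u x) (volume : Measure E) := by
    refine AEStronglyMeasurable.sub ?_ aestronglyMeasurable_const
    exact hu.aestronglyMeasurable.comp_quasiMeasurePreserving
      (quasiMeasurePreserving_sub_left volume x)
  have e1 : mollify φ u x - u x = ∫ t, φ.normed volume t • (u (x - t) - u x) := by
    simp only [smul_sub]
    rw [integral_sub hint hint2, integral_smul_const, φ.integral_normed, one_smul,
      mollify_apply]
  have hP' : P ≪ volume := withDensity_absolutelyContinuous _ _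
  have h1 : ‖mollify φ u x - u x‖ₑ ≤ eLpNorm (fun t => u (x - t) - u x) 1 P := by
    rw [e1, eLpNorm_one_eq_lintegral_enorm, hP,
      lintegral_withDensity_eq_lintegral_mul₀ hm.aemeasurable hmeas.enorm]
    refine (enorm_integral_le_lintegral_enorm _).trans (le_of_eq ?_)
    refine lintegral_congr fun t => ?_
    rw [enorm_smul, Pi.mul_apply, Real.enorm_eq_ofReal (φ.nonneg_normed t)]
  have h2 : eLpNorm (fun t => u (x - t) - u x) 1 P ≤ eLpNorm (fun t => u (x - t) - u x) 2 P :=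
    eLpNorm_le_eLpNorm_of_exponent_le (by norm_num) (hmeas.mono_ac hP')
  calc ‖mollify φ u x - u x‖ₑ ^ 2 ≤ (eLpNorm (fun t => u (x - t) - u x) 2 P) ^ 2 := by
        gcongr; exact h1.trans h2
    _ = ∫⁻ t, ‖u (x - t) - u x‖ₑ ^ 2 ∂P := by
        exact eLpNorm_two_sq P _
    _ = _ := by
        rw [hP, lintegral_withDensity_eq_lintegral_mul₀ hm.aemeasurable
          (hmeas.enorm.pow_const 2)]
        rfl

/-- Translations are continuous on `L²`. -/
theorem tendsto_eLpNorm_translate_sub {u : E → ℂ} (hu : MemLp u 2) :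
    Tendsto (fun t : E => eLpNorm (fun x => u (x - t) - u x) 2 volume) (𝓝 0) (𝓝 0) := by
  have hg : Continuous fun t : E => (⟨fun x => x - t, by fun_prop⟩ : C(E, E)) :=
    (ContinuousMap.mk (fun a : E × E => a.2 - a.1) (by fun_prop)).curry.continuous
  have hmp : ∀ t : E, MeasurePreserving (⟨fun x => x - t, by fun_prop⟩ : C(E, E)) volume volume :=
    fun t => measurePreserving_sub_right volume t
  have hc := (continuous_const (y := hu.toLp u)).compMeasurePreservingLp hg hmp (by norm_num)
  have h0 := (hc.tendsto 0)
  rw [Lp.tendsto_Lp_iff_tendsto_eLpNorm'] at h0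
  refine h0.congr fun t => eLpNorm_congr_ae ?_
  have q0 : ⇑(Lp.compMeasurePreserving _ (hmp t) (hu.toLp u)) =ᵐ[volume] fun x => u (x - t) :=
    (Lp.coeFn_compMeasurePreserving (hu.toLp u) (hmp t)).trans
      ((hmp t).quasiMeasurePreserving.ae_eq_comp hu.coeFn_toLp)
  have q1 : ⇑(Lp.compMeasurePreserving _ (hmp 0) (hu.toLp u)) =ᵐ[volume] fun x => u (x - 0) :=
    (Lp.coeFn_compMeasurePreserving (hu.toLp u) (hmp 0)).trans
      ((hmp 0).quasiMeasurePreserving.ae_eq_comp hu.coeFn_toLp)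
  filter_upwards [q0, q1] with x h0 h1
  rw [Pi.sub_apply, h0, h1, sub_zero]

/-- Mollifications converge in `L²` as the radius of the bump shrinks. -/
theorem exists_forall_eLpNorm_mollify_sub_le {u : E → ℂ} (hu : MemLp u 2) {η : ℝ≥0∞}
    (hη : 0 < η) :
    ∃ r : ℝ, 0 < r ∧ ∀ φ : ContDiffBump (0 : E), φ.rOut ≤ r →
      eLpNorm (mollify φ u - u) 2 volume ≤ η := by
  have h0 := tendsto_eLpNorm_translate_sub hu
  have h1 := h0.eventually (ge_mem_nhds hη)
  obtain ⟨r, hr, hb⟩ := Metric.eventually_nhds_iff.1 h1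
  refine ⟨r, hr, fun φ hφ => ?_⟩
  have hloc : LocallyIntegrable u := hu.locallyIntegrable (by norm_num)
  have key : eLpNorm (mollify φ u - u) 2 volume ^ 2 ≤ η ^ 2 := by
    rw [eLpNorm_two_sq]
    have hmeas : AEMeasurable (Function.uncurry fun x t =>
        ENNReal.ofReal (φ.normed volume t) * ‖u (x - t) - u x‖ₑ ^ 2)
        ((volume : Measure E).prod volume) := by
      refine AEMeasurable.mul (f := fun p : E × E => ENNReal.ofReal (φ.normed volume p.2))
        (g := fun p : E × E => ‖u (p.1 - p.2) - u p.1‖ₑ ^ 2) ?_ ?_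
      · exact ((φ.continuous_normed (μ := volume)).measurable.ennreal_ofReal.comp
          measurable_snd).aemeasurable
      · refine (AEStronglyMeasurable.enorm ?_).pow_const 2
        refine AEStronglyMeasurable.sub ?_ ?_
        · exact hu.1.comp_quasiMeasurePreserving
            (quasiMeasurePreserving_sub_of_right_invariant volume volume)
        · exact hu.1.comp_fst
    calc ∫⁻ x, ‖(mollify φ u - u) x‖ₑ ^ 2
        ≤ ∫⁻ x, ∫⁻ t, ENNReal.ofReal (φ.normed volume t) * ‖u (x - t) - u x‖ₑ ^ 2 :=
          lintegral_mono fun x => enorm_mollify_sub_sq_le φ hloc x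
      _ = ∫⁻ t, ∫⁻ x, ENNReal.ofReal (φ.normed volume t) * ‖u (x - t) - u x‖ₑ ^ 2 :=
          lintegral_lintegral_swap hmeas
      _ ≤ ∫⁻ t, ENNReal.ofReal (φ.normed volume t) * η ^ 2 := by
          refine lintegral_mono fun t => ?_
          rw [lintegral_const_mul' _ _ ENNReal.ofReal_ne_top,
            ← eLpNorm_two_sq volume fun x => u (x - t) - u x]
          by_cases ht : t ∈ Metric.ball (0 : E) φ.rOut
          · gcongr
            exact hb ((Metric.mem_ball.1 ht).trans_le hφ)
          · have : φ.normed volume t = 0 := by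
              rw [← φ.support_normed_eq (μ := volume)] at ht
              exact Function.notMem_support.1 ht
            simp [this]
      _ = η ^ 2 := by
          rw [lintegral_mul_const _
            (φ.continuous_normed (μ := volume)).measurable.ennreal_ofReal, lintegral_normed,
            one_mul]
  exact (ENNReal.pow_le_pow_left_iff (by norm_num)).1 key

end WeakDerivatives

/-! ### Projection onto a normalized real function -/

section Projection

variable {α : Type*} [MeasurableSpace α] {μ : Measure α} {ψ : α → ℝ} {f : α → ℂ}

theorem integrable_smul_of_memLp (hψ : MemLp ψ 2 μ) (hf : MemLp f 2 μ) :
    Integrable (fun x => ψ x • f x) μ :=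
  memLp_one_iff_integrable.1 (hf.smul hψ)

theorem integrable_norm_sq (hf : MemLp f 2 μ) : Integrable (fun x => ‖f x‖ ^ 2) μ :=
  hf.integrable_norm_pow (by norm_num)

/-- Pythagoras: the squared distance of `f` to `a ψ` is least for the projection coefficient. -/
theorem integral_norm_sub_smul_sq (hψ : MemLp ψ 2 μ) (h1 : ∫ x, ψ x ^ 2 ∂μ = 1)
    (hf : MemLp f 2 μ) (a : ℂ) :
    ∫ x, ‖f x - ψ x • a‖ ^ 2 ∂μ
      = ∫ x, ‖f x‖ ^ 2 ∂μ - ‖∫ x, ψ x • f x ∂μ‖ ^ 2 + ‖(∫ x, ψ x • f x ∂μ) - a‖ ^ 2 := by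
  have hi := integrable_smul_of_memLp hψ hf
  have hψ2 : Integrable (fun x => ψ x ^ 2) μ := by
    simpa using hψ.integrable_norm_pow (p := 2) (by norm_num)
  have hpt : ∀ x, ‖f x - ψ x • a‖ ^ 2 = ‖f x‖ ^ 2
      - 2 * (a.re * (ψ x • f x).re + a.im * (ψ x • f x).im) + ‖a‖ ^ 2 * ψ x ^ 2 := by
    intro x
    simp only [Complex.sq_norm, Complex.normSq_apply, Complex.sub_re, Complex.sub_im,
      Complex.real_smul, Complex.re_ofReal_mul, Complex.im_ofReal_mul]
    ring
  have hre : ∫ x, (ψ x • f x).re ∂μ = (∫ x, ψ x • f x ∂μ).re := integral_re hi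
  have him : ∫ x, (ψ x • f x).im ∂μ = (∫ x, ψ x • f x ∂μ).im := integral_im hi
  have ire : Integrable (fun x => (ψ x • f x).re) μ := hi.re
  have iim : Integrable (fun x => (ψ x • f x).im) μ := hi.im
  have i2 : Integrable
      (fun x => 2 * (a.re * (ψ x • f x).re + a.im * (ψ x • f x).im)) μ :=
    ((ire.const_mul _).add (iim.const_mul _)).const_mul 2
  simp only [hpt]
  have i1 : Integrable (fun x => ‖f x‖ ^ 2
      - 2 * (a.re * (ψ x • f x).re + a.im * (ψ x • f x).im)) μ := (integrable_norm_sq hf).sub i2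
  rw [integral_add i1 (hψ2.const_mul _), integral_sub (integrable_norm_sq hf) i2,
    integral_const_mul, integral_const_mul, integral_add (ire.const_mul _) (iim.const_mul _),
    integral_const_mul, integral_const_mul,
    hre, him, h1]
  simp only [Complex.sq_norm, Complex.normSq_apply, Complex.sub_re, Complex.sub_im]
  ring

theorem integral_norm_sub_proj_sq (hψ : MemLp ψ 2 μ) (h1 : ∫ x, ψ x ^ 2 ∂μ = 1)
    (hf : MemLp f 2 μ) :
    ∫ x, ‖f x - ψ x • ∫ y, ψ y • f y ∂μ‖ ^ 2 ∂μ
      = ∫ x, ‖f x‖ ^ 2 ∂μ - ‖∫ x, ψ x • f x ∂μ‖ ^ 2 := by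
  simpa using integral_norm_sub_smul_sq hψ h1 hf (∫ x, ψ x • f x ∂μ)

/-- Bessel's inequality for a single normalized function. -/
theorem norm_proj_sq_le (hψ : MemLp ψ 2 μ) (h1 : ∫ x, ψ x ^ 2 ∂μ = 1) (hf : MemLp f 2 μ) :
    ‖∫ x, ψ x • f x ∂μ‖ ^ 2 ≤ ∫ x, ‖f x‖ ^ 2 ∂μ := by
  have h := integral_norm_sub_proj_sq hψ h1 hf
  have h0 : 0 ≤ ∫ x, ‖f x - ψ x • ∫ y, ψ y • f y ∂μ‖ ^ 2 ∂μ :=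
    integral_nonneg fun x => by positivity
  linarith

end Projection

/-! ### The Gaussian ground state -/

/-- The one-dimensional normalized Gaussian ground state. -/
def psiOne (om x : ℝ) : ℝ := √√(om / Real.pi) * Real.exp (-(om / 2) * x ^ 2)

theorem psiPerp_eq_mul (om : ℝ) (q : ℝ × ℝ) : psiPerp om q = psiOne om q.1 * psiOne om q.2 := by
  have h : √√(om / Real.pi) * √√(om / Real.pi) = √(om / Real.pi) :=
    Real.mul_self_sqrt (Real.sqrt_nonneg _)
  rw [psiPerp, psiOne, psiOne, mul_add, Real.exp_add, mul_mul_mul_comm, h]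

theorem psiOne_pos {om : ℝ} (hom : 0 < om) (x : ℝ) : 0 < psiOne om x := by
  have := Real.pi_pos
  unfold psiOne
  positivity

theorem hasDerivAt_psiOne (om x : ℝ) : HasDerivAt (psiOne om) (-(om * x) * psiOne om x) x := by
  have h : HasDerivAt (fun x : ℝ => -(om / 2) * x ^ 2) (-(om * x)) x := by
    refine ((hasDerivAt_pow 2 x).const_mul (-(om / 2))).congr_deriv ?_
    simp; ring
  refine (h.exp.const_mul (√√(om / Real.pi))).congr_deriv ?_
  unfold psiOne
  ring

@[fun_prop]
theorem continuous_psiOne (om : ℝ) : Continuous (psiOne om) := by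
  unfold psiOne; fun_prop

theorem psiOne_sq {om : ℝ} (x : ℝ) :
    psiOne om x ^ 2 = √(om / Real.pi) * Real.exp (-om * x ^ 2) := by
  rw [psiOne, mul_pow, Real.sq_sqrt (Real.sqrt_nonneg _), ← Real.exp_nat_mul]
  congr 2
  push_cast; ring

theorem integral_psiOne_sq {om : ℝ} (hom : 0 < om) : ∫ x, psiOne om x ^ 2 = 1 := by
  have := Real.pi_pos
  simp only [psiOne_sq]
  rw [integral_const_mul, integral_gaussian, ← Real.sqrt_mul (by positivity)]
  have : om / Real.pi * (Real.pi / om) = 1 := by field_simp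
  rw [this, Real.sqrt_one]

theorem integrable_psiOne_sq {om : ℝ} (hom : 0 < om) : Integrable fun x => psiOne om x ^ 2 := by
  simp only [psiOne_sq]
  exact (integrable_exp_neg_mul_sq hom).const_mul _

theorem memLp_psiOne {om : ℝ} (hom : 0 < om) : MemLp (psiOne om) 2 := by
  rw [memLp_two_iff_integrable_sq (continuous_psiOne om).aestronglyMeasurable]
  exact integrable_psiOne_sq hom

theorem integrable_sq_mul_psiOne_sq {om : ℝ} (hom : 0 < om) :
    Integrable fun x => (x * psiOne om x) ^ 2 := by
  have h := (integrable_rpow_mul_exp_neg_mul_sq hom (s := 2) (by norm_num)).const_mul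
    (√(om / Real.pi))
  refine h.congr (Eventually.of_forall fun x => ?_)
  simp only [mul_pow, psiOne_sq, Real.rpow_ofNat]
  ring

theorem memLp_mul_psiOne {om : ℝ} (hom : 0 < om) : MemLp (fun x => x * psiOne om x) 2 := by
  rw [memLp_two_iff_integrable_sq (by fun_prop)]
  exact integrable_sq_mul_psiOne_sq hom

/-- The second moment of the Gaussian density, from `∫ (x ψ²)' = 0`. -/
theorem integral_sq_mul_psiOne_sq {om : ℝ} (hom : 0 < om) :
    om * ∫ x, (x * psiOne om x) ^ 2 = 1 / 2 := by
  have hd : ∀ x, HasDerivAt (fun x => x * psiOne om x ^ 2)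
      (psiOne om x ^ 2 - 2 * om * (x * psiOne om x) ^ 2) x := by
    intro x
    refine ((hasDerivAt_id x).mul ((hasDerivAt_psiOne om x).pow 2)).congr_deriv ?_
    simp; ring
  have h1 : Integrable fun x => x * psiOne om x ^ 2 := by
    have := (memLp_mul_psiOne hom).integrable_mul (memLp_psiOne hom)
    refine this.congr (Eventually.of_forall fun x => ?_)
    simp; ring
  have h2 := (integrable_sq_mul_psiOne_sq hom).const_mul (2 * om)
  have h := integral_eq_zero_of_hasDerivAt_of_integrable hd
    ((integrable_psiOne_sq hom).sub h2) h1
  rw [integral_sub (integrable_psiOne_sq hom) h2, integral_psiOne_sq hom,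
    integral_const_mul] at h
  linarith

@[fun_prop]
theorem continuous_psiPerp (om : ℝ) : Continuous (psiPerp om) := by
  unfold psiPerp; fun_prop

theorem integral_psiPerp_sq {om : ℝ} (hom : 0 < om) : ∫ q, psiPerp om q ^ 2 = 1 := by
  simp only [psiPerp_eq_mul, mul_pow]
  rw [Measure.volume_eq_prod, integral_prod_mul (fun x => psiOne om x ^ 2)
    (fun x => psiOne om x ^ 2), integral_psiOne_sq hom, one_mul]

theorem memLp_psiPerp {om : ℝ} (hom : 0 < om) : MemLp (psiPerp om) 2 := by
  rw [memLp_two_iff_integrable_sq (continuous_psiPerp om).aestronglyMeasurable]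
  simp only [psiPerp_eq_mul, mul_pow]
  exact (integrable_psiOne_sq hom).mul_prod (integrable_psiOne_sq hom)

/-! ### The spectral gap of the harmonic oscillator -/

/-- The weighted Hardy-type inequality behind the spectral gap. With `θ x = 1 / (2 (x + a))`,
`om a² = 1`, the integrand `‖f' + om x f‖² - om ‖f‖² / 4` dominates the derivative of
`θ ‖f‖²`, which vanishes at `0` and is nonnegative at `R`. -/
theorem integral_norm_sq_le_of_eq_zero {om : ℝ} (hom : 0 < om) {f f' : ℝ → ℂ}
    (hf : ∀ x, HasDerivAt f (f' x) x) (hf' : Continuous f') (h0 : f 0 = 0) {R : ℝ} (hR : 0 ≤ R) :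
    ∫ x in (0)..R, ‖f x‖ ^ 2 ≤ 4 / om * ∫ x in (0)..R, ‖f' x + (om * x : ℝ) • f x‖ ^ 2 := by
  have hfc : Continuous f := continuous_iff_continuousAt.2 fun x => (hf x).continuousAt
  set a : ℝ := 1 / √om with ha
  have hapos : 0 < a := by positivity
  have ha2 : om * a ^ 2 = 1 := by
    rw [ha, div_pow, Real.sq_sqrt hom.le]; field_simp
  set H' : ℝ → ℝ := fun x => -(1 / (2 * (x + a) ^ 2)) * ‖f x‖ ^ 2
    + 1 / (2 * (x + a)) * (2 * ((f x).re * (f' x).re + (f x).im * (f' x).im)) with hH'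
  have hderiv : ∀ x ∈ uIcc 0 R,
      HasDerivAt (fun x => 1 / (2 * (x + a)) * ‖f x‖ ^ 2) (H' x) x := by
    intro x hx
    rw [uIcc_of_le hR] at hx
    have hxa : x + a ≠ 0 := by have := hx.1; positivity
    have h1 : HasDerivAt (fun x : ℝ => 1 / (2 * (x + a))) (-(1 / (2 * (x + a) ^ 2))) x := by
      have := (((hasDerivAt_id x).add_const a).const_mul 2).inv (by simpa using hxa)
      simp only [one_div]
      refine this.congr_deriv ?_
      simp only [id]
      field_simp
    have h2 : HasDerivAt (fun x => ‖f x‖ ^ 2)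
        (2 * ((f x).re * (f' x).re + (f x).im * (f' x).im)) x := by
      refine (hf x).norm_sq.congr_deriv ?_
      rw [Complex.inner]
      simp only [Complex.mul_re, Complex.conj_re, Complex.conj_im]
      ring
    exact h1.mul h2
  have hint : IntervalIntegrable H' volume 0 R := by
    apply ContinuousOn.intervalIntegrable
    rw [uIcc_of_le hR]
    refine ContinuousOn.add (ContinuousOn.mul (ContinuousOn.neg (ContinuousOn.div
      continuousOn_const (by fun_prop) ?_)) (by fun_prop)) (ContinuousOn.mul (ContinuousOn.div
      continuousOn_const (by fun_prop) ?_) (by fun_prop)) <;>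
    · intro x hx
      have := hx.1
      positivity
  have hFTC := intervalIntegral.integral_eq_sub_of_hasDerivAt hderiv hint
  rw [h0] at hFTC
  have hpos : 0 ≤ ∫ x in (0)..R, H' x := by
    rw [hFTC]
    simp only [norm_zero, ne_eq, OfNat.ofNat_ne_zero, not_false_eq_true, zero_pow, mul_zero,
      sub_zero]
    positivity
  have hle : ∫ x in (0)..R, H' x ≤
      ∫ x in (0)..R, (‖f' x + (om * x : ℝ) • f x‖ ^ 2 - om / 4 * ‖f x‖ ^ 2) := by
    refine intervalIntegral.integral_mono_on hR hint
      (Continuous.intervalIntegrable (by fun_prop) _ _) fun x hx => ?_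
    have hx0 := hx.1
    have hxa : 0 < x + a := by positivity
    set θ : ℝ := 1 / (2 * (x + a)) with hθ
    have e1 : 1 / (2 * (x + a) ^ 2) = 2 * θ ^ 2 := by rw [hθ]; field_simp
    have key : om / 4 ≤ θ ^ 2 + 2 * θ * (om * x) := by
      have : θ ^ 2 + 2 * θ * (om * x) - om / 4
          = (3 * om * x ^ 2 + 2 * om * x * a) / (4 * (x + a) ^ 2) := by
        rw [hθ, _root_.eq_div_iff (by positivity)]
        field_simp
        nlinarith [ha2]
      have h2 : 0 ≤ (3 * om * x ^ 2 + 2 * om * x * a) / (4 * (x + a) ^ 2) := by positivity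
      linarith
    have comp : ∀ u u' : ℝ, -(2 * θ ^ 2) * u ^ 2 + θ * (2 * (u * u'))
        ≤ (u' + om * x * u) ^ 2 - om / 4 * u ^ 2 := by
      intro u u'
      nlinarith [sq_nonneg (u' + om * x * u - θ * u), mul_le_mul_of_nonneg_right key (sq_nonneg u)]
    have hr := comp (f x).re (f' x).re
    have hi := comp (f x).im (f' x).im
    simp only [hH', e1, Complex.sq_norm, Complex.normSq_apply, Complex.add_re, Complex.add_im,
      Complex.real_smul, Complex.re_ofReal_mul, Complex.im_ofReal_mul]
    nlinarith [hr, hi]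
  rw [intervalIntegral.integral_sub (Continuous.intervalIntegrable (by fun_prop) _ _)
    (Continuous.intervalIntegrable (by fun_prop) _ _), intervalIntegral.integral_const_mul] at hle
  rw [div_mul_eq_mul_div, le_div_iff₀ hom]
  linarith

/-- Spectral gap of the one-dimensional harmonic oscillator; the constant is not sharp. The distance
to the ground state is estimated by the norm of `f - ψ α`, which vanishes at the origin for a
suitable `α` and has the same image as `f` under `d/dx + om x`. -/
theorem gap_one {om : ℝ} (hom : 0 < om) {f f' : ℝ → ℂ} (hf : ∀ x, HasDerivAt f (f' x) x)
    (hf' : Continuous f') (hs : HasCompactSupport f) :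
    ∫ x, ‖f x - psiOne om x • ∫ y, psiOne om y • f y‖ ^ 2
      ≤ 4 / om * ∫ x, ‖f' x + (om * x : ℝ) • f x‖ ^ 2 := by
  have hfc : Continuous f := continuous_iff_continuousAt.2 fun x => (hf x).continuousAt
  have hs' : HasCompactSupport f' := by
    have : f' = deriv f := funext fun x => (hf x).deriv.symm
    rw [this]; exact hs.deriv
  have hfL : MemLp f 2 := hfc.memLp_of_hasCompactSupport hs
  have hψ := memLp_psiOne hom
  have h1 := integral_psiOne_sq hom
  -- subtract the multiple of the ground state which makes the function vanish at the origin
  set α : ℂ := (psiOne om 0)⁻¹ • f 0 with hα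
  set k : ℝ → ℂ := fun x => f x - psiOne om x • α with hk
  set k' : ℝ → ℂ := fun x => f' x + (om * x * psiOne om x) • α with hk'
  have hk0 : k 0 = 0 := by
    simp only [hk, hα, smul_smul, mul_inv_cancel₀ (psiOne_pos hom 0).ne', one_smul, sub_self]
  have hkd : ∀ x, HasDerivAt k (k' x) x := by
    intro x
    refine ((hf x).sub ((hasDerivAt_psiOne om x).smul_const α)).congr_deriv ?_
    simp only [hk', neg_mul, neg_smul, sub_neg_eq_add]
  have hkc' : Continuous k' := by fun_prop
  have hkc : Continuous k := by fun_prop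
  have hD : ∀ x, k' x + (om * x : ℝ) • k x = f' x + (om * x : ℝ) • f x := by
    intro x
    simp only [hk, hk', smul_sub, smul_smul]
    abel
  have hkL : MemLp k 2 := hfL.sub (by
    have := (memLp_psiOne hom).ofReal (K := ℂ)
    refine (this.mul_const α).congr_norm (by fun_prop) (Eventually.of_forall fun x => ?_)
    simp)
  have iR : Integrable fun x => ‖f' x + (om * x : ℝ) • f x‖ ^ 2 := by
    refine Continuous.integrable_of_hasCompactSupport (by fun_prop) ?_
    have hc : HasCompactSupport fun x => f' x + (om * x : ℝ) • f x :=
      hs'.add (hs.smul_left (f := fun x : ℝ => om * x))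
    exact hc.comp_left (g := fun z : ℂ => ‖z‖ ^ 2) (by simp)
  have hfin : ∀ R : ℝ, 0 ≤ R → ∫ x in (-R)..R, ‖k x‖ ^ 2
      ≤ 4 / om * ∫ x in (-R)..R, ‖f' x + (om * x : ℝ) • f x‖ ^ 2 := by
    intro R hR
    have hpos := integral_norm_sq_le_of_eq_zero hom hkd hkc' hk0 hR
    have hneg := integral_norm_sq_le_of_eq_zero hom (f := fun x => k (-x))
      (f' := fun x => -k' (-x)) (fun x => by
        have h := (hkd (-x)).scomp x (hasDerivAt_neg x)
        rwa [neg_one_smul] at h) (by fun_prop) (by simpa using hk0) hR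
    have e1 : ∫ x in (0)..R, ‖k (-x)‖ ^ 2 = ∫ x in (-R)..0, ‖k x‖ ^ 2 := by
      simpa using intervalIntegral.integral_comp_neg (fun x => ‖k x‖ ^ 2) (a := 0) (b := R)
    have e2 : ∫ x in (0)..R, ‖-k' (-x) + (om * x : ℝ) • k (-x)‖ ^ 2
        = ∫ x in (-R)..0, ‖k' x + (om * x : ℝ) • k x‖ ^ 2 := by
      have := intervalIntegral.integral_comp_neg
        (fun x => ‖k' x + (om * x : ℝ) • k x‖ ^ 2) (a := 0) (b := R)
      simp only [neg_zero] at this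
      rw [← this]
      refine intervalIntegral.integral_congr fun x _ => ?_
      have : -k' (-x) + (om * x : ℝ) • k (-x) = -(k' (-x) + (om * -x : ℝ) • k (-x)) := by
        simp only [mul_neg, neg_smul]; abel
      simp only [this, norm_neg]
    rw [e1, e2] at hneg
    simp only [hD] at hpos hneg
    rw [← intervalIntegral.integral_add_adjacent_intervals (a := -R) (b := 0) (c := R)
      (Continuous.intervalIntegrable (by fun_prop) _ _)
      (Continuous.intervalIntegrable (by fun_prop) _ _),
      ← intervalIntegral.integral_add_adjacent_intervals (a := -R) (b := 0) (c := R)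
      (f := fun x => ‖f' x + (om * x : ℝ) • f x‖ ^ 2)
      (Continuous.intervalIntegrable (by fun_prop) _ _)
      (Continuous.intervalIntegrable (by fun_prop) _ _), mul_add]
    linarith
  have hk_le : ∫ x, ‖k x‖ ^ 2 ≤ 4 / om * ∫ x, ‖f' x + (om * x : ℝ) • f x‖ ^ 2 := by
    refine le_of_tendsto_of_tendsto
      (intervalIntegral_tendsto_integral (integrable_norm_sq hkL) tendsto_neg_atTop_atBot
        tendsto_id)
      ((intervalIntegral_tendsto_integral iR tendsto_neg_atTop_atBot tendsto_id).const_mul _) ?_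
    filter_upwards [eventually_ge_atTop 0] with R hR
    exact hfin R hR
  refine le_trans ?_ hk_le
  rw [integral_norm_sub_proj_sq hψ h1 hfL, integral_norm_sub_smul_sq hψ h1 hfL]
  have := sq_nonneg ‖(∫ x, psiOne om x • f x) - α‖
  linarith

/-! ### Tensorization of the spectral gap -/

section Parametric

variable {α : Type*} [TopologicalSpace α] [MeasurableSpace α] [OpensMeasurableSpace α]
  {μ : Measure α} [IsLocallyFiniteMeasure μ]

theorem continuous_integral_of_vanishing {K : Set α} (hK : IsCompact K)
    {F : α → ℝ → ℂ} (hF : Continuous (Function.uncurry F)) (h0 : ∀ x ∉ K, ∀ t, F x t = 0) :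
    Continuous fun t => ∫ x, F x t ∂μ := by
  have h : (fun t => ∫ x, F x t ∂μ) = fun t => ∫ x in K, F x t ∂μ :=
    funext fun t => (setIntegral_eq_integral_of_forall_compl_eq_zero fun x hx => h0 x hx t).symm
  rw [h]
  exact continuous_parametric_integral_of_continuous (f := fun t x => F x t)
    (hF.comp continuous_swap) hK

/-- Differentiation under the integral sign for integrands vanishing off a fixed compact set. -/
theorem hasDerivAt_integral_of_vanishing {K : Set α} (hK : IsCompact K) (hKm : MeasurableSet K)
    {F F' : α → ℝ → ℂ} (hF : Continuous (Function.uncurry F))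
    (hF' : Continuous (Function.uncurry F')) (h0 : ∀ x ∉ K, ∀ t, F x t = 0)
    (h0' : ∀ x ∉ K, ∀ t, F' x t = 0) (hd : ∀ x t, HasDerivAt (F x) (F' x t) t) (t : ℝ) :
    HasDerivAt (fun t => ∫ x, F x t ∂μ) (∫ x, F' x t ∂μ) t := by
  have h : (fun t => ∫ x, F x t ∂μ) = fun t => ∫ x in K, F x t ∂μ :=
    funext fun t => (setIntegral_eq_integral_of_forall_compl_eq_zero fun x hx => h0 x hx t).symm
  rw [h, ← setIntegral_eq_integral_of_forall_compl_eq_zero fun x hx => h0' x hx t]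
  obtain ⟨M, hM⟩ := (hK.prod (isCompact_Icc (a := t - 1) (b := t + 1))).exists_bound_of_continuousOn
    hF'.continuousOn
  have hfin : IsFiniteMeasure (μ.restrict K) := ⟨by simpa using hK.measure_lt_top⟩
  have hFt : ∀ t, Continuous fun x => F x t := fun t =>
    hF.comp (by fun_prop : Continuous fun x => (x, t))
  have hFt' : ∀ t, Continuous fun x => F' x t :=
    fun t => hF'.comp (by fun_prop : Continuous fun x => (x, t))
  refine (hasDerivAt_integral_of_dominated_loc_of_deriv_le
    (F' := fun t x => F' x t) (s := Ioo (t - 1) (t + 1))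
    (bound := fun _ => M) (Ioo_mem_nhds (by linarith) (by linarith))
    (Eventually.of_forall fun s => (hFt s).aestronglyMeasurable) ?_
    (hFt' t).aestronglyMeasurable ?_ (integrable_const M) ?_).2
  · exact ((hFt t).continuousOn.integrableOn_compact' hK hKm)
  · filter_upwards [ae_restrict_mem hKm] with x hx s hs
    exact hM (x, s) ⟨hx, Ioo_subset_Icc_self hs⟩
  · exact Eventually.of_forall fun x s _ => hd x s

end Parametric

theorem hasCompactSupport_of_box {f : ℝ × ℝ → ℂ} {R : ℝ}
    (h : ∀ q : ℝ × ℝ, R < |q.1| ∨ R < |q.2| → f q = 0) : HasCompactSupport f := by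
  refine HasCompactSupport.intro ((isCompact_Icc (a := -R) (b := R)).prod
    (isCompact_Icc (a := -R) (b := R))) fun q hq => h q ?_
  by_contra hcon
  push Not at hcon
  exact hq ⟨abs_le.1 hcon.1, abs_le.1 hcon.2⟩

theorem hasCompactSupport_of_Icc {f : ℝ → ℂ} {R : ℝ}
    (h : ∀ x, R < |x| → f x = 0) : HasCompactSupport f := by
  refine HasCompactSupport.intro (isCompact_Icc (a := -R) (b := R)) fun x hx => h x ?_
  by_contra hcon
  push Not at hcon
  exact hx (abs_le.1 hcon)

/-- Spectral gap of the two-dimensional harmonic oscillator, obtained by projecting onto the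
Gaussian in one variable after the other. -/
theorem gap_two {om : ℝ} (hom : 0 < om) {f fx fy : ℝ × ℝ → ℂ} (hf : Continuous f)
    (hfx : Continuous fx) (hfy : Continuous fy)
    (hdx : ∀ x y, HasDerivAt (fun x => f (x, y)) (fx (x, y)) x)
    (hdy : ∀ x y, HasDerivAt (fun y => f (x, y)) (fy (x, y)) y) {R : ℝ}
    (h0 : ∀ q : ℝ × ℝ, R < |q.1| ∨ R < |q.2| → f q = 0)
    (h0x : ∀ q : ℝ × ℝ, R < |q.1| ∨ R < |q.2| → fx q = 0)
    (h0y : ∀ q : ℝ × ℝ, R < |q.1| ∨ R < |q.2| → fy q = 0) :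
    ∫ q, ‖f q - psiPerp om q • ∫ q', psiPerp om q' • f q'‖ ^ 2
      ≤ 4 / om * ∫ q, (‖fx q + (om * q.1 : ℝ) • f q‖ ^ 2
        + ‖fy q + (om * q.2 : ℝ) • f q‖ ^ 2) := by
  have hψ := memLp_psiOne hom
  have h1 := integral_psiOne_sq hom
  set c1 : ℝ → ℂ := fun y => ∫ x, psiOne om x • f (x, y) with hc1
  set c1' : ℝ → ℂ := fun y => ∫ x, psiOne om x • fy (x, y) with hc1'
  set c : ℂ := ∫ q', psiPerp om q' • f q' with hc
  have hK : ∀ {x : ℝ}, x ∉ Icc (-R) R → R < |x| := by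
    intro x hx
    by_contra hcon
    exact hx (abs_le.1 (not_lt.1 hcon))
  have hs : HasCompactSupport f := hasCompactSupport_of_box h0
  have hsx : HasCompactSupport fx := hasCompactSupport_of_box h0x
  have hsy : HasCompactSupport fy := hasCompactSupport_of_box h0y
  have hsl : ∀ y, HasCompactSupport fun x => f (x, y) := fun y =>
    hasCompactSupport_of_Icc fun x hx => h0 (x, y) (Or.inl hx)
  have hsly : ∀ y, HasCompactSupport fun x => fy (x, y) := fun y =>
    hasCompactSupport_of_Icc fun x hx => h0y (x, y) (Or.inl hx)
  have hfl : ∀ y, MemLp (fun x => f (x, y)) 2 := fun y =>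
    (by fun_prop : Continuous fun x => f (x, y)).memLp_of_hasCompactSupport (hsl y)
  have hfL : MemLp f 2 := hf.memLp_of_hasCompactSupport hs
  have hc1d : ∀ y, HasDerivAt c1 (c1' y) y := by
    refine hasDerivAt_integral_of_vanishing (isCompact_Icc (a := -R) (b := R)) measurableSet_Icc
      (F := fun x y => psiOne om x • f (x, y)) (F' := fun x y => psiOne om x • fy (x, y))
      (by fun_prop) (by fun_prop) (fun x hx t => ?_) (fun x hx t => ?_)
      (fun x t => (hdy x t).fun_const_smul _)
    · rw [h0 (x, t) (Or.inl (hK hx)), smul_zero]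
    · rw [h0y (x, t) (Or.inl (hK hx)), smul_zero]
  have hc1c' : Continuous c1' := by
    refine continuous_integral_of_vanishing (isCompact_Icc (a := -R) (b := R))
      (F := fun x y => psiOne om x • fy (x, y)) (by fun_prop) (fun x hx t => ?_)
    rw [h0y (x, t) (Or.inl (hK hx)), smul_zero]
  have hc1s : HasCompactSupport c1 := hasCompactSupport_of_Icc (R := R) fun y hy => by
    simp only [hc1, h0 (_, y) (Or.inr hy), smul_zero, integral_zero]
  have hc1c : Continuous c1 := continuous_iff_continuousAt.2 fun x => (hc1d x).continuousAt
  have hψf : Integrable fun q => psiPerp om q • f q :=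
    integrable_smul_of_memLp (memLp_psiPerp hom) hfL
  have hcc : c = ∫ y, psiOne om y • c1 y := by
    rw [hc, Measure.volume_eq_prod, integral_prod_symm _ (by rwa [← Measure.volume_eq_prod])]
    refine integral_congr_ae (Eventually.of_forall fun y => ?_)
    simp only [hc1]
    rw [← integral_smul]
    refine integral_congr_ae (Eventually.of_forall fun x => ?_)
    simp only [psiPerp_eq_mul, smul_smul]
    rw [mul_comm]
  -- integrability of all the functions of two variables
  have iA : Integrable fun q => ‖f q - psiPerp om q • c‖ ^ 2 := by
    have : MemLp (fun q => f q - psiPerp om q • c) 2 := hfL.sub (by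
      have := (memLp_psiPerp hom).ofReal (K := ℂ)
      refine (this.mul_const c).congr_norm (by fun_prop) (Eventually.of_forall fun x => ?_)
      simp)
    exact integrable_norm_sq this
  have iB : Integrable fun q : ℝ × ℝ => ‖fx q + (om * q.1 : ℝ) • f q‖ ^ 2 := by
    refine Continuous.integrable_of_hasCompactSupport (by fun_prop) ?_
    have hc : HasCompactSupport fun q : ℝ × ℝ => fx q + (om * q.1 : ℝ) • f q :=
      hsx.add (hs.smul_left (f := fun q : ℝ × ℝ => om * q.1))
    exact hc.comp_left (g := fun z : ℂ => ‖z‖ ^ 2) (by simp)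
  have iC : Integrable fun q : ℝ × ℝ => ‖fy q + (om * q.2 : ℝ) • f q‖ ^ 2 := by
    refine Continuous.integrable_of_hasCompactSupport (by fun_prop) ?_
    have hc : HasCompactSupport fun q : ℝ × ℝ => fy q + (om * q.2 : ℝ) • f q :=
      hsy.add (hs.smul_left (f := fun q : ℝ × ℝ => om * q.2))
    exact hc.comp_left (g := fun z : ℂ => ‖z‖ ^ 2) (by simp)
  have iD : Integrable fun y => ‖c1 y - psiOne om y • c‖ ^ 2 := by
    have : MemLp (fun q => c1 q - psiOne om q • c) 2 :=
      (hc1c.memLp_of_hasCompactSupport hc1s).sub (by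
      have := hψ.ofReal (K := ℂ)
      refine (this.mul_const c).congr_norm (by fun_prop) (Eventually.of_forall fun x => ?_)
      simp)
    exact integrable_norm_sq this
  -- the gap in `x` for each fixed `y`
  have hslice : ∀ y, ∫ x, ‖f (x, y) - psiPerp om (x, y) • c‖ ^ 2
      ≤ 4 / om * (∫ x, ‖fx (x, y) + (om * x : ℝ) • f (x, y)‖ ^ 2)
        + ‖c1 y - psiOne om y • c‖ ^ 2 := by
    intro y
    have e := integral_norm_sub_smul_sq hψ h1 (hfl y) (psiOne om y • c)
    have e' := integral_norm_sub_proj_sq hψ h1 (hfl y)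
    have g := gap_one hom (fun x => hdx x y) (by fun_prop) (hsl y)
    simp only [smul_smul, ← psiPerp_eq_mul om (_, y)] at e
    rw [e, ← e']
    exact add_le_add_left g _
  -- the gap in `y` for the projection
  have hproj : ∫ y, ‖c1 y - psiOne om y • c‖ ^ 2
      ≤ 4 / om * ∫ y, ∫ x, ‖fy (x, y) + (om * y : ℝ) • f (x, y)‖ ^ 2 := by
    rw [hcc]
    refine (gap_one hom hc1d hc1c' hc1s).trans ?_
    gcongr
    · have : HasCompactSupport fun y => c1' y + (om * y : ℝ) • c1 y := by
        have h1 : c1' = deriv c1 := funext fun x => (hc1d x).deriv.symm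
        rw [h1]
        exact hc1s.deriv.add (hc1s.smul_left (f := fun y : ℝ => om * y))
      refine Continuous.integrable_of_hasCompactSupport (by fun_prop) ?_
      exact this.comp_left (g := fun z : ℂ => ‖z‖ ^ 2) (by simp)
    · rw [Measure.volume_eq_prod] at iC
      exact iC.integral_prod_right
    · intro y
      have hfyL : MemLp (fun x => fy (x, y) + (om * y : ℝ) • f (x, y)) 2 :=
        ((by fun_prop : Continuous fun x => fy (x, y)).memLp_of_hasCompactSupport (hsly y)).add
          ((hfl y).const_smul (om * y : ℝ))
      refine le_trans (le_of_eq ?_) (norm_proj_sq_le hψ h1 hfyL)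
      simp only [hc1, hc1', smul_add]
      rw [integral_add, ← integral_smul]
      · simp only [smul_comm (om * y)]
      · exact integrable_smul_of_memLp hψ
          ((by fun_prop : Continuous fun x => fy (x, y)).memLp_of_hasCompactSupport (hsly y))
      · exact integrable_smul_of_memLp hψ ((hfl y).const_smul (om * y : ℝ))
  have eA : ∫ q, ‖f q - psiPerp om q • c‖ ^ 2
      = ∫ y, ∫ x, ‖f (x, y) - psiPerp om (x, y) • c‖ ^ 2 := by
    rw [Measure.volume_eq_prod] at iA ⊢
    exact integral_prod_symm _ iA
  have eB : ∫ q : ℝ × ℝ, ‖fx q + (om * q.1 : ℝ) • f q‖ ^ 2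
      = ∫ y, ∫ x, ‖fx (x, y) + (om * x : ℝ) • f (x, y)‖ ^ 2 := by
    rw [Measure.volume_eq_prod] at iB ⊢
    exact integral_prod_symm _ iB
  have eC : ∫ q : ℝ × ℝ, ‖fy q + (om * q.2 : ℝ) • f q‖ ^ 2
      = ∫ y, ∫ x, ‖fy (x, y) + (om * y : ℝ) • f (x, y)‖ ^ 2 := by
    rw [Measure.volume_eq_prod] at iC ⊢
    exact integral_prod_symm _ iC
  have iA' : Integrable fun y => ∫ x, ‖f (x, y) - psiPerp om (x, y) • c‖ ^ 2 := by
    rw [Measure.volume_eq_prod] at iA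
    exact iA.integral_prod_right
  have iB' : Integrable fun y => ∫ x, ‖fx (x, y) + (om * x : ℝ) • f (x, y)‖ ^ 2 := by
    rw [Measure.volume_eq_prod] at iB
    exact iB.integral_prod_right
  rw [integral_add iB iC, eA, eB, eC, mul_add]
  calc ∫ y, ∫ x, ‖f (x, y) - psiPerp om (x, y) • c‖ ^ 2
      ≤ ∫ y, (4 / om * (∫ x, ‖fx (x, y) + (om * x : ℝ) • f (x, y)‖ ^ 2)
        + ‖c1 y - psiOne om y • c‖ ^ 2) :=
        integral_mono iA' ((iB'.const_mul _).add iD) hslice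
    _ = 4 / om * (∫ y, ∫ x, ‖fx (x, y) + (om * x : ℝ) • f (x, y)‖ ^ 2)
        + ∫ y, ‖c1 y - psiOne om y • c‖ ^ 2 := by
        rw [integral_add (iB'.const_mul _) iD, integral_const_mul]
    _ ≤ _ := by gcongr

/-! ### Integration over the periodicity cell -/

theorem restrict_cell3 (L : ℝ) : volume.restrict (cell3 L) = (volume : Measure ℝ).prod
    ((volume : Measure ℝ).prod (volume.restrict (Ioo (-(L / 2)) (L / 2)))) := by
  have h : cell3 L = univ ×ˢ (univ ×ˢ Ioo (-(L / 2)) (L / 2)) := by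
    ext p; simp [cell3]
  rw [h, Measure.volume_eq_prod, ← Measure.prod_restrict, Measure.volume_eq_prod,
    ← Measure.prod_restrict]
  simp only [Measure.restrict_univ]

theorem measurableSet_cell3 (L : ℝ) : MeasurableSet (cell3 L) :=
  measurableSet_Ioo.preimage (measurable_snd.comp measurable_snd)

theorem lintegral_cell3 (L : ℝ) {F : ℝ × ℝ × ℝ → ℝ≥0∞} (hF : Measurable F) :
    ∫⁻ p in cell3 L, F p
      = ∫⁻ z in Ioo (-(L / 2)) (L / 2), ∫⁻ x, ∫⁻ y, F (x, y, z) := by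
  rw [restrict_cell3, lintegral_prod _ hF.aemeasurable]
  have h : ∀ x, ∫⁻ q, F (x, q) ∂((volume : Measure ℝ).prod (volume.restrict
      (Ioo (-(L / 2)) (L / 2)))) = ∫⁻ z in Ioo (-(L / 2)) (L / 2), ∫⁻ y, F (x, y, z) := fun x =>
    lintegral_prod_symm _ (hF.comp measurable_prodMk_left).aemeasurable
  simp only [h]
  refine lintegral_lintegral_swap (Measurable.aemeasurable ?_)
  exact Measurable.lintegral_prod_right (f := fun (p : ℝ × ℝ) y => F (p.1, y, p.2))
    (hF.comp (by fun_prop))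

theorem measurePreserving_cell3 (L : ℝ) :
    MeasurePreserving (fun p : (ℝ × ℝ) × ℝ => (p.1.1, p.1.2, p.2))
      ((volume : Measure (ℝ × ℝ)).prod (volume.restrict (Ioo (-(L / 2)) (L / 2))))
      (volume.restrict (cell3 L)) := by
  rw [restrict_cell3]
  exact measurePreserving_prodAssoc (volume : Measure ℝ) (volume : Measure ℝ) _

theorem integrable_cell3_iff (L : ℝ) {F : ℝ × ℝ × ℝ → ℝ} :
    Integrable F (volume.restrict (cell3 L)) ↔
    Integrable (fun p : (ℝ × ℝ) × ℝ => F (p.1.1, p.1.2, p.2))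
      ((volume : Measure (ℝ × ℝ)).prod (volume.restrict (Ioo (-(L / 2)) (L / 2)))) :=
  ((measurePreserving_cell3 L).integrable_comp_emb
    (MeasurableEquiv.prodAssoc (α := ℝ) (β := ℝ) (γ := ℝ)).measurableEmbedding).symm

theorem integral_cell3 (L : ℝ) {F : ℝ × ℝ × ℝ → ℝ}
    (hF : Integrable F (volume.restrict (cell3 L))) :
    ∫ p in cell3 L, F p
      = ∫ z in Ioo (-(L / 2)) (L / 2), ∫ q : ℝ × ℝ, F (q.1, q.2, z) := by
  rw [← (measurePreserving_cell3 L).integral_comp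
    (MeasurableEquiv.prodAssoc (α := ℝ) (β := ℝ) (γ := ℝ)).measurableEmbedding F]
  exact integral_prod_symm _ ((integrable_cell3_iff L).1 hF)

/-- An inequality between the integrals over all horizontal slices can be integrated. -/
theorem integral_cell3_mono {L : ℝ} {F G : ℝ × ℝ × ℝ → ℝ}
    (hF : Integrable F (volume.restrict (cell3 L))) (hG : Integrable G (volume.restrict (cell3 L)))
    (h : ∀ z, ∫ q : ℝ × ℝ, F (q.1, q.2, z) ≤ ∫ q : ℝ × ℝ, G (q.1, q.2, z)) :
    ∫ p in cell3 L, F p ≤ ∫ p in cell3 L, G p := by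
  rw [integral_cell3 L hF, integral_cell3 L hG]
  exact integral_mono ((integrable_cell3_iff L).1 hF).integral_prod_right
    ((integrable_cell3_iff L).1 hG).integral_prod_right h

/-- No boundary terms in the direction `x`. -/
theorem integral_cell3_deriv_x {L : ℝ} {G G' : ℝ × ℝ × ℝ → ℝ}
    (hd : ∀ x y z, HasDerivAt (fun x => G (x, y, z)) (G' (x, y, z)) x)
    (hG : Integrable G (volume.restrict (cell3 L)))
    (hG' : Integrable G' (volume.restrict (cell3 L))) : ∫ p in cell3 L, G' p = 0 := by
  rw [restrict_cell3] at hG hG' ⊢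
  rw [integral_prod_symm _ hG']
  refine integral_eq_zero_of_ae ?_
  filter_upwards [hG.prod_left_ae, hG'.prod_left_ae] with q h1 h2
  exact integral_eq_zero_of_hasDerivAt_of_integrable (fun x => hd x q.1 q.2) h2 h1

/-- No boundary terms in the direction `y`. -/
theorem integral_cell3_deriv_y {L : ℝ} {G G' : ℝ × ℝ × ℝ → ℝ}
    (hd : ∀ x y z, HasDerivAt (fun y => G (x, y, z)) (G' (x, y, z)) y)
    (hG : Integrable G (volume.restrict (cell3 L)))
    (hG' : Integrable G' (volume.restrict (cell3 L))) : ∫ p in cell3 L, G' p = 0 := by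
  rw [restrict_cell3] at hG hG' ⊢
  rw [integral_prod _ hG']
  refine integral_eq_zero_of_ae ?_
  filter_upwards [hG.prod_right_ae, hG'.prod_right_ae] with x h1 h2
  rw [integral_prod_symm _ h2]
  refine integral_eq_zero_of_ae ?_
  filter_upwards [h1.prod_left_ae, h2.prod_left_ae] with z h3 h4
  exact integral_eq_zero_of_hasDerivAt_of_integrable (fun y => hd x y z) h4 h3

/-! ### An anisotropic Gagliardo-Nirenberg inequality -/

/-- The fundamental theorem of calculus for `‖h‖²`, together with `|(‖h‖²)'| ≤ 2 ‖h‖ ‖h'‖`. -/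
theorem enorm_sq_le_add_lintegral {h h' : ℝ → ℂ} (hd : ∀ x, HasDerivAt h (h' x) x)
    (hc : Continuous h') (a b : ℝ) {s : Set ℝ} (hs : uIoc a b ⊆ s) :
    ‖h b‖ₑ ^ 2 ≤ ‖h a‖ₑ ^ 2 + ∫⁻ x in s, 2 * (‖h x‖ₑ * ‖h' x‖ₑ) := by
  have hcont : Continuous h := continuous_iff_continuousAt.2 fun x => (hd x).continuousAt
  set D : ℝ → ℝ := fun x => 2 * ((h x).re * (h' x).re + (h x).im * (h' x).im) with hD
  have hDc : Continuous D := by fun_prop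
  have hderiv : ∀ x, HasDerivAt (fun x => ‖h x‖ ^ 2) (D x) x := by
    intro x
    refine (hd x).norm_sq.congr_deriv ?_
    rw [Complex.inner]
    simp only [Complex.mul_re, Complex.conj_re, Complex.conj_im, hD]
    ring
  have hDle : ∀ x, |D x| ≤ 2 * (‖h x‖ * ‖h' x‖) := by
    intro x
    have h1 : (h x).re * (h' x).re + (h x).im * (h' x).im
        = ((starRingEnd ℂ) (h x) * h' x).re := by
      simp only [Complex.mul_re, Complex.conj_re, Complex.conj_im]; ring
    rw [hD]
    simp only [h1, abs_mul, abs_two]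
    gcongr
    refine (Complex.abs_re_le_norm _).trans ?_
    rw [norm_mul, Complex.norm_conj]
  have hFTC : ‖h b‖ ^ 2 - ‖h a‖ ^ 2 = ∫ x in a..b, D x :=
    (intervalIntegral.integral_eq_sub_of_hasDerivAt (fun x _ => hderiv x)
      (hDc.intervalIntegrable a b)).symm
  have hle : ‖h b‖ ^ 2 ≤ ‖h a‖ ^ 2 + ∫ x in uIoc a b, ‖D x‖ := by
    have := intervalIntegral.norm_integral_le_integral_norm_uIoc (f := D) (μ := volume)
      (a := a) (b := b)
    rw [Real.norm_eq_abs] at this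
    linarith [le_abs_self (∫ x in a..b, D x)]
  have hint : Integrable (fun x => ‖D x‖) (volume.restrict (uIoc a b)) :=
    (intervalIntegrable_iff.1 (hDc.intervalIntegrable a b)).norm
  have e : ∀ z : ℂ, ‖z‖ₑ ^ 2 = ENNReal.ofReal (‖z‖ ^ 2) := fun z => by
    rw [ENNReal.ofReal_pow (norm_nonneg z), ofReal_norm]
  rw [e, e]
  refine (ENNReal.ofReal_le_ofReal hle).trans ?_
  rw [ENNReal.ofReal_add (by positivity) (integral_nonneg fun x => norm_nonneg _)]
  gcongr
  rw [ofReal_integral_eq_lintegral_ofReal hint (Eventually.of_forall fun x => norm_nonneg _)]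
  refine (lintegral_mono fun x => ?_).trans (lintegral_mono_set hs)
  rw [← ofReal_norm, ← ofReal_norm, ← ENNReal.ofReal_mul (norm_nonneg _)]
  have h2 : (2 : ℝ≥0∞) = ENNReal.ofReal 2 := by simp
  rw [h2, ← ENNReal.ofReal_mul (by norm_num)]
  exact ENNReal.ofReal_le_ofReal (hDle x)

theorem enorm_sq_le_lintegral {h h' : ℝ → ℂ} (hd : ∀ x, HasDerivAt h (h' x) x)
    (hc : Continuous h') (hlim : Tendsto h atBot (𝓝 0)) (b : ℝ) :
    ‖h b‖ₑ ^ 2 ≤ ∫⁻ x, 2 * (‖h x‖ₑ * ‖h' x‖ₑ) := by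
  have h1 : ∀ a, ‖h b‖ₑ ^ 2 ≤ ‖h a‖ₑ ^ 2 + ∫⁻ x, 2 * (‖h x‖ₑ * ‖h' x‖ₑ) := fun a => by
    simpa using enorm_sq_le_add_lintegral hd hc a b (subset_univ _)
  have h2 : Tendsto (fun a => ‖h a‖ₑ ^ 2 + ∫⁻ x, 2 * (‖h x‖ₑ * ‖h' x‖ₑ)) atBot
      (𝓝 (0 + ∫⁻ x, 2 * (‖h x‖ₑ * ‖h' x‖ₑ))) := by
    refine Tendsto.add ?_ tendsto_const_nhds
    have := ENNReal.Tendsto.pow (n := 2) hlim.enorm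
    simpa using this
  simpa using ge_of_tendsto' h2 h1

/-- The Cauchy-Schwarz inequality. -/
theorem lintegral_mul_sq_le {α : Type*} [MeasurableSpace α] {μ : Measure α} {f g : α → ℝ≥0∞}
    (hf : AEMeasurable f μ) (hg : AEMeasurable g μ) :
    (∫⁻ x, f x * g x ∂μ) ^ 2 ≤ (∫⁻ x, f x ^ 2 ∂μ) * ∫⁻ x, g x ^ 2 ∂μ := by
  have h := ENNReal.lintegral_mul_le_Lp_mul_Lq μ Real.HolderConjugate.two_two hf hg
  simp only [Pi.mul_apply] at h
  calc (∫⁻ x, f x * g x ∂μ) ^ 2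
      ≤ ((∫⁻ x, f x ^ (2 : ℝ) ∂μ) ^ (1 / 2 : ℝ) * (∫⁻ x, g x ^ (2 : ℝ) ∂μ) ^ (1 / 2 : ℝ)) ^ 2 := by
        gcongr
    _ = _ := by
        rw [mul_pow, ← ENNReal.rpow_natCast, ← ENNReal.rpow_natCast, ← ENNReal.rpow_mul,
          ← ENNReal.rpow_mul]
        norm_num

/-- The planar inequality `∫ |h|⁴ ≤ 4 ∫ |h|² (∫ |∂ₓh|² + ∫ |∂ᵧh|²)`. -/
theorem lintegral_enorm_pow_four_le {h hx hy : ℝ × ℝ → ℂ} (hc : Continuous h)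
    (hcx : Continuous hx) (hcy : Continuous hy)
    (hdx : ∀ x y, HasDerivAt (fun x => h (x, y)) (hx (x, y)) x)
    (hdy : ∀ x y, HasDerivAt (fun y => h (x, y)) (hy (x, y)) y)
    (limx : ∀ y, Tendsto (fun x => h (x, y)) atBot (𝓝 0))
    (limy : ∀ x, Tendsto (fun y => h (x, y)) atBot (𝓝 0)) :
    ∫⁻ x, ∫⁻ y, ‖h (x, y)‖ₑ ^ 4 ≤ 4 * (∫⁻ x, ∫⁻ y, ‖h (x, y)‖ₑ ^ 2)
      * ((∫⁻ x, ∫⁻ y, ‖hx (x, y)‖ₑ ^ 2) + ∫⁻ x, ∫⁻ y, ‖hy (x, y)‖ₑ ^ 2) := by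
  set U : ℝ → ℝ≥0∞ := fun y => ∫⁻ x, 2 * (‖h (x, y)‖ₑ * ‖hx (x, y)‖ₑ) with hU
  set V : ℝ → ℝ≥0∞ := fun x => ∫⁻ y, 2 * (‖h (x, y)‖ₑ * ‖hy (x, y)‖ₑ) with hV
  set n := ∫⁻ x, ∫⁻ y, ‖h (x, y)‖ₑ ^ 2 with hn
  set kx := ∫⁻ x, ∫⁻ y, ‖hx (x, y)‖ₑ ^ 2 with hkx
  set ky := ∫⁻ x, ∫⁻ y, ‖hy (x, y)‖ₑ ^ 2 with hky
  have mU : Measurable U :=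
    Measurable.lintegral_prod_left (f := fun x y => 2 * (‖h (x, y)‖ₑ * ‖hx (x, y)‖ₑ))
      (by simp only [Function.uncurry_def]; fun_prop)
  have mV : Measurable V :=
    Measurable.lintegral_prod_right (f := fun x y => 2 * (‖h (x, y)‖ₑ * ‖hy (x, y)‖ₑ))
      (by simp only [Function.uncurry_def]; fun_prop)
  have hhU : ∀ x y, ‖h (x, y)‖ₑ ^ 2 ≤ U y := fun x y =>
    enorm_sq_le_lintegral (fun x => hdx x y) (by fun_prop) (limx y) x
  have hhV : ∀ x y, ‖h (x, y)‖ₑ ^ 2 ≤ V x := fun x y =>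
    enorm_sq_le_lintegral (fun y => hdy x y) (by fun_prop) (limy x) y
  have h1 : ∫⁻ x, ∫⁻ y, ‖h (x, y)‖ₑ ^ 4 ≤ (∫⁻ x, V x) * ∫⁻ y, U y := by
    rw [← lintegral_mul_const _ mV]
    refine lintegral_mono fun x => ?_
    rw [← lintegral_const_mul _ mU]
    refine lintegral_mono fun y => ?_
    calc ‖h (x, y)‖ₑ ^ 4 = ‖h (x, y)‖ₑ ^ 2 * ‖h (x, y)‖ₑ ^ 2 := by ring
      _ ≤ V x * U y := mul_le_mul' (hhV x y) (hhU x y)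
  have cs : ∀ g : ℝ × ℝ → ℂ, Continuous g →
      (∫⁻ x, ∫⁻ y, 2 * (‖h (x, y)‖ₑ * ‖g (x, y)‖ₑ)) ^ 2
        ≤ 4 * (n * ∫⁻ x, ∫⁻ y, ‖g (x, y)‖ₑ ^ 2) := by
    intro g hg
    have e : ∀ F : ℝ × ℝ → ℝ≥0∞, Measurable F → ∫⁻ x, ∫⁻ y, F (x, y) = ∫⁻ q, F q :=
      fun F hF => (lintegral_prod _ hF.aemeasurable).symm
    rw [hn, e (fun q => 2 * (‖h q‖ₑ * ‖g q‖ₑ)) (by fun_prop), e (fun q => ‖h q‖ₑ ^ 2)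
      (by fun_prop), e (fun q => ‖g q‖ₑ ^ 2) (by fun_prop), lintegral_const_mul _ (by fun_prop),
      mul_pow]
    have := lintegral_mul_sq_le (μ := (volume : Measure (ℝ × ℝ))) (f := fun q => ‖h q‖ₑ)
      (g := fun q => ‖g q‖ₑ) (by fun_prop) (by fun_prop)
    gcongr
    norm_num
  have hV2 : (∫⁻ x, V x) ^ 2 ≤ 4 * (n * ky) := cs hy hcy
  have hU2 : (∫⁻ y, U y) ^ 2 ≤ 4 * (n * kx) := by
    have : ∫⁻ y, U y = ∫⁻ x, ∫⁻ y, 2 * (‖h (x, y)‖ₑ * ‖hx (x, y)‖ₑ) :=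
      lintegral_lintegral_swap (by simp only [Function.uncurry_def]; fun_prop)
    rw [this]
    exact cs hx hcx
  refine h1.trans ((ENNReal.pow_le_pow_left_iff (n := 2) (by norm_num)).1 ?_)
  calc ((∫⁻ x, V x) * ∫⁻ y, U y) ^ 2 = (∫⁻ x, V x) ^ 2 * (∫⁻ y, U y) ^ 2 := mul_pow _ _ _
    _ ≤ (4 * (n * ky)) * (4 * (n * kx)) := mul_le_mul' hV2 hU2
    _ = (4 * n) ^ 2 * (kx * ky) := by ring
    _ ≤ (4 * n) ^ 2 * (kx + ky) ^ 2 := by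
        gcongr
        rw [sq]
        exact mul_le_mul' le_self_add le_add_self
    _ = (4 * n * (kx + ky)) ^ 2 := (mul_pow _ _ _).symm

/-- A continuously differentiable function on the cell, given together with its partial
derivatives, which is square integrable with its gradient and its products with `x` and `y`, and
which decays along the transverse directions. -/
structure Regular (L : ℝ) (f fx fy fz : ℝ × ℝ × ℝ → ℂ) : Prop where
  cont : Continuous f
  cont_x : Continuous fx
  cont_y : Continuous fy
  cont_z : Continuous fz
  deriv_x : ∀ x y z, HasDerivAt (fun x => f (x, y, z)) (fx (x, y, z)) x
  deriv_y : ∀ x y z, HasDerivAt (fun y => f (x, y, z)) (fy (x, y, z)) y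
  deriv_z : ∀ x y z, HasDerivAt (fun z => f (x, y, z)) (fz (x, y, z)) z
  lim_x : ∀ y z, Tendsto (fun x => f (x, y, z)) atBot (𝓝 0)
  lim_y : ∀ x z, Tendsto (fun y => f (x, y, z)) atBot (𝓝 0)
  memLp : MemLp f 2 (volume.restrict (cell3 L))
  memLp_x : MemLp fx 2 (volume.restrict (cell3 L))
  memLp_y : MemLp fy 2 (volume.restrict (cell3 L))
  memLp_z : MemLp fz 2 (volume.restrict (cell3 L))
  memLp_wx : MemLp (fun p => p.1 • f p) 2 (volume.restrict (cell3 L))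
  memLp_wy : MemLp (fun p => p.2.1 • f p) 2 (volume.restrict (cell3 L))

theorem Regular.sub {L : ℝ} {f fx fy fz g gx gy gz : ℝ × ℝ × ℝ → ℂ} (hf : Regular L f fx fy fz)
    (hg : Regular L g gx gy gz) :
    Regular L (fun p => f p - g p) (fun p => fx p - gx p) (fun p => fy p - gy p)
      (fun p => fz p - gz p) where
  cont := hf.cont.sub hg.cont
  cont_x := hf.cont_x.sub hg.cont_x
  cont_y := hf.cont_y.sub hg.cont_y
  cont_z := hf.cont_z.sub hg.cont_z
  deriv_x x y z := (hf.deriv_x x y z).sub (hg.deriv_x x y z)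
  deriv_y x y z := (hf.deriv_y x y z).sub (hg.deriv_y x y z)
  deriv_z x y z := (hf.deriv_z x y z).sub (hg.deriv_z x y z)
  lim_x y z := by simpa using (hf.lim_x y z).sub (hg.lim_x y z)
  lim_y x z := by simpa using (hf.lim_y x z).sub (hg.lim_y x z)
  memLp := hf.memLp.sub hg.memLp
  memLp_x := hf.memLp_x.sub hg.memLp_x
  memLp_y := hf.memLp_y.sub hg.memLp_y
  memLp_z := hf.memLp_z.sub hg.memLp_z
  memLp_wx := by
    have h : MemLp (fun p => p.1 • f p - p.1 • g p) 2 (volume.restrict (cell3 L)) :=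
      hf.memLp_wx.sub hg.memLp_wx
    simpa only [smul_sub] using h
  memLp_wy := by
    have h : MemLp (fun p => p.2.1 • f p - p.2.1 • g p) 2 (volume.restrict (cell3 L)) :=
      hf.memLp_wy.sub hg.memLp_wy
    simpa only [smul_sub] using h

/-- The planar inequality on each slice, combined with a bound for the mass of a slice: any two
slices differ in mass by at most `∫ 2 |f| |∂_z f|`, and their average is `L⁻¹ ∫ |f|²`. -/
theorem Regular.lintegral_pow_four_le {L : ℝ} {f fx fy fz : ℝ × ℝ × ℝ → ℂ}
    (hf : Regular L f fx fy fz) :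
    ENNReal.ofReal L * ∫⁻ p in cell3 L, ‖f p‖ₑ ^ 4 ≤
      4 * ((∫⁻ p in cell3 L, ‖f p‖ₑ ^ 2)
          + ENNReal.ofReal L * ∫⁻ p in cell3 L, 2 * (‖f p‖ₑ * ‖fz p‖ₑ))
        * ((∫⁻ p in cell3 L, ‖fx p‖ₑ ^ 2) + ∫⁻ p in cell3 L, ‖fy p‖ₑ ^ 2) := by
  have c0 := hf.cont
  have cx := hf.cont_x
  have cy := hf.cont_y
  have cz := hf.cont_z
  have m0 := c0.measurable
  set I : Set ℝ := Ioo (-(L / 2)) (L / 2) with hI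
  set n : ℝ → ℝ≥0∞ := fun z => ∫⁻ x, ∫⁻ y, ‖f (x, y, z)‖ₑ ^ 2 with hn
  set kx : ℝ → ℝ≥0∞ := fun z => ∫⁻ x, ∫⁻ y, ‖fx (x, y, z)‖ₑ ^ 2 with hkx
  set ky : ℝ → ℝ≥0∞ := fun z => ∫⁻ x, ∫⁻ y, ‖fy (x, y, z)‖ₑ ^ 2 with hky
  set K := ∫⁻ p in cell3 L, 2 * (‖f p‖ₑ * ‖fz p‖ₑ) with hK
  have mI : MeasurableSet I := measurableSet_Ioo
  have meas2 : ∀ g : ℝ × ℝ × ℝ → ℂ, Continuous g →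
      Measurable fun z => ∫⁻ x, ∫⁻ y, ‖g (x, y, z)‖ₑ ^ 2 := by
    intro g hg
    have mg := hg.measurable
    refine Measurable.lintegral_prod_right
      (f := fun z x => ∫⁻ y, ‖g (x, y, z)‖ₑ ^ 2) ?_
    simp only [Function.uncurry_def]
    exact Measurable.lintegral_prod_right
      (f := fun (p : ℝ × ℝ) y => ‖g (p.2, y, p.1)‖ₑ ^ 2)
      (by simp only [Function.uncurry_def]; fun_prop)
  have hNn : ∫⁻ p in cell3 L, ‖f p‖ₑ ^ 2 = ∫⁻ z in I, n z := lintegral_cell3 L (by fun_prop)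
  have hvol : volume I = ENNReal.ofReal L := by rw [hI, Real.volume_Ioo]; congr 1; ring
  have hK' : K = ∫⁻ x, ∫⁻ y, ∫⁻ z in I, 2 * (‖f (x, y, z)‖ₑ * ‖fz (x, y, z)‖ₑ) := by
    rw [hK, restrict_cell3, lintegral_prod _ (by fun_prop)]
    refine lintegral_congr fun x => ?_
    rw [lintegral_prod _ (by fun_prop)]
  -- compare the masses of two slices
  have hslice : ∀ z ∈ I, ∀ z' ∈ I, n z ≤ n z' + K := by
    intro z hz z' hz'
    have hsub : uIoc z' z ⊆ I := by
      refine uIoc_subset_uIcc.trans ?_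
      exact (ordConnected_Ioo).uIcc_subset hz' hz
    have h1 : ∀ x y, ‖f (x, y, z)‖ₑ ^ 2 ≤ ‖f (x, y, z')‖ₑ ^ 2
        + ∫⁻ z in I, 2 * (‖f (x, y, z)‖ₑ * ‖fz (x, y, z)‖ₑ) := fun x y =>
      enorm_sq_le_add_lintegral (fun z => hf.deriv_z x y z) (by fun_prop) z' z hsub
    have h2 : n z ≤ ∫⁻ x, ∫⁻ y, (‖f (x, y, z')‖ₑ ^ 2
        + ∫⁻ z in I, 2 * (‖f (x, y, z)‖ₑ * ‖fz (x, y, z)‖ₑ)) :=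
      lintegral_mono fun x => lintegral_mono fun y => h1 x y
    refine h2.trans (le_of_eq ?_)
    rw [hK', hn]
    simp only
    rw [← lintegral_add_left]
    · refine lintegral_congr fun x => ?_
      rw [lintegral_add_left (by fun_prop)]
    · exact Measurable.lintegral_prod_right
        (f := fun x y => ‖f (x, y, z')‖ₑ ^ 2)
        (by simp only [Function.uncurry_def]; fun_prop)
  have havg : ∀ z ∈ I, ENNReal.ofReal L * n z ≤ (∫⁻ z in I, n z) + ENNReal.ofReal L * K := by
    intro z hz
    calc ENNReal.ofReal L * n z = ∫⁻ _ in I, n z := by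
          rw [setLIntegral_const, hvol, mul_comm]
      _ ≤ ∫⁻ z' in I, (n z' + K) := by
          refine setLIntegral_mono' mI fun z' hz' => hslice z hz z' hz'
      _ = _ := by
          rw [lintegral_add_left (meas2 f c0), setLIntegral_const, hvol, mul_comm]
  have hq : ∀ z, ∫⁻ x, ∫⁻ y, ‖f (x, y, z)‖ₑ ^ 4 ≤ 4 * n z * (kx z + ky z) := fun z =>
    lintegral_enorm_pow_four_le (h := fun q => f (q.1, q.2, z)) (hx := fun q => fx (q.1, q.2, z))
      (hy := fun q => fy (q.1, q.2, z)) (by fun_prop) (by fun_prop) (by fun_prop)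
      (fun x y => hf.deriv_x x y z) (fun x y => hf.deriv_y x y z) (fun y => hf.lim_x y z)
      (fun x => hf.lim_y x z)
  rw [lintegral_cell3 L (F := fun p => ‖f p‖ₑ ^ 4) (by fun_prop),
    lintegral_cell3 L (F := fun p => ‖fx p‖ₑ ^ 2) (by fun_prop),
    lintegral_cell3 L (F := fun p => ‖fy p‖ₑ ^ 2) (by fun_prop), hNn,
    ← lintegral_add_left (meas2 fx cx), ← lintegral_const_mul' _ _ ENNReal.ofReal_ne_top]
  have mk : Measurable fun z => (∫⁻ x, ∫⁻ y, ‖fx (x, y, z)‖ₑ ^ 2)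
      + ∫⁻ x, ∫⁻ y, ‖fy (x, y, z)‖ₑ ^ 2 := (meas2 fx cx).add (meas2 fy cy)
  rw [← lintegral_const_mul _ mk]
  refine setLIntegral_mono' mI fun z hz => ?_
  calc ENNReal.ofReal L * ∫⁻ x, ∫⁻ y, ‖f (x, y, z)‖ₑ ^ 4
      ≤ ENNReal.ofReal L * (4 * n z * (kx z + ky z)) := by gcongr; exact hq z
    _ = 4 * (ENNReal.ofReal L * n z) * (kx z + ky z) := by ring
    _ ≤ _ := by
        gcongr
        exact havg z hz

theorem lintegral_enorm_pow_eq {α : Type*} [MeasurableSpace α] {μ : Measure α} {f : α → ℂ}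
    {k : ℕ} (hf : Integrable (fun x => ‖f x‖ ^ k) μ) :
    ∫⁻ x, ‖f x‖ₑ ^ k ∂μ = ENNReal.ofReal (∫ x, ‖f x‖ ^ k ∂μ) := by
  rw [ofReal_integral_eq_lintegral_ofReal hf (Eventually.of_forall fun x => by positivity)]
  refine lintegral_congr fun x => ?_
  rw [ENNReal.ofReal_pow (norm_nonneg _), ofReal_norm]

/-- The anisotropic Gagliardo-Nirenberg inequality on the cell. The parameter `l` comes from
`2 |f| |∂_z f| ≤ l |f|² + |∂_z f|² / l`; it weighs the mass against the longitudinal energy. -/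
theorem Regular.pow_four {L : ℝ} (hL : 0 < L) {f fx fy fz : ℝ × ℝ × ℝ → ℂ}
    (hf : Regular L f fx fy fz) {l : ℝ} (hl : 0 < l) :
    Integrable (fun p => ‖f p‖ ^ 4) (volume.restrict (cell3 L)) ∧
    ∫ p in cell3 L, ‖f p‖ ^ 4 ≤
      4 * ((1 / L + l) * (∫ p in cell3 L, ‖f p‖ ^ 2) + 1 / l * ∫ p in cell3 L, ‖fz p‖ ^ 2)
        * ((∫ p in cell3 L, ‖fx p‖ ^ 2) + ∫ p in cell3 L, ‖fy p‖ ^ 2) := by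
  have i0 := integrable_norm_sq hf.memLp
  have ix := integrable_norm_sq hf.memLp_x
  have iy := integrable_norm_sq hf.memLp_y
  have iz := integrable_norm_sq hf.memLp_z
  have h := hf.lintegral_pow_four_le
  set N := ∫ p in cell3 L, ‖f p‖ ^ 2 with hN
  set Kx := ∫ p in cell3 L, ‖fx p‖ ^ 2 with hKx
  set Ky := ∫ p in cell3 L, ‖fy p‖ ^ 2 with hKy
  set Kz := ∫ p in cell3 L, ‖fz p‖ ^ 2 with hKz
  have hN0 : 0 ≤ N := integral_nonneg fun p => by positivity
  have hKx0 : 0 ≤ Kx := integral_nonneg fun p => by positivity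
  have hKy0 : 0 ≤ Ky := integral_nonneg fun p => by positivity
  have hKz0 : 0 ≤ Kz := integral_nonneg fun p => by positivity
  have hcross : ∫⁻ p in cell3 L, 2 * (‖f p‖ₑ * ‖fz p‖ₑ) ≤ ENNReal.ofReal (l * N + 1 / l * Kz) := by
    rw [hN, hKz, ← integral_const_mul, ← integral_const_mul,
      ← integral_add (i0.const_mul _) (iz.const_mul _), ofReal_integral_eq_lintegral_ofReal
      (f := fun p => l * ‖f p‖ ^ 2 + 1 / l * ‖fz p‖ ^ 2)
      ((i0.const_mul _).add (iz.const_mul _)) (Eventually.of_forall fun p => by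
        simp only [Pi.zero_apply]; positivity)]
    refine lintegral_mono fun p => ?_
    rw [← ofReal_norm, ← ofReal_norm, ← ENNReal.ofReal_mul (norm_nonneg _)]
    have h2 : (2 : ℝ≥0∞) = ENNReal.ofReal 2 := by simp
    rw [h2, ← ENNReal.ofReal_mul (by norm_num)]
    refine ENNReal.ofReal_le_ofReal ?_
    have e : l * ‖f p‖ ^ 2 + 1 / l * ‖fz p‖ ^ 2 - 2 * (‖f p‖ * ‖fz p‖)
        = 1 / l * (l * ‖f p‖ - ‖fz p‖) ^ 2 := by field_simp; ring
    have : 0 ≤ 1 / l * (l * ‖f p‖ - ‖fz p‖) ^ 2 := by positivity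
    linarith
  rw [lintegral_enorm_pow_eq i0, lintegral_enorm_pow_eq ix, lintegral_enorm_pow_eq iy,
    ← hN, ← hKx, ← hKy] at h
  have hbound : ENNReal.ofReal L * ∫⁻ p in cell3 L, ‖f p‖ₑ ^ 4
      ≤ ENNReal.ofReal (4 * (N + L * (l * N + 1 / l * Kz)) * (Kx + Ky)) := by
    refine h.trans ?_
    rw [ENNReal.ofReal_mul (by positivity), ENNReal.ofReal_mul (by norm_num),
      ENNReal.ofReal_add hN0 (by positivity), ENNReal.ofReal_mul hL.le,
      ENNReal.ofReal_add hKx0 hKy0]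
    gcongr
    norm_num
  have hfin : ∫⁻ p in cell3 L, ‖f p‖ₑ ^ 4 < ⊤ := by
    by_contra hcon
    rw [not_lt, top_le_iff] at hcon
    rw [hcon, ENNReal.mul_top (by simpa using hL)] at hbound
    exact absurd hbound (by simp)
  have hint : Integrable (fun p => ‖f p‖ ^ 4) (volume.restrict (cell3 L)) := by
    refine ⟨(by have := hf.cont; fun_prop : Continuous fun p => ‖f p‖ ^ 4).aestronglyMeasurable, ?_⟩
    rw [hasFiniteIntegral_iff_enorm]
    simpa using hfin
  refine ⟨hint, ?_⟩
  rw [lintegral_enorm_pow_eq hint, ← ENNReal.ofReal_mul hL.le,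
    ENNReal.ofReal_le_ofReal_iff (by positivity)] at hbound
  rw [mul_comm, ← le_div_iff₀ hL] at hbound
  refine hbound.trans (le_of_eq ?_)
  field_simp
  ring

/-! ### Smooth functions with bounded transverse support -/

/-- Smooth functions on `ℝ³` which are `L`-periodic in `z` and vanish for large `(x, y)`. -/
structure Nice (L : ℝ) (Ψ : ℝ × ℝ × ℝ → ℂ) : Prop where
  smooth : ContDiff ℝ ∞ Ψ
  periodic : ∀ p : ℝ × ℝ × ℝ, Ψ (p.1, p.2.1, p.2.2 + L) = Ψ p
  vanish : ∃ R, ∀ p : ℝ × ℝ × ℝ, R < |p.1| ∨ R < |p.2.1| → Ψ p = 0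

theorem Nice.fderiv_apply {L : ℝ} {Ψ : ℝ × ℝ × ℝ → ℂ} (h : Nice L Ψ) (e : ℝ × ℝ × ℝ) :
    Nice L (fun p => fderiv ℝ Ψ p e) where
  smooth := (h.smooth.fderiv_right (m := ∞) (by simp)).clm_apply contDiff_const
  periodic p := by
    have h1 : (fun p : ℝ × ℝ × ℝ => Ψ (p + (0, 0, L))) = Ψ := by
      funext p
      have := h.periodic p
      rw [← this]
      congr 1
      ext <;> simp
    have h2 := fderiv_comp_add_right (𝕜 := ℝ) (f := Ψ) (x := p) (0, 0, L)
    rw [h1] at h2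
    rw [h2]
    congr 2
    ext <;> simp
  vanish := by
    obtain ⟨R, hR⟩ := h.vanish
    refine ⟨R, fun p hp => ?_⟩
    have hopen : IsOpen {p : ℝ × ℝ × ℝ | R < |p.1| ∨ R < |p.2.1|} :=
      (isOpen_lt (by fun_prop : Continuous fun _ : ℝ × ℝ × ℝ => R)
        (by fun_prop : Continuous fun p : ℝ × ℝ × ℝ => |p.1|)).union
        (isOpen_lt (by fun_prop : Continuous fun _ : ℝ × ℝ × ℝ => R)
          (by fun_prop : Continuous fun p : ℝ × ℝ × ℝ => |p.2.1|))
    have h0 : Ψ =ᶠ[𝓝 p] fun _ => 0 := by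
      filter_upwards [hopen.mem_nhds hp] with q hq using hR q hq
    rw [h0.fderiv_eq]
    simp

theorem memLp_cell3_of_vanish {L R : ℝ} {F : ℝ × ℝ × ℝ → ℂ} (hF : Continuous F)
    (h0 : ∀ p : ℝ × ℝ × ℝ, R < |p.1| ∨ R < |p.2.1| → F p = 0) (r : ℝ≥0∞) :
    MemLp F r (volume.restrict (cell3 L)) := by
  set K : Set (ℝ × ℝ × ℝ) := Icc (-R) R ×ˢ (Icc (-R) R ×ˢ Icc (-(L / 2)) (L / 2)) with hK
  have hKc : IsCompact K := isCompact_Icc.prod (isCompact_Icc.prod isCompact_Icc)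
  obtain ⟨M, hM⟩ := hKc.exists_bound_of_continuousOn hF.continuousOn
  have hfin : IsFiniteMeasure (volume.restrict K) := ⟨by simpa using hKc.measure_lt_top⟩
  have h1 : MemLp F r (volume.restrict K) := by
    refine MemLp.of_bound hF.aestronglyMeasurable M ?_
    filter_upwards [ae_restrict_mem hKc.measurableSet] with p hp using hM p hp
  have h2 : MemLp (K.indicator F) r volume := (memLp_indicator_iff_restrict hKc.measurableSet).2 h1
  refine (h2.restrict (cell3 L)).ae_eq ?_
  filter_upwards [ae_restrict_mem (measurableSet_cell3 L)] with p hp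
  by_cases hpK : p ∈ K
  · rw [indicator_of_mem hpK]
  · rw [indicator_of_notMem hpK, h0 p]
    by_contra hcon
    push Not at hcon
    exact hpK ⟨abs_le.1 hcon.1, abs_le.1 hcon.2, Ioo_subset_Icc_self hp⟩

theorem Nice.regular {L : ℝ} {Ψ : ℝ × ℝ × ℝ → ℂ} (h : Nice L Ψ) :
    Regular L Ψ (fun p => fderiv ℝ Ψ p (1, 0, 0)) (fun p => fderiv ℝ Ψ p (0, 1, 0))
      (fun p => fderiv ℝ Ψ p (0, 0, 1)) := by
  obtain ⟨R, hR⟩ := h.vanish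
  have hc := h.smooth.continuous
  have hd : Differentiable ℝ Ψ := h.smooth.differentiable (by simp)
  have hmem : ∀ e : ℝ × ℝ × ℝ, MemLp (fun p => fderiv ℝ Ψ p e) 2 (volume.restrict (cell3 L)) := by
    intro e
    obtain ⟨R', hR'⟩ := (h.fderiv_apply e).vanish
    exact memLp_cell3_of_vanish (h.fderiv_apply e).smooth.continuous hR' 2
  refine ⟨hc, (h.fderiv_apply _).smooth.continuous, (h.fderiv_apply _).smooth.continuous,
    (h.fderiv_apply _).smooth.continuous, fun x y z => ?_, fun x y z => ?_, fun x y z => ?_,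
    fun y z => ?_, fun x z => ?_, memLp_cell3_of_vanish hc hR 2, hmem _, hmem _, hmem _,
    memLp_cell3_of_vanish (R := R) (by fun_prop) (fun p hp => by rw [hR p hp, smul_zero]) 2,
    memLp_cell3_of_vanish (R := R) (by fun_prop) (fun p hp => by rw [hR p hp, smul_zero]) 2⟩
  · exact (hd (x, y, z)).hasFDerivAt.comp_hasDerivAt x
      ((hasDerivAt_id x).prodMk (hasDerivAt_const x (y, z)))
  · exact (hd (x, y, z)).hasFDerivAt.comp_hasDerivAt y
      ((hasDerivAt_const y x).prodMk ((hasDerivAt_id y).prodMk (hasDerivAt_const y z)))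
  · exact (hd (x, y, z)).hasFDerivAt.comp_hasDerivAt z
      ((hasDerivAt_const z x).prodMk ((hasDerivAt_const z y).prodMk (hasDerivAt_id z)))
  · refine tendsto_const_nhds.congr' ?_
    filter_upwards [eventually_lt_atBot (-R), eventually_lt_atBot 0] with x hx hx0
    refine (hR (x, y, z) (Or.inl ?_)).symm
    rw [abs_of_neg hx0]; linarith
  · refine tendsto_const_nhds.congr' ?_
    filter_upwards [eventually_lt_atBot (-R), eventually_lt_atBot 0] with y hy hy0
    refine (hR (x, y, z) (Or.inr ?_)).symm
    rw [abs_of_neg hy0]; linarith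

/-! ### The transverse quadratic form -/

section Forms

variable {α : Type*} [MeasurableSpace α] {μ : Measure α} {f g : α → ℂ}

theorem integrable_re_mul_conj (hf : MemLp f 2 μ) (hg : MemLp g 2 μ) :
    Integrable (fun x => (f x).re * (g x).re + (f x).im * (g x).im) μ :=
  (hf.re.integrable_mul hg.re).add (hf.im.integrable_mul hg.im)

theorem integrable_im_mul_conj (hf : MemLp f 2 μ) (hg : MemLp g 2 μ) :
    Integrable (fun x => (f x).im * (g x).re - (f x).re * (g x).im) μ :=
  (hf.im.integrable_mul hg.re).sub (hf.re.integrable_mul hg.im)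

end Forms

theorem Regular.memLp_annihilation_x {L : ℝ} {f fx fy fz : ℝ × ℝ × ℝ → ℂ}
    (hf : Regular L f fx fy fz) (om : ℝ) :
    MemLp (fun p => fx p + (om * p.1) • f p) 2 (volume.restrict (cell3 L)) := by
  have h : MemLp (fun p => fx p + om • (p.1 • f p)) 2 (volume.restrict (cell3 L)) :=
    hf.memLp_x.add (hf.memLp_wx.const_smul om)
  simpa only [smul_smul] using h

theorem Regular.memLp_annihilation_y {L : ℝ} {f fx fy fz : ℝ × ℝ × ℝ → ℂ}
    (hf : Regular L f fx fy fz) (om : ℝ) :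
    MemLp (fun p => fy p + (om * p.2.1) • f p) 2 (volume.restrict (cell3 L)) := by
  have h : MemLp (fun p => fy p + om • (p.2.1 • f p)) 2 (volume.restrict (cell3 L)) :=
    hf.memLp_y.add (hf.memLp_wy.const_smul om)
  simpa only [smul_smul] using h

/-- The excess of the planar oscillator energy over the ground state energy is a sum of squares:
`½ ∫ |∇f|² + ½ ω² ∫ r² |f|² - ω ∫ |f|² = ½ ∫ |(∂ₓ + ω x) f|² + ½ ∫ |(∂ᵧ + ω y) f|²`. -/
theorem Regular.integral_annihilation {L : ℝ} {f fx fy fz : ℝ × ℝ × ℝ → ℂ}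
    (hf : Regular L f fx fy fz) (om : ℝ) :
    ∫ p in cell3 L, (‖fx p + (om * p.1) • f p‖ ^ 2 + ‖fy p + (om * p.2.1) • f p‖ ^ 2)
      = (∫ p in cell3 L, ‖fx p‖ ^ 2) + (∫ p in cell3 L, ‖fy p‖ ^ 2)
        + om ^ 2 * ((∫ p in cell3 L, ‖p.1 • f p‖ ^ 2) + ∫ p in cell3 L, ‖p.2.1 • f p‖ ^ 2)
        - 2 * om * ∫ p in cell3 L, ‖f p‖ ^ 2 := by
  have i0 := integrable_norm_sq hf.memLp
  have ix := integrable_norm_sq hf.memLp_x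
  have iy := integrable_norm_sq hf.memLp_y
  have iwx := integrable_norm_sq hf.memLp_wx
  have iwy := integrable_norm_sq hf.memLp_wy
  have icx := integrable_re_mul_conj hf.memLp_wx hf.memLp_x
  have icy := integrable_re_mul_conj hf.memLp_wy hf.memLp_y
  have nx : ∀ p : ℝ × ℝ × ℝ, ‖f p‖ ^ 2 = (f p).re * (f p).re + (f p).im * (f p).im := fun p => by
    rw [Complex.sq_norm, Complex.normSq_apply]
  have dsq : ∀ {u u' : ℝ → ℂ} {t : ℝ}, HasDerivAt u (u' t) t →
      HasDerivAt (fun t => t * ‖u t‖ ^ 2) (‖u t‖ ^ 2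
        + 2 * ((t • u t).re * (u' t).re + (t • u t).im * (u' t).im)) t := by
    intro u u' t hu
    refine ((hasDerivAt_id t).mul hu.norm_sq).congr_deriv ?_
    rw [Complex.inner]
    simp only [Complex.mul_re, Complex.mul_im, Complex.conj_re, Complex.conj_im, id,
      Complex.real_smul, Complex.ofReal_re, Complex.ofReal_im]
    ring
  have zx : ∫ p in cell3 L, (‖f p‖ ^ 2 + 2 * ((p.1 • f p).re * (fx p).re
      + (p.1 • f p).im * (fx p).im)) = 0 := by
    refine integral_cell3_deriv_x (G := fun p => p.1 * ‖f p‖ ^ 2) (fun x y z =>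
      dsq (u := fun x => f (x, y, z)) (u' := fun x => fx (x, y, z)) (hf.deriv_x x y z)) ?_
      (i0.add (icx.const_mul 2))
    refine (integrable_re_mul_conj hf.memLp_wx hf.memLp).congr (Eventually.of_forall fun p => ?_)
    simp only [nx, Complex.real_smul, Complex.re_ofReal_mul, Complex.im_ofReal_mul]
    ring
  have zy : ∫ p in cell3 L, (‖f p‖ ^ 2 + 2 * ((p.2.1 • f p).re * (fy p).re
      + (p.2.1 • f p).im * (fy p).im)) = 0 := by
    refine integral_cell3_deriv_y (G := fun p => p.2.1 * ‖f p‖ ^ 2) (fun x y z =>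
      dsq (u := fun y => f (x, y, z)) (u' := fun y => fy (x, y, z)) (hf.deriv_y x y z)) ?_
      (i0.add (icy.const_mul 2))
    refine (integrable_re_mul_conj hf.memLp_wy hf.memLp).congr (Eventually.of_forall fun p => ?_)
    simp only [nx, Complex.real_smul, Complex.re_ofReal_mul, Complex.im_ofReal_mul]
    ring
  rw [integral_add i0 (icx.const_mul 2), integral_const_mul] at zx
  rw [integral_add i0 (icy.const_mul 2), integral_const_mul] at zy
  have ex : ∫ p in cell3 L, ‖fx p + (om * p.1) • f p‖ ^ 2
      = (∫ p in cell3 L, ‖fx p‖ ^ 2) + om ^ 2 * (∫ p in cell3 L, ‖p.1 • f p‖ ^ 2)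
        + 2 * om * ∫ p in cell3 L, ((p.1 • f p).re * (fx p).re
      + (p.1 • f p).im * (fx p).im) := by
    rw [← integral_const_mul, ← integral_const_mul, ← integral_add ix (iwx.const_mul _),
      ← integral_add (by exact ix.add (iwx.const_mul _)) (icx.const_mul _)]
    refine integral_congr_ae (Eventually.of_forall fun p => ?_)
    simp only [Complex.sq_norm, Complex.normSq_apply, Complex.add_re, Complex.add_im,
      Complex.real_smul, Complex.re_ofReal_mul, Complex.im_ofReal_mul]
    ring
  have ey : ∫ p in cell3 L, ‖fy p + (om * p.2.1) • f p‖ ^ 2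
      = (∫ p in cell3 L, ‖fy p‖ ^ 2) + om ^ 2 * (∫ p in cell3 L, ‖p.2.1 • f p‖ ^ 2)
        + 2 * om * ∫ p in cell3 L, ((p.2.1 • f p).re * (fy p).re
      + (p.2.1 • f p).im * (fy p).im) := by
    rw [← integral_const_mul, ← integral_const_mul, ← integral_add iy (iwy.const_mul _),
      ← integral_add (by exact iy.add (iwy.const_mul _)) (icy.const_mul _)]
    refine integral_congr_ae (Eventually.of_forall fun p => ?_)
    simp only [Complex.sq_norm, Complex.normSq_apply, Complex.add_re, Complex.add_im,
      Complex.real_smul, Complex.re_ofReal_mul, Complex.im_ofReal_mul]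
    ring
  rw [integral_add (integrable_norm_sq (hf.memLp_annihilation_x om))
    (integrable_norm_sq (hf.memLp_annihilation_y om)), ex, ey]
  linear_combination om * zx + om * zy

/-- The Jacobian of a smooth function with bounded transverse support has zero integral, being
`½ ∂ₓ (Im (Ψ conj ∂ᵧΨ)) - ½ ∂ᵧ (Im (Ψ conj ∂ₓΨ))`. -/
theorem Nice.integral_jacobian {L : ℝ} {Ψ : ℝ × ℝ × ℝ → ℂ} (h : Nice L Ψ) :
    ∫ p in cell3 L, ((fderiv ℝ Ψ p (1, 0, 0)).im * (fderiv ℝ Ψ p (0, 1, 0)).re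
      - (fderiv ℝ Ψ p (1, 0, 0)).re * (fderiv ℝ Ψ p (0, 1, 0)).im) = 0 := by
  set fx : ℝ × ℝ × ℝ → ℂ := fun p => fderiv ℝ Ψ p (1, 0, 0) with hfx
  set fy : ℝ × ℝ × ℝ → ℂ := fun p => fderiv ℝ Ψ p (0, 1, 0) with hfy
  set fxy : ℝ × ℝ × ℝ → ℂ := fun p => fderiv ℝ fy p (1, 0, 0) with hfxy
  have r0 := h.regular
  have rx := (h.fderiv_apply (1, 0, 0)).regular
  have ry := (h.fderiv_apply (0, 1, 0)).regular
  have hsymm : ∀ p, fderiv ℝ fx p (0, 1, 0) = fxy p := by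
    intro p
    have hd : DifferentiableAt ℝ (fderiv ℝ Ψ) p :=
      (h.smooth.fderiv_right (m := 1) (by norm_cast)).differentiable (by simp) p
    have hs : IsSymmSndFDerivAt ℝ Ψ p := by
      refine (h.smooth.contDiffAt (x := p)).isSymmSndFDerivAt ?_
      rw [minSmoothness_of_isRCLikeNormedField]
      exact WithTop.coe_le_coe.2 le_top
    have e : ∀ v w : ℝ × ℝ × ℝ, fderiv ℝ (fun p => fderiv ℝ Ψ p v) p w
        = fderiv ℝ (fderiv ℝ Ψ) p w v := by
      intro v w
      rw [fderiv_clm_apply hd (differentiableAt_const v)]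
      simp
    rw [hfxy, hfx, hfy]
    simp only
    rw [e, e]
    exact hs _ _
  have i0 := integrable_im_mul_conj r0.memLp ry.memLp
  have i1 := integrable_im_mul_conj r0.memLp rx.memLp
  have i2 := integrable_im_mul_conj rx.memLp ry.memLp
  have i3 := integrable_im_mul_conj r0.memLp ry.memLp_x
  have d : ∀ {u v : ℝ → ℂ} {u' v' : ℂ} {t : ℝ}, HasDerivAt u u' t → HasDerivAt v v' t →
      HasDerivAt (fun t => (u t).im * (v t).re - (u t).re * (v t).im)
        ((u'.im * (v t).re - u'.re * (v t).im) + ((u t).im * v'.re - (u t).re * v'.im)) t := by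
    intro u v u' v' t hu hv
    have re : ∀ {u : ℝ → ℂ} {u' : ℂ}, HasDerivAt u u' t → HasDerivAt (fun t => (u t).re) u'.re t :=
      fun hu => Complex.reCLM.hasFDerivAt.comp_hasDerivAt t hu
    have im : ∀ {u : ℝ → ℂ} {u' : ℂ}, HasDerivAt u u' t → HasDerivAt (fun t => (u t).im) u'.im t :=
      fun hu => Complex.imCLM.hasFDerivAt.comp_hasDerivAt t hu
    refine (((im hu).mul (re hv)).sub ((re hu).mul (im hv))).congr_deriv ?_
    ring
  have zx := integral_cell3_deriv_x (L := L)
    (G := fun p => (Ψ p).im * (fy p).re - (Ψ p).re * (fy p).im)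
    (G' := fun p => ((fx p).im * (fy p).re - (fx p).re * (fy p).im)
      + ((Ψ p).im * (fxy p).re - (Ψ p).re * (fxy p).im))
    (fun x y z => d (r0.deriv_x x y z) (ry.deriv_x x y z)) i0 (i2.add i3)
  have i2' : Integrable (fun p => (fy p).im * (fx p).re - (fy p).re * (fx p).im)
      (volume.restrict (cell3 L)) := integrable_im_mul_conj ry.memLp rx.memLp
  have zy := integral_cell3_deriv_y (L := L)
    (G := fun p => (Ψ p).im * (fx p).re - (Ψ p).re * (fx p).im)
    (G' := fun p => ((fy p).im * (fx p).re - (fy p).re * (fx p).im)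
      + ((Ψ p).im * (fxy p).re - (Ψ p).re * (fxy p).im))
    (fun x y z => by
      refine (d (r0.deriv_y x y z) (rx.deriv_y x y z)).congr_deriv ?_
      simp only [← hsymm]
      rfl) i1 (i2'.add i3)
  rw [integral_add i2 i3] at zx
  rw [integral_add i2' i3] at zy
  have e : ∫ p in cell3 L, ((fy p).im * (fx p).re - (fy p).re * (fx p).im)
      = - ∫ p in cell3 L, ((fx p).im * (fy p).re - (fx p).re * (fy p).im) := by
    rw [← integral_neg]
    exact integral_congr_ae (Eventually.of_forall fun p => by ring)
  rw [e] at zy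
  linarith

/-- The transverse part of the rotating energy density. -/
def transverseDensity (om Om : ℝ) (u ux uy : ℂ) (x y : ℝ) : ℝ :=
  1 / 2 * (‖ux - Complex.I * (Om * (-y) : ℝ) * u‖ ^ 2 + ‖uy - Complex.I * (Om * x : ℝ) * u‖ ^ 2)
    - 1 / 2 * Om ^ 2 * (x ^ 2 + y ^ 2) * ‖u‖ ^ 2 + 1 / 2 * om ^ 2 * (x ^ 2 + y ^ 2) * ‖u‖ ^ 2

/-- Lower bound for the rotating transverse energy. With `D = ∇ + ω (x, y)`, the nonnegativity of
`∫ |(D_x + i D_y) Ψ|²` bounds `ω` times the angular momentum by `½ ∫ |D Ψ|²`. -/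
theorem Nice.transverse_lower_bound {L : ℝ} {Ψ : ℝ × ℝ × ℝ → ℂ} (h : Nice L Ψ) {om Om : ℝ}
    (hom : 0 < om) (hOm : 0 ≤ Om) :
    om * (∫ p in cell3 L, ‖Ψ p‖ ^ 2) + (om - Om) / om * (1 / 2 *
      ∫ p in cell3 L, (‖fderiv ℝ Ψ p (1, 0, 0) + (om * p.1) • Ψ p‖ ^ 2
        + ‖fderiv ℝ Ψ p (0, 1, 0) + (om * p.2.1) • Ψ p‖ ^ 2))
      ≤ ∫ p in cell3 L, transverseDensity om Om (Ψ p) (fderiv ℝ Ψ p (1, 0, 0))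
        (fderiv ℝ Ψ p (0, 1, 0)) p.1 p.2.1 := by
  set fx : ℝ × ℝ × ℝ → ℂ := fun p => fderiv ℝ Ψ p (1, 0, 0) with hfx
  set fy : ℝ × ℝ × ℝ → ℂ := fun p => fderiv ℝ Ψ p (0, 1, 0) with hfy
  have r0 := h.regular
  have hann := r0.integral_annihilation om
  have hjac := h.integral_jacobian
  have i0 := integrable_norm_sq r0.memLp
  have ix := integrable_norm_sq r0.memLp_x
  have iy := integrable_norm_sq r0.memLp_y
  have iwx := integrable_norm_sq r0.memLp_wx
  have iwy := integrable_norm_sq r0.memLp_wy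
  have idx := integrable_norm_sq (r0.memLp_annihilation_x om)
  have idy := integrable_norm_sq (r0.memLp_annihilation_y om)
  have ij := integrable_im_mul_conj r0.memLp_x r0.memLp_y
  -- the angular momentum density
  set J : ℝ × ℝ × ℝ → ℝ := fun p =>
    ((fy p).im * (p.1 • Ψ p).re - (fy p).re * (p.1 • Ψ p).im)
      - ((fx p).im * (p.2.1 • Ψ p).re - (fx p).re * (p.2.1 • Ψ p).im) with hJ
  have iJ : Integrable J (volume.restrict (cell3 L)) :=
    (integrable_im_mul_conj r0.memLp_y r0.memLp_wx).sub
      (integrable_im_mul_conj r0.memLp_x r0.memLp_wy)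
  have hpos : 0 ≤ ∫ p in cell3 L, ((‖fx p + (om * p.1) • Ψ p‖ ^ 2
      + ‖fy p + (om * p.2.1) • Ψ p‖ ^ 2)
      + (2 * ((fx p).im * (fy p).re - (fx p).re * (fy p).im) - 2 * om * J p)) := by
    refine integral_nonneg fun p => ?_
    have : 0 ≤ ‖(fx p + (om * p.1) • Ψ p) + Complex.I * (fy p + (om * p.2.1) • Ψ p)‖ ^ 2 := by
      positivity
    refine this.trans (le_of_eq ?_)
    simp only [hJ, Complex.sq_norm, Complex.normSq_apply, Complex.add_re, Complex.add_im,
      Complex.real_smul, Complex.ofReal_re, Complex.ofReal_im, Complex.mul_re,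
      Complex.mul_im, Complex.I_re, Complex.I_im]
    ring
  have iD : Integrable (fun p => ‖fx p + (om * p.1) • Ψ p‖ ^ 2
      + ‖fy p + (om * p.2.1) • Ψ p‖ ^ 2) (volume.restrict (cell3 L)) := idx.add idy
  have iR : Integrable (fun p => 2 * ((fx p).im * (fy p).re - (fx p).re * (fy p).im)
      - 2 * om * J p) (volume.restrict (cell3 L)) := (ij.const_mul 2).sub (iJ.const_mul (2 * om))
  rw [integral_add iD iR, integral_sub (ij.const_mul 2) (iJ.const_mul (2 * om)),
    integral_const_mul, integral_const_mul, hjac] at hpos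
  have hT : ∫ p in cell3 L, transverseDensity om Om (Ψ p) (fx p) (fy p) p.1 p.2.1
      = 1 / 2 * (((∫ p in cell3 L, ‖fx p‖ ^ 2) + ∫ p in cell3 L, ‖fy p‖ ^ 2)
        + om ^ 2 * ((∫ p in cell3 L, ‖p.1 • Ψ p‖ ^ 2) + ∫ p in cell3 L, ‖p.2.1 • Ψ p‖ ^ 2))
        - Om * ∫ p in cell3 L, J p := by
    have i12 : Integrable (fun p => ‖fx p‖ ^ 2 + ‖fy p‖ ^ 2) (volume.restrict (cell3 L)) :=
      ix.add iy
    have i34 : Integrable (fun p => ‖p.1 • Ψ p‖ ^ 2 + ‖p.2.1 • Ψ p‖ ^ 2)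
      (volume.restrict (cell3 L)) := iwx.add iwy
    have i14 : Integrable (fun p => (‖fx p‖ ^ 2 + ‖fy p‖ ^ 2)
      + om ^ 2 * (‖p.1 • Ψ p‖ ^ 2 + ‖p.2.1 • Ψ p‖ ^ 2)) (volume.restrict (cell3 L)) :=
      i12.add (i34.const_mul _)
    rw [← integral_add ix iy, ← integral_add iwx iwy, ← integral_const_mul (om ^ 2),
      ← integral_add i12 (i34.const_mul _), ← integral_const_mul, ← integral_const_mul,
      ← integral_sub (i14.const_mul _) (iJ.const_mul _)]
    refine integral_congr_ae (Eventually.of_forall fun p => ?_)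
    simp only [hJ, transverseDensity, Complex.sq_norm, Complex.normSq_apply, Complex.sub_re,
      Complex.sub_im, Complex.real_smul,
      Complex.mul_re, Complex.mul_im, Complex.I_re, Complex.I_im, Complex.ofReal_re,
      Complex.ofReal_im]
    ring
  set H := ∫ p in cell3 L, (‖fx p + (om * p.1) • Ψ p‖ ^ 2
    + ‖fy p + (om * p.2.1) • Ψ p‖ ^ 2) with hH
  set Jt := ∫ p in cell3 L, J p with hJt
  have key : Om * Jt ≤ Om / om * (1 / 2 * H) := by
    rw [div_mul_eq_mul_div, le_div_iff₀ hom]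
    nlinarith
  rw [hT]
  have e : (om - Om) / om * (1 / 2 * H) = 1 / 2 * H - Om / om * (1 / 2 * H) := by
    field_simp
  rw [e]
  linarith

/-! ### Products of Gaussians with longitudinal profiles -/

theorem memLp_tensor {L : ℝ} {a b : ℝ → ℝ} {c : ℝ → ℂ} (ha : MemLp a 2) (hb : MemLp b 2)
    (hc : MemLp c 2 (volume.restrict (Ioo (-(L / 2)) (L / 2)))) :
    MemLp (fun p : ℝ × ℝ × ℝ => (a p.1 * b p.2.1) • c p.2.2) 2 (volume.restrict (cell3 L)) := by
  rw [restrict_cell3]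
  have hm : AEStronglyMeasurable (fun p : ℝ × ℝ × ℝ => (a p.1 * b p.2.1) • c p.2.2)
      ((volume : Measure ℝ).prod ((volume : Measure ℝ).prod
        (volume.restrict (Ioo (-(L / 2)) (L / 2))))) :=
    (ha.1.comp_fst.mul hb.1.comp_fst.comp_snd).smul hc.1.comp_snd.comp_snd
  rw [memLp_two_iff_integrable_sq_norm hm]
  have hb2 := (memLp_two_iff_integrable_sq_norm hb.1).1 hb
  have ha2 := (memLp_two_iff_integrable_sq_norm ha.1).1 ha
  have hc2 := (memLp_two_iff_integrable_sq_norm hc.1).1 hc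
  refine (ha2.mul_prod (hb2.mul_prod hc2)).congr (Eventually.of_forall fun p => ?_)
  simp only [norm_smul, norm_mul]
  ring

theorem integral_tensor (L : ℝ) (a b c : ℝ → ℝ) :
    ∫ p in cell3 L, a p.1 * b p.2.1 * c p.2.2
      = (∫ x, a x) * (∫ y, b y) * ∫ z in Ioo (-(L / 2)) (L / 2), c z := by
  rw [restrict_cell3]
  simp only [mul_assoc]
  rw [integral_prod_mul (f := a) (g := fun q : ℝ × ℝ => b q.1 * c q.2),
    integral_prod_mul (f := b) (g := c)]

theorem tendsto_psiOne_atBot {om : ℝ} (hom : 0 < om) : Tendsto (psiOne om) atBot (𝓝 0) := by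
  have h1 : Tendsto (fun x : ℝ => -(om / 2) * x ^ 2) atBot atBot := by
    refine Tendsto.const_mul_atTop_of_neg (by linarith) ?_
    have := (tendsto_pow_atTop (α := ℝ) (n := 2) (by norm_num)).comp tendsto_neg_atBot_atTop
    simpa [Function.comp_def] using this
  have h2 := (Real.tendsto_exp_atBot.comp h1).const_mul (√√(om / Real.pi))
  rw [mul_zero] at h2
  exact h2

theorem memLp_Ioo_of_continuous {L : ℝ} {φ : ℝ → ℂ} (hφ : Continuous φ) :
    MemLp φ 2 (volume.restrict (Ioo (-(L / 2)) (L / 2))) := by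
  rw [memLp_two_iff_integrable_sq_norm hφ.aestronglyMeasurable]
  exact ((by fun_prop : Continuous fun x => ‖φ x‖ ^ 2).integrableOn_Icc).mono_set
    Ioo_subset_Icc_self

/-- The product of the transverse ground state with a longitudinal profile. -/
def gaussianMul (om : ℝ) (φ : ℝ → ℂ) (p : ℝ × ℝ × ℝ) : ℂ := psiPerp om (p.1, p.2.1) • φ p.2.2

theorem gaussianMul_eq (om : ℝ) (φ : ℝ → ℂ) (p : ℝ × ℝ × ℝ) :
    gaussianMul om φ p = (psiOne om p.1 * psiOne om p.2.1) • φ p.2.2 := by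
  rw [gaussianMul, psiPerp_eq_mul]

section GaussianMul

variable {om L : ℝ} {φ : ℝ → ℂ}

theorem memLp_gaussianMul (hom : 0 < om)
    (hφ : MemLp φ 2 (volume.restrict (Ioo (-(L / 2)) (L / 2)))) :
    MemLp (gaussianMul om φ) 2 (volume.restrict (cell3 L)) := by
  have := memLp_tensor (memLp_psiOne hom) (memLp_psiOne hom) hφ
  simpa only [← gaussianMul_eq] using this

theorem memLp_gaussianMul_wx (hom : 0 < om)
    (hφ : MemLp φ 2 (volume.restrict (Ioo (-(L / 2)) (L / 2)))) :
    MemLp (fun p => p.1 • gaussianMul om φ p) 2 (volume.restrict (cell3 L)) := by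
  have := memLp_tensor (memLp_mul_psiOne hom) (memLp_psiOne hom) hφ
  simpa only [gaussianMul_eq, smul_smul, mul_assoc] using this

theorem memLp_gaussianMul_wy (hom : 0 < om)
    (hφ : MemLp φ 2 (volume.restrict (Ioo (-(L / 2)) (L / 2)))) :
    MemLp (fun p => p.2.1 • gaussianMul om φ p) 2 (volume.restrict (cell3 L)) := by
  have := memLp_tensor (memLp_psiOne hom) (memLp_mul_psiOne hom) hφ
  simpa only [gaussianMul_eq, smul_smul, mul_left_comm] using this

theorem hasDerivAt_gaussianMul_x (x y z : ℝ) :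
    HasDerivAt (fun x => gaussianMul om φ (x, y, z))
      (-(om * x) • gaussianMul om φ (x, y, z)) x := by
  simp only [gaussianMul_eq, smul_smul]
  refine (((hasDerivAt_psiOne om x).mul_const (psiOne om y)).smul_const (φ z)).congr_deriv ?_
  rw [mul_assoc]

theorem hasDerivAt_gaussianMul_y (x y z : ℝ) :
    HasDerivAt (fun y => gaussianMul om φ (x, y, z))
      (-(om * y) • gaussianMul om φ (x, y, z)) y := by
  simp only [gaussianMul_eq, smul_smul]
  refine (((hasDerivAt_psiOne om y).const_mul (psiOne om x)).smul_const (φ z)).congr_deriv ?_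
  rw [mul_left_comm]

theorem regular_gaussianMul (hom : 0 < om) {φ' : ℝ → ℂ} (hd : ∀ z, HasDerivAt φ (φ' z) z)
    (hc' : Continuous φ') :
    Regular L (gaussianMul om φ) (fun p => -(om * p.1) • gaussianMul om φ p)
      (fun p => -(om * p.2.1) • gaussianMul om φ p) (gaussianMul om φ') := by
  have hc : Continuous φ := continuous_iff_continuousAt.2 fun x => (hd x).continuousAt
  have hcG : ∀ {χ : ℝ → ℂ}, Continuous χ → Continuous (gaussianMul om χ) := by
    intro χ hχ
    unfold gaussianMul
    fun_prop
  have hL := memLp_Ioo_of_continuous (L := L) hc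
  refine ⟨hcG hc, ?_, ?_, hcG hc', fun x y z => hasDerivAt_gaussianMul_x x y z,
    fun x y z => hasDerivAt_gaussianMul_y x y z,
    fun x y z => (hd z).fun_const_smul (psiPerp om (x, y)), fun y z => ?_,
    fun x z => ?_, memLp_gaussianMul hom hL, ?_, ?_,
    memLp_gaussianMul hom (memLp_Ioo_of_continuous hc'),
    memLp_gaussianMul_wx hom hL, memLp_gaussianMul_wy hom hL⟩
  · have := hcG hc; fun_prop
  · have := hcG hc; fun_prop
  · simp only [gaussianMul_eq]
    simpa using ((tendsto_psiOne_atBot hom).mul_const (psiOne om y)).smul_const (φ z)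
  · simp only [gaussianMul_eq]
    simpa using ((tendsto_psiOne_atBot hom).const_mul (psiOne om x)).smul_const (φ z)
  · have h : MemLp (fun p => (-om) • (p.1 • gaussianMul om φ p)) 2 (volume.restrict (cell3 L)) :=
      (memLp_gaussianMul_wx hom hL).const_smul (-om)
    simpa only [smul_smul, neg_mul] using h
  · have h : MemLp (fun p => (-om) • (p.2.1 • gaussianMul om φ p)) 2 (volume.restrict (cell3 L)) :=
      (memLp_gaussianMul_wy hom hL).const_smul (-om)
    simpa only [smul_smul, neg_mul] using h

theorem gHat_eq_mul (g om : ℝ) :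
    gHat g om = g * ((∫ x, psiOne om x ^ 4) * ∫ y, psiOne om y ^ 4) := by
  rw [gHat, Measure.volume_eq_prod, ← integral_prod_mul]
  congr 1
  refine integral_congr_ae (Eventually.of_forall fun q => ?_)
  simp only [psiPerp_eq_mul]
  rw [← mul_pow, Even.pow_abs (by decide)]

/-- The transverse ground state turns the coupling constant `g` into `gHat g om`. -/
theorem integral_gaussianMul_pow_four (g om L : ℝ) (φ : ℝ → ℂ) :
    g * ∫ p in cell3 L, ‖gaussianMul om φ p‖ ^ 4
      = gHat g om * ∫ z in Ioo (-(L / 2)) (L / 2), ‖φ z‖ ^ 4 := by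
  rw [gHat_eq_mul, mul_assoc g, ← integral_tensor L (fun x => psiOne om x ^ 4)
    (fun y => psiOne om y ^ 4) fun z => ‖φ z‖ ^ 4]
  congr 1
  refine integral_congr_ae (Eventually.of_forall fun p => ?_)
  simp only [gaussianMul_eq, norm_smul, norm_mul, mul_pow, Real.norm_eq_abs]
  rw [Even.pow_abs (by decide), Even.pow_abs (by decide)]

end GaussianMul

/-! ### The projection onto the transverse ground state -/

/-- The longitudinal profile of `F`: the coefficient of the transverse ground state in the
horizontal slice at height `z`. -/
def proj (om : ℝ) (F : ℝ × ℝ × ℝ → ℂ) (z : ℝ) : ℂ := ∫ q, psiPerp om q • F (q.1, q.2, z)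

section Proj

variable {L om : ℝ} {F : ℝ × ℝ × ℝ → ℂ}

theorem Nice.exists_compact (h : Nice L F) :
    ∃ K : Set (ℝ × ℝ), IsCompact K ∧ ∀ q ∉ K, ∀ z, F (q.1, q.2, z) = 0 := by
  obtain ⟨R, hR⟩ := h.vanish
  refine ⟨Icc (-R) R ×ˢ Icc (-R) R, isCompact_Icc.prod isCompact_Icc, fun q hq z =>
    hR (q.1, q.2, z) ?_⟩
  by_contra hcon
  push Not at hcon
  exact hq ⟨abs_le.1 hcon.1, abs_le.1 hcon.2⟩

theorem Nice.continuous_proj (h : Nice L F) : Continuous (proj om F) := by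
  obtain ⟨K, hK, h0⟩ := h.exists_compact
  have hc := h.smooth.continuous
  exact continuous_integral_of_vanishing hK
    (F := fun q z => psiPerp om q • F (q.1, q.2, z)) (by fun_prop)
    fun q hq z => by rw [h0 q hq z, smul_zero]

theorem Nice.hasDerivAt_proj (h : Nice L F) (z : ℝ) :
    HasDerivAt (proj om F) (proj om (fun p => fderiv ℝ F p (0, 0, 1)) z) z := by
  obtain ⟨K, hK, h0⟩ := h.exists_compact
  obtain ⟨K', hK', h0'⟩ := (h.fderiv_apply (0, 0, 1)).exists_compact
  have hc := h.smooth.continuous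
  have hc' := (h.fderiv_apply (0, 0, 1)).smooth.continuous
  refine hasDerivAt_integral_of_vanishing (hK.union hK') (hK.union hK').measurableSet
    (F := fun q z => psiPerp om q • F (q.1, q.2, z))
    (F' := fun q z => psiPerp om q • fderiv ℝ F (q.1, q.2, z) (0, 0, 1))
    (by fun_prop) (by fun_prop) (fun q hq z => ?_) (fun q hq z => ?_)
    (fun q z => (h.regular.deriv_z q.1 q.2 z).fun_const_smul _) z
  · rw [h0 q (fun hh => hq (Or.inl hh)) z, smul_zero]
  · rw [h0' q (fun hh => hq (Or.inr hh)) z, smul_zero]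

theorem Nice.proj_periodic (h : Nice L F) (z : ℝ) : proj om F (z + L) = proj om F z := by
  unfold proj
  congr 1
  funext q
  rw [← h.periodic (q.1, q.2, z)]

theorem Nice.memLp_slice (h : Nice L F) (z : ℝ) :
    MemLp (fun q : ℝ × ℝ => F (q.1, q.2, z)) 2 := by
  obtain ⟨R, hR⟩ := h.vanish
  have hc := h.smooth.continuous
  exact (by fun_prop : Continuous fun q : ℝ × ℝ => F (q.1, q.2, z)).memLp_of_hasCompactSupport
    (hasCompactSupport_of_box fun q hq => hR (q.1, q.2, z) hq)

theorem integrable_weight_mul {W : ℝ → ℝ} (hW : Continuous W) {G : ℝ × ℝ × ℝ → ℝ}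
    (hG : Integrable G (volume.restrict (cell3 L))) :
    Integrable (fun p => W p.2.2 * G p) (volume.restrict (cell3 L)) := by
  obtain ⟨M, hM⟩ := (isCompact_Icc (a := -(L / 2)) (b := L / 2)).exists_bound_of_continuousOn
    hW.continuousOn
  refine hG.bdd_mul (c := M)
    (by fun_prop : Continuous fun p : ℝ × ℝ × ℝ => W p.2.2).aestronglyMeasurable ?_
  filter_upwards [ae_restrict_mem (measurableSet_cell3 L)] with p hp
  exact hM _ (Ioo_subset_Icc_self hp)

theorem Nice.regular_sub_proj (hom : 0 < om) (h : Nice L F) :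
    Regular L (fun p => F p - gaussianMul om (proj om F) p)
      (fun p => fderiv ℝ F p (1, 0, 0) - -(om * p.1) • gaussianMul om (proj om F) p)
      (fun p => fderiv ℝ F p (0, 1, 0) - -(om * p.2.1) • gaussianMul om (proj om F) p)
      (fun p => fderiv ℝ F p (0, 0, 1)
        - gaussianMul om (proj om fun p => fderiv ℝ F p (0, 0, 1)) p) :=
  h.regular.sub (regular_gaussianMul hom h.hasDerivAt_proj (h.fderiv_apply _).continuous_proj)

/-- Pythagoras for the projection, with a longitudinal weight. -/
theorem Nice.integral_pythagoras (hom : 0 < om) (h : Nice L F) {W : ℝ → ℝ} (hW : Continuous W) :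
    ∫ p in cell3 L, W p.2.2 * ‖F p‖ ^ 2
      = (∫ z in Ioo (-(L / 2)) (L / 2), W z * ‖proj om F z‖ ^ 2)
        + ∫ p in cell3 L, W p.2.2 * ‖F p - gaussianMul om (proj om F) p‖ ^ 2 := by
  have r := h.regular_sub_proj hom
  have iF := integrable_weight_mul hW (integrable_norm_sq h.regular.memLp)
  have ib := integrable_weight_mul hW (integrable_norm_sq r.memLp)
  have hc := h.continuous_proj (om := om)
  rw [integral_cell3 L iF, integral_cell3 L ib, ← integral_add]
  · refine integral_congr_ae (Eventually.of_forall fun z => ?_)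
    have := integral_norm_sub_proj_sq (memLp_psiPerp hom) (integral_psiPerp_sq hom)
      (h.memLp_slice z)
    simp only [integral_const_mul, gaussianMul]
    rw [← mul_add]
    congr 1
    simp only [proj]
    rw [this]
    ring
  · exact ((by fun_prop : Continuous fun z => W z * ‖proj om F z‖ ^ 2).integrableOn_Icc).mono_set
      Ioo_subset_Icc_self
  · exact ((integrable_cell3_iff L).1 ib).integral_prod_right

/-- The spectral gap, integrated over the slices. -/
theorem Nice.integral_gap (hom : 0 < om) (h : Nice L F) :
    ∫ p in cell3 L, ‖F p - gaussianMul om (proj om F) p‖ ^ 2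
      ≤ 4 / om * ∫ p in cell3 L, (‖fderiv ℝ F p (1, 0, 0) + (om * p.1) • F p‖ ^ 2
        + ‖fderiv ℝ F p (0, 1, 0) + (om * p.2.1) • F p‖ ^ 2) := by
  have r := h.regular_sub_proj hom
  have r0 := h.regular
  obtain ⟨R0, hR0⟩ := h.vanish
  obtain ⟨R1, hR1⟩ := (h.fderiv_apply (1, 0, 0)).vanish
  obtain ⟨R2, hR2⟩ := (h.fderiv_apply (0, 1, 0)).vanish
  have c0 := r0.cont
  have cx := r0.cont_x
  have cy := r0.cont_y
  rw [← integral_const_mul]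
  refine integral_cell3_mono (integrable_norm_sq r.memLp)
    (((integrable_norm_sq (r0.memLp_annihilation_x om)).add
      (integrable_norm_sq (r0.memLp_annihilation_y om))).const_mul _) fun z => ?_
  rw [integral_const_mul]
  have hv : ∀ (R' : ℝ) (q : ℝ × ℝ), max R0 (max R1 R2) < |q.1| ∨ max R0 (max R1 R2) < |q.2| →
      R' ≤ max R0 (max R1 R2) → R' < |q.1| ∨ R' < |q.2| := fun R' q hq hle =>
    hq.imp (fun hh => hle.trans_lt hh) (fun hh => hle.trans_lt hh)
  exact gap_two hom (f := fun q => F (q.1, q.2, z))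
    (fx := fun q => fderiv ℝ F (q.1, q.2, z) (1, 0, 0))
    (fy := fun q => fderiv ℝ F (q.1, q.2, z) (0, 1, 0)) (by fun_prop) (by fun_prop) (by fun_prop)
    (fun x y => r0.deriv_x x y z) (fun x y => r0.deriv_y x y z) (R := max R0 (max R1 R2))
    (fun q hq => hR0 (q.1, q.2, z) (hv R0 q hq (le_max_left _ _)))
    (fun q hq => hR1 (q.1, q.2, z) (hv R1 q hq (le_max_of_le_right (le_max_left _ _))))
    (fun q hq => hR2 (q.1, q.2, z) (hv R2 q hq (le_max_of_le_right (le_max_right _ _))))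

end Proj

/-! ### The longitudinal functional -/

theorem continuous_latticePotential {w : ℝ → ℝ} (hw : Continuous w) (ε : ℝ) :
    Continuous (latticePotential w ε) := by
  unfold latticePotential; fun_prop

theorem latticePotential_nonneg {w : ℝ → ℝ} (hw : ∀ z, 0 ≤ w z) (ε z : ℝ) :
    0 ≤ latticePotential w ε z :=
  mul_nonneg (by positivity) (hw z)

theorem integrable_weight_mul_Ioo {L : ℝ} {W : ℝ → ℝ} (hW : Continuous W) {G : ℝ → ℝ}
    (hG : Integrable G (volume.restrict (Ioo (-(L / 2)) (L / 2)))) :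
    Integrable (fun z => W z * G z) (volume.restrict (Ioo (-(L / 2)) (L / 2))) := by
  obtain ⟨M, hM⟩ := (isCompact_Icc (a := -(L / 2)) (b := L / 2)).exists_bound_of_continuousOn
    hW.continuousOn
  refine hG.bdd_mul (c := M) hW.aestronglyMeasurable ?_
  filter_upwards [ae_restrict_mem measurableSet_Ioo] with z hz
  exact hM _ (Ioo_subset_Icc_self hz)

theorem energyA_eq {w : ℝ → ℝ} (hw : Continuous w) {L ε gh : ℝ} {φ v : ℝ → ℂ}
    (hv : HasWeakDeriv φ 1 v) (hφL : MemLp φ 2 (volume.restrict (Ioo (-(L / 2)) (L / 2))))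
    (hvL : MemLp v 2 (volume.restrict (Ioo (-(L / 2)) (L / 2))))
    (hφ4 : Integrable (fun z => ‖φ z‖ ^ 4) (volume.restrict (Ioo (-(L / 2)) (L / 2)))) :
    energyA w L ε gh φ = 1 / 2 * (∫ z in Ioo (-(L / 2)) (L / 2), ‖v z‖ ^ 2)
      + (∫ z in Ioo (-(L / 2)) (L / 2), latticePotential w ε z * ‖φ z‖ ^ 2)
      + gh * ∫ z in Ioo (-(L / 2)) (L / 2), ‖φ z‖ ^ 4 := by
  have iv := (integrable_norm_sq hvL).const_mul (1 / 2)
  have iW := integrable_weight_mul_Ioo (continuous_latticePotential hw ε) (integrable_norm_sq hφL)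
  rw [← integral_const_mul, ← integral_const_mul, ← integral_add iv iW,
    ← integral_add (by exact iv.add iW) (hφ4.const_mul gh), energyA]
  refine integral_congr_ae ?_
  filter_upwards [ae_restrict_of_ae hv.weakDeriv_ae_eq] with z hz
  rw [hz]

theorem energyA_nonneg {w : ℝ → ℝ} (hw : ∀ z, 0 ≤ w z) {L ε gh : ℝ} (hgh : 0 ≤ gh) (φ : ℝ → ℂ) :
    0 ≤ energyA w L ε gh φ :=
  integral_nonneg fun z => by
    have := latticePotential_nonneg hw ε z
    simp only [Pi.zero_apply]
    positivity

theorem gHat_nonneg {g : ℝ} (hg : 0 ≤ g) (om : ℝ) : 0 ≤ gHat g om :=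
  mul_nonneg hg (integral_nonneg fun q => by positivity)

theorem mA_le {w : ℝ → ℝ} (hw : ∀ z, 0 ≤ w z) {T : ℝ} {N : ℕ} {ε gh : ℝ} (hgh : 0 ≤ gh)
    {φ : ℝ → ℂ} (hφ : MemH1Per (N * T) φ)
    (h1 : ∫ z in Ioo (-(N * T / 2)) (N * T / 2), ‖φ z‖ ^ 2 = 1) :
    mA w T N ε gh ≤ energyA w (N * T) ε gh φ := by
  refine csInf_le ⟨0, ?_⟩ ⟨φ, ⟨hφ, h1⟩, rfl⟩
  rintro _ ⟨φ, -, rfl⟩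
  exact energyA_nonneg hw hgh φ

theorem mA_nonneg {w : ℝ → ℝ} (hw : ∀ z, 0 ≤ w z) {T : ℝ} {N : ℕ} {ε gh : ℝ} (hgh : 0 ≤ gh) :
    0 ≤ mA w T N ε gh := by
  refine Real.sInf_nonneg ?_
  rintro _ ⟨φ, -, rfl⟩
  exact energyA_nonneg hw hgh φ

/-- The functional at a profile of mass `s ≤ 1` is at least `s² m_A`, by normalizing it. -/
theorem sq_mul_mA_le {w : ℝ → ℝ} (hwc : Continuous w) (hw : ∀ z, 0 ≤ w z) {T : ℝ} {N : ℕ}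
    {ε gh : ℝ} (hgh : 0 ≤ gh) {φ φ' : ℝ → ℂ} (hd : ∀ z, HasDerivAt φ (φ' z) z)
    (hc' : Continuous φ') (hper : ∀ z, φ (z + N * T) = φ z) {s : ℝ}
    (hs : ∫ z in Ioo (-(N * T / 2)) (N * T / 2), ‖φ z‖ ^ 2 = s) (hs1 : s ≤ 1) :
    s ^ 2 * mA w T N ε gh ≤ 1 / 2 * (∫ z in Ioo (-(N * T / 2)) (N * T / 2), ‖φ' z‖ ^ 2)
      + (∫ z in Ioo (-(N * T / 2)) (N * T / 2), latticePotential w ε z * ‖φ z‖ ^ 2)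
      + gh * ∫ z in Ioo (-(N * T / 2)) (N * T / 2), ‖φ z‖ ^ 4 := by
  set I : Set ℝ := Ioo (-(N * T / 2)) (N * T / 2) with hI
  have hc : Continuous φ := continuous_iff_continuousAt.2 fun x => (hd x).continuousAt
  have hK : 0 ≤ ∫ z in I, ‖φ' z‖ ^ 2 := integral_nonneg fun z => by positivity
  have hV : 0 ≤ ∫ z in I, latticePotential w ε z * ‖φ z‖ ^ 2 :=
    integral_nonneg fun z => mul_nonneg (latticePotential_nonneg hw ε z) (by positivity)
  have hA : 0 ≤ gh * ∫ z in I, ‖φ z‖ ^ 4 :=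
    mul_nonneg hgh (integral_nonneg fun z => by positivity)
  have hs0 : 0 ≤ s := hs ▸ integral_nonneg fun z => by positivity
  rcases hs0.eq_or_lt with h0 | hpos
  · rw [← h0]; simp only [ne_eq, OfNat.ofNat_ne_zero, not_false_eq_true, zero_pow, zero_mul]
    positivity
  set c : ℝ := 1 / √s with hcdef
  have hc2 : c ^ 2 = 1 / s := by rw [hcdef, div_pow, Real.sq_sqrt hs0, one_pow]
  have hc4 : c ^ 4 = 1 / s ^ 2 := by
    rw [show c ^ 4 = (c ^ 2) ^ 2 by ring, hc2, div_pow, one_pow]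
  have hdc : ∀ z, HasDerivAt (fun z => c • φ z) (c • φ' z) z := fun z => (hd z).fun_const_smul c
  have hcc : Continuous fun z => c • φ z := by fun_prop
  have hcc' : Continuous fun z => c • φ' z := by fun_prop
  have hweak : HasWeakDeriv (fun z => c • φ z) 1 (fun z => c • φ' z) := by
    have h1 : ContDiff ℝ 1 fun z => c • φ z := by
      rw [contDiff_one_iff_deriv]
      refine ⟨fun z => (hdc z).differentiableAt, ?_⟩
      rw [show deriv (fun z => c • φ z) = fun z => c • φ' z from funext fun z => (hdc z).deriv]
      exact hcc'
    have h2 := HasWeakDeriv.of_contDiff h1 1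
    refine h2.congr (Eventually.of_forall fun _ => rfl) (Eventually.of_forall fun z => ?_)
    show fderiv ℝ (fun z => c • φ z) z 1 = c • φ' z
    rw [← (hdc z).deriv, fderiv_apply_one_eq_deriv]
  have hm : MemH1Per (N * T) fun z => c • φ z :=
    ⟨Eventually.of_forall fun z => by simp only [hper], memLp_Ioo_of_continuous hcc,
      ⟨_, hweak, memLp_Ioo_of_continuous hcc'⟩⟩
  have hpow : ∀ (k : ℕ) (u : ℂ), ‖c • u‖ ^ k = c ^ k * ‖u‖ ^ k := fun k u => by
    rw [norm_smul, mul_pow, Real.norm_of_nonneg (by positivity)]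
  have h1 : ∫ z in I, ‖c • φ z‖ ^ 2 = 1 := by
    simp only [hpow]
    rw [integral_const_mul, hs, hc2]
    field_simp
  have hle := mA_le hw hgh (ε := ε) hm h1
  have hi4 : Integrable (fun z => ‖c • φ z‖ ^ 4) (volume.restrict I) :=
    ((by fun_prop : Continuous fun z => ‖c • φ z‖ ^ 4).integrableOn_Icc).mono_set
      Ioo_subset_Icc_self
  rw [energyA_eq hwc hweak (memLp_Ioo_of_continuous hcc) (memLp_Ioo_of_continuous hcc') hi4] at hle
  have e1 : ∀ z, latticePotential w ε z * ‖c • φ z‖ ^ 2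
      = c ^ 2 * (latticePotential w ε z * ‖φ z‖ ^ 2) := fun z => by rw [hpow]; ring
  simp only [e1] at hle
  simp only [hpow] at hle
  rw [integral_const_mul, integral_const_mul, integral_const_mul, hc2, hc4] at hle
  set K := ∫ z in I, ‖φ' z‖ ^ 2
  set V := ∫ z in I, latticePotential w ε z * ‖φ z‖ ^ 2
  set A := ∫ z in I, ‖φ z‖ ^ 4
  calc s ^ 2 * mA w T N ε gh
      ≤ s ^ 2 * (1 / 2 * (1 / s * K) + 1 / s * V + gh * (1 / s ^ 2 * A)) := by gcongr
    _ = s * (1 / 2 * K + V) + gh * A := by field_simp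
    _ ≤ 1 * (1 / 2 * K + V) + gh * A := by gcongr
    _ = _ := by ring

/-! ### The lower bound for smooth functions -/

/-- Convexity of `x ↦ x⁴` with the weights `1 / (1 + t)` and `t / (1 + t)`. -/
theorem add_pow_four_le {t u v : ℝ} (ht : 0 < t) :
    (u + v) ^ 4 ≤ (1 + t) ^ 3 * u ^ 4 + (1 + 1 / t) ^ 3 * v ^ 4 := by
  have hconv := (Even.convexOn_pow (𝕜 := ℝ) (n := 4) (by decide)).2
  replace hconv := hconv (mem_univ ((1 + t) * u)) (mem_univ ((1 + 1 / t) * v))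
    (show 0 ≤ 1 / (1 + t) by positivity) (show 0 ≤ t / (1 + t) by positivity) (by field_simp)
  simp only [smul_eq_mul] at hconv
  have e1 : 1 / (1 + t) * ((1 + t) * u) + t / (1 + t) * ((1 + 1 / t) * v) = u + v := by
    field_simp
    ring
  have e2 : 1 / (1 + t) * ((1 + t) * u) ^ 4 = (1 + t) ^ 3 * u ^ 4 := by field_simp
  have e3 : t / (1 + t) * ((1 + 1 / t) * v) ^ 4 = (1 + 1 / t) ^ 3 * v ^ 4 := by
    have : 1 + 1 / t = (1 + t) / t := by field_simp; ring
    rw [this]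
    field_simp
  rw [e1, e2, e3] at hconv
  exact hconv

/-- The elementary inequality which combines the estimates of the lower bound. Here `X` is the
excess energy, `h` the transverse excess, `Nb`, `Kb` and `B` the mass, the longitudinal energy and
the quartic energy of the part orthogonal to the transverse ground state, `E` and `A` the linear
and the quartic energy of the longitudinal profile. If `X ≥ m` there is nothing to prove; otherwise
`hX` bounds every term on its left by `m`. -/
theorem excess_lower_bound {om d g L m h Nb Kb E A B G X t : ℝ} (hom : 0 < om) (hd : 0 < d)
    (hg : 0 ≤ g) (hL : 0 < L) (hm : 0 ≤ m) (hh : 0 ≤ h) (hKb : 0 ≤ Kb) (hE : 0 ≤ E)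
    (hG : 0 ≤ G) (ht : 0 < t) (ht1 : t ≤ 1)
    (hNb0 : 0 ≤ Nb) (hNb : Nb ≤ 8 / om * h) (hmE : (1 - Nb) ^ 2 * m ≤ E + A)
    (hB : ∀ l : ℝ, 0 < l → B ≤ g * (4 * ((1 / L + l) * Nb + 1 / l * Kb) * (2 * h + 2 * om * Nb)))
    (hA : A ≤ (1 + t) ^ 3 * G + (1 + 1 / t) ^ 3 * B)
    (hX : d / om * h + E + 1 / 2 * Kb + G ≤ X) :
    m * (1 - 16 * (m / d) - 7 * t
      - 5760 / t ^ 3 * (g * om * m / (d * √d) * (1 + 1 / (√d * L)))) ≤ X := by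
  have hsd : 0 < √d := Real.sqrt_pos.2 hd
  have hdd : √d * √d = d := Real.mul_self_sqrt hd.le
  set Z := g * om * m / (d * √d) * (1 + 1 / (√d * L)) with hZ
  have hZ0 : 0 ≤ Z := by positivity
  rcases le_or_gt m X with hmX | hXm
  · refine le_trans ?_ hmX
    have : 0 ≤ m * (16 * (m / d) + 7 * t + 5760 / t ^ 3 * Z) := by positivity
    linarith
  have hdh : d / om * h ≤ m := by linarith
  have hh' : h ≤ om * m / d := by
    rw [le_div_iff₀ hd]
    have := mul_le_mul_of_nonneg_left hdh hom.le
    have e : om * (d / om * h) = h * d := by field_simp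
    linarith
  have hdh0 : 0 ≤ d / om * h := by positivity
  have hKb' : Kb ≤ 2 * m := by linarith
  have hGm : G ≤ m := by linarith
  have hNb' : Nb ≤ 8 * (m / d) := by
    refine hNb.trans ?_
    calc 8 / om * h ≤ 8 / om * (om * m / d) := by gcongr
      _ = 8 * (m / d) := by field_simp
  have hgrad : 2 * h + 2 * om * Nb ≤ 18 * (om * m / d) := by
    have : om * Nb ≤ om * (8 * (m / d)) := by gcongr
    have e : om * (8 * (m / d)) = 8 * (om * m / d) := by ring
    linarith
  -- the choice `l = √d` balances the mass and the longitudinal energy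
  have hmass : (1 / L + √d) * Nb + 1 / √d * Kb ≤ 10 * (m / √d * (1 + 1 / (√d * L))) := by
    calc (1 / L + √d) * Nb + 1 / √d * Kb
        ≤ (1 / L + √d) * (8 * (m / d)) + 1 / √d * (2 * m) := by gcongr
      _ = 10 * (m / √d) + 8 * (m / √d * (1 / (√d * L))) := by
          rw [show m / d = m / (√d * √d) by rw [hdd]]
          field_simp
          ring
      _ ≤ 10 * (m / √d * (1 + 1 / (√d * L))) := by
          have : 0 ≤ m / √d * (1 / (√d * L)) := by positivity
          linarith
  have hBZ : B ≤ 720 * (m * Z) := by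
    refine (hB √d hsd).trans ?_
    calc g * (4 * ((1 / L + √d) * Nb + 1 / √d * Kb) * (2 * h + 2 * om * Nb))
        ≤ g * (4 * (10 * (m / √d * (1 + 1 / (√d * L)))) * (18 * (om * m / d))) := by gcongr
      _ = 720 * (m * Z) := by rw [hZ]; field_simp; ring
  have ht3 : (1 + t) ^ 3 ≤ 1 + 7 * t := by nlinarith [sq_nonneg t, mul_nonneg ht.le (sq_nonneg t)]
  have ht3' : (1 + 1 / t) ^ 3 ≤ 8 / t ^ 3 := by
    have : 1 + 1 / t ≤ 2 / t := by
      have : 1 ≤ 1 / t := by rw [le_div_iff₀ ht]; linarith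
      have e : 2 / t = 1 / t + 1 / t := by ring
      linarith
    calc (1 + 1 / t) ^ 3 ≤ (2 / t) ^ 3 := by gcongr
      _ = 8 / t ^ 3 := by rw [div_pow]; norm_num
  have hAle : A ≤ G + 7 * t * m + 5760 / t ^ 3 * (m * Z) := by
    refine hA.trans ?_
    have h1 : (1 + t) ^ 3 * G ≤ (1 + 7 * t) * G := by gcongr
    have h2 : 7 * t * G ≤ 7 * t * m := by gcongr
    have h3 : (1 + 1 / t) ^ 3 * B ≤ 8 / t ^ 3 * (720 * (m * Z)) := by
      have : 0 ≤ 720 * (m * Z) := by positivity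
      calc (1 + 1 / t) ^ 3 * B ≤ (1 + 1 / t) ^ 3 * (720 * (m * Z)) := by gcongr
        _ ≤ _ := by gcongr
    have e : 8 / t ^ 3 * (720 * (m * Z)) = 5760 / t ^ 3 * (m * Z) := by ring
    linarith
  have hsq : (1 - 2 * Nb) * m ≤ (1 - Nb) ^ 2 * m := by
    gcongr
    nlinarith [sq_nonneg Nb]
  have hNm : Nb * m ≤ 8 * (m / d) * m := by gcongr
  have e : m * (1 - 16 * (m / d) - 7 * t - 5760 / t ^ 3 * Z)
      = m - 2 * (8 * (m / d) * m) - 7 * t * m - 5760 / t ^ 3 * (m * Z) := by ring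
  rw [e]
  linarith

/-- The lower bound for normalized smooth functions with bounded transverse support. -/
theorem Nice.lower_bound {w : ℝ → ℝ} (hwc : Continuous w) (hw : ∀ z, 0 ≤ w z) {T : ℝ} {N : ℕ}
    (hL : 0 < N * T) {ε om Om g : ℝ} (hOm : 0 ≤ Om) (hlt : Om < om) (hg : 0 ≤ g)
    {Ψ : ℝ × ℝ × ℝ → ℂ} (h : Nice (N * T) Ψ) (h1 : ∫ p in cell3 (N * T), ‖Ψ p‖ ^ 2 = 1)
    {t : ℝ} (ht : 0 < t) (ht1 : t ≤ 1) :
    om + mA w T N ε (gHat g om) * (1 - 16 * (mA w T N ε (gHat g om) / (om - Om)) - 7 * t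
      - 5760 / t ^ 3 * (g * om * mA w T N ε (gHat g om) / ((om - Om) * √(om - Om))
        * (1 + 1 / (√(om - Om) * (N * T)))))
      ≤ (∫ p in cell3 (N * T), transverseDensity om Om (Ψ p) (fderiv ℝ Ψ p (1, 0, 0))
          (fderiv ℝ Ψ p (0, 1, 0)) p.1 p.2.1)
        + 1 / 2 * (∫ p in cell3 (N * T), ‖fderiv ℝ Ψ p (0, 0, 1)‖ ^ 2)
        + (∫ p in cell3 (N * T), latticePotential w ε p.2.2 * ‖Ψ p‖ ^ 2)
        + g * ∫ p in cell3 (N * T), ‖Ψ p‖ ^ 4 := by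
  have hom : 0 < om := hOm.trans_lt hlt
  have hgh := gHat_nonneg hg om
  have hWc := continuous_latticePotential hwc ε
  set L : ℝ := N * T with hLdef
  set dz : ℝ × ℝ × ℝ → ℂ := fun p => fderiv ℝ Ψ p (0, 0, 1) with hdz
  set φ : ℝ → ℂ := proj om Ψ with hφ
  set b : ℝ × ℝ × ℝ → ℂ := fun p => Ψ p - gaussianMul om φ p with hb
  have hndz : Nice L dz := h.fderiv_apply _
  have r0 := h.regular
  have r := h.regular_sub_proj hom
  have hT := h.transverse_lower_bound hom hOm
  have hgap := h.integral_gap hom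
  have hbann := r.integral_annihilation om
  have hP := h.integral_pythagoras hom (W := fun _ => 1) continuous_const
  have hPz := hndz.integral_pythagoras hom (W := fun _ => 1) continuous_const
  have hPW := h.integral_pythagoras hom hWc
  simp only [one_mul] at hP hPz
  rw [← hφ] at hP hPW hgap hbann r
  rw [h1] at hP
  rw [h1, mul_one] at hT
  -- the annihilation operators do not see the projection
  have hDb : ∀ (c : ℝ) (u v z : ℂ), u - -c • v + c • (z - v) = u + c • z := by
    intro c u v z
    rw [smul_sub, neg_smul]; abel
  simp only [hDb] at hbann
  set D := ∫ p in cell3 L, (‖fderiv ℝ Ψ p (1, 0, 0) + (om * p.1) • Ψ p‖ ^ 2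
        + ‖fderiv ℝ Ψ p (0, 1, 0) + (om * p.2.1) • Ψ p‖ ^ 2) with hD
  have hD0 : 0 ≤ D := integral_nonneg fun p => by positivity
  set Nb := ∫ p in cell3 L, ‖Ψ p - gaussianMul om φ p‖ ^ 2 with hNb
  have hNb0 : 0 ≤ Nb := integral_nonneg fun p => by positivity
  set Kb := ∫ p in cell3 L, ‖dz p - gaussianMul om (proj om dz) p‖ ^ 2 with hKb
  have hKb0 : 0 ≤ Kb := integral_nonneg fun p => by positivity
  have hVb0 : 0 ≤ ∫ p in cell3 L, latticePotential w ε p.2.2 * ‖Ψ p - gaussianMul om φ p‖ ^ 2 :=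
    integral_nonneg fun p => mul_nonneg (latticePotential_nonneg hw _ _) (by positivity)
  set I : Set ℝ := Ioo (-(L / 2)) (L / 2) with hI
  have hKφ0 : 0 ≤ ∫ z in I, ‖proj om dz z‖ ^ 2 := integral_nonneg fun z => by positivity
  have hVφ0 : 0 ≤ ∫ z in I, latticePotential w ε z * ‖φ z‖ ^ 2 :=
    integral_nonneg fun z => mul_nonneg (latticePotential_nonneg hw _ _) (by positivity)
  have hmE := sq_mul_mA_le hwc hw (T := T) (N := N) (ε := ε) hgh h.hasDerivAt_proj
    hndz.continuous_proj h.proj_periodic (s := 1 - Nb) (by linarith) (by linarith)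
  -- quartic terms: `|psiPerp φ| ≤ |Ψ| + |b|` pointwise
  obtain ⟨iΨ4, -⟩ := r0.pow_four hL one_pos
  obtain ⟨ib4, -⟩ := r.pow_four hL one_pos
  have hwx0 : 0 ≤ ∫ p in cell3 L, ‖p.1 • (Ψ p - gaussianMul om φ p)‖ ^ 2 :=
    integral_nonneg fun p => by positivity
  have hwy0 : 0 ≤ ∫ p in cell3 L, ‖p.2.1 • (Ψ p - gaussianMul om φ p)‖ ^ 2 :=
    integral_nonneg fun p => by positivity
  have hB : ∀ l : ℝ, 0 < l → g * ∫ p in cell3 L, ‖Ψ p - gaussianMul om φ p‖ ^ 4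
      ≤ g * (4 * ((1 / L + l) * Nb + 1 / l * Kb) * (2 * (1 / 2 * D) + 2 * om * Nb)) := by
    intro l hl
    refine mul_le_mul_of_nonneg_left ?_ hg
    refine (r.pow_four hL hl).2.trans ?_
    refine mul_le_mul_of_nonneg_left ?_ (by positivity)
    nlinarith [mul_nonneg (sq_nonneg om) (add_nonneg hwx0 hwy0)]
  have hA : gHat g om * ∫ z in I, ‖φ z‖ ^ 4
      ≤ (1 + t) ^ 3 * (g * ∫ p in cell3 L, ‖Ψ p‖ ^ 4)
        + (1 + 1 / t) ^ 3 * (g * ∫ p in cell3 L, ‖Ψ p - gaussianMul om φ p‖ ^ 4) := by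
    have e : (1 + t) ^ 3 * (g * ∫ p in cell3 L, ‖Ψ p‖ ^ 4)
        + (1 + 1 / t) ^ 3 * (g * ∫ p in cell3 L, ‖Ψ p - gaussianMul om φ p‖ ^ 4)
        = g * ∫ p in cell3 L, ((1 + t) ^ 3 * ‖Ψ p‖ ^ 4
          + (1 + 1 / t) ^ 3 * ‖Ψ p - gaussianMul om φ p‖ ^ 4) := by
      rw [integral_add (iΨ4.const_mul _) (ib4.const_mul _), integral_const_mul, integral_const_mul]
      ring
    rw [← integral_gaussianMul_pow_four, e]
    refine mul_le_mul_of_nonneg_left ?_ hg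
    refine integral_mono_of_nonneg (Eventually.of_forall fun p => by
      simp only [Pi.zero_apply]; positivity) ((iΨ4.const_mul _).add (ib4.const_mul _))
      (Eventually.of_forall fun p => ?_)
    refine le_trans ?_ (add_pow_four_le ht)
    refine pow_le_pow_left₀ (norm_nonneg _) ?_ 4
    calc ‖gaussianMul om φ p‖ = ‖Ψ p - (Ψ p - gaussianMul om φ p)‖ := by congr 1; ring
      _ ≤ _ := norm_sub_le _ _
  have key := excess_lower_bound (X := (∫ p in cell3 L, transverseDensity om Om (Ψ p)
      (fderiv ℝ Ψ p (1, 0, 0)) (fderiv ℝ Ψ p (0, 1, 0)) p.1 p.2.1)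
        + 1 / 2 * (∫ p in cell3 L, ‖dz p‖ ^ 2)
        + (∫ p in cell3 L, latticePotential w ε p.2.2 * ‖Ψ p‖ ^ 2)
        + g * (∫ p in cell3 L, ‖Ψ p‖ ^ 4) - om)
    hom (sub_pos.2 hlt) hg hL (mA_nonneg (T := T) (N := N) (ε := ε) hw hgh)
    (h := 1 / 2 * D) (by positivity) hKb0
    (E := 1 / 2 * (∫ z in I, ‖proj om dz z‖ ^ 2) + ∫ z in I, latticePotential w ε z * ‖φ z‖ ^ 2)
    (by positivity) (G := g * ∫ p in cell3 L, ‖Ψ p‖ ^ 4)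
    (mul_nonneg hg (integral_nonneg fun p => by positivity)) ht ht1 hNb0
    (hgap.trans (le_of_eq (by ring))) hmE hB hA (by
      rw [hPz, hPW]
      linarith)
  linarith

/-! ### Convergence in `Lᵖ` of sequences of functions -/

/-- `f n` converges to `F` in `Lʳ(μ)`, for functions rather than classes. -/
structure LpTendsto {α : Type*} [MeasurableSpace α] (r : ℝ≥0∞) (μ : Measure α) (f : ℕ → α → ℂ)
    (F : α → ℂ) : Prop where
  memLp : ∀ n, MemLp (f n) r μ
  memLp_lim : MemLp F r μ
  tendsto : Tendsto (fun n => eLpNorm (fun x => f n x - F x) r μ) atTop (𝓝 0)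

section LpTendsto

variable {α : Type*} [MeasurableSpace α] {r : ℝ≥0∞} {μ : Measure α} {f g : ℕ → α → ℂ}
  {F G : α → ℂ}

theorem LpTendsto.of_le (h : LpTendsto r μ f F) (hr : 1 ≤ r) (hg : ∀ n, MemLp (g n) r μ)
    {e : ℕ → ℝ≥0∞} (he : Tendsto e atTop (𝓝 0))
    (hle : ∀ n, eLpNorm (fun x => g n x - f n x) r μ ≤ e n) : LpTendsto r μ g F := by
  refine ⟨hg, h.memLp_lim, ?_⟩
  have h0 : Tendsto (fun n => e n + eLpNorm (fun x => f n x - F x) r μ) atTop (𝓝 0) := by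
    simpa using he.add h.tendsto
  refine tendsto_of_tendsto_of_tendsto_of_le_of_le tendsto_const_nhds h0 (fun _ => zero_le)
    fun n => ?_
  calc eLpNorm (fun x => g n x - F x) r μ
      = eLpNorm ((fun x => g n x - f n x) + fun x => f n x - F x) r μ := by
        congr 1; funext x; simp
    _ ≤ _ := eLpNorm_add_le ((hg n).sub (h.memLp n)).1 ((h.memLp n).sub h.memLp_lim).1 hr
    _ ≤ _ := by gcongr; exact hle n

theorem LpTendsto.add (hr : 1 ≤ r) (hf : LpTendsto r μ f F) (hg : LpTendsto r μ g G) :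
    LpTendsto r μ (fun n x => f n x + g n x) (fun x => F x + G x) := by
  refine ⟨fun n => (hf.memLp n).add (hg.memLp n), hf.memLp_lim.add hg.memLp_lim, ?_⟩
  have h0 := hf.tendsto.add hg.tendsto
  rw [add_zero] at h0
  refine tendsto_of_tendsto_of_tendsto_of_le_of_le tendsto_const_nhds h0 (fun _ => zero_le)
    fun n => ?_
  calc eLpNorm (fun x => f n x + g n x - (F x + G x)) r μ
      = eLpNorm ((fun x => f n x - F x) + fun x => g n x - G x) r μ := by
        congr 1; funext x; simp only [Pi.add_apply]; ring
    _ ≤ _ := eLpNorm_add_le ((hf.memLp n).sub hf.memLp_lim).1 ((hg.memLp n).sub hg.memLp_lim).1 hr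

/-- Multiplication by a bounded function preserves convergence. -/
theorem LpTendsto.bdd_mul (hf : LpTendsto r μ f F) {a : α → ℂ} (ha : AEStronglyMeasurable a μ)
    {c : ℝ} (hc : ∀ᵐ x ∂μ, ‖a x‖ ≤ c) :
    LpTendsto r μ (fun n x => a x * f n x) (fun x => a x * F x) := by
  have hm : ∀ {u : α → ℂ}, MemLp u r μ → MemLp (fun x => a x * u x) r μ := by
    intro u hu
    refine hu.of_le_mul (c := c) (ha.mul hu.1) ?_
    filter_upwards [hc] with x hx
    rw [norm_mul]
    gcongr
  refine ⟨fun n => hm (hf.memLp n), hm hf.memLp_lim, ?_⟩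
  have h0 := ENNReal.Tendsto.const_mul hf.tendsto (Or.inr (ENNReal.ofReal_ne_top (r := c)))
  rw [mul_zero] at h0
  refine tendsto_of_tendsto_of_tendsto_of_le_of_le tendsto_const_nhds h0 (fun _ => zero_le)
    fun n => ?_
  refine eLpNorm_le_mul_eLpNorm_of_ae_le_mul ?_ r
  filter_upwards [hc] with x hx
  rw [← mul_sub, norm_mul]
  gcongr

theorem LpTendsto.const_mul (hf : LpTendsto r μ f F) (a : ℂ) :
    LpTendsto r μ (fun n x => a * f n x) (fun x => a * F x) :=
  hf.bdd_mul aestronglyMeasurable_const (Eventually.of_forall fun _ => le_rfl)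

/-- Multiplication by convergent sequences of scalars. -/
theorem LpTendsto.seq_smul (hr : 1 ≤ r) (hf : LpTendsto r μ f F) {c : ℕ → ℝ}
    (hc : Tendsto c atTop (𝓝 1)) : LpTendsto r μ (fun n x => c n • f n x) F := by
  refine ⟨fun n => (hf.memLp n).const_smul (c n), hf.memLp_lim, ?_⟩
  have h1 : Tendsto (fun n => ENNReal.ofReal ‖c n‖ * eLpNorm (fun x => f n x - F x) r μ) atTop
      (𝓝 0) := by
    have := ENNReal.Tendsto.mul (ENNReal.tendsto_ofReal hc.norm) (Or.inr (by simp)) hf.tendsto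
      (Or.inr (by simp))
    simpa using this
  have h2 : Tendsto (fun n => ENNReal.ofReal ‖c n - 1‖ * eLpNorm F r μ) atTop (𝓝 0) := by
    have h3 : Tendsto (fun n => ‖c n - 1‖) atTop (𝓝 0) := by
      simpa using (hc.sub_const 1).norm
    have := ENNReal.Tendsto.mul_const (ENNReal.tendsto_ofReal h3) (Or.inr hf.memLp_lim.2.ne)
    simpa using this
  have h0 := h1.add h2
  rw [add_zero] at h0
  refine tendsto_of_tendsto_of_tendsto_of_le_of_le tendsto_const_nhds h0 (fun _ => zero_le)
    fun n => ?_
  have m1 : MemLp (c n • fun x => f n x - F x) r μ :=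
    ((hf.memLp n).sub hf.memLp_lim).const_smul (c n)
  have m2 : MemLp ((c n - 1) • F) r μ := hf.memLp_lim.const_smul (c n - 1)
  calc eLpNorm (fun x => c n • f n x - F x) r μ
      = eLpNorm ((c n • fun x => f n x - F x) + (c n - 1) • F) r μ := by
        congr 1; funext x
        simp only [Pi.add_apply, Pi.smul_apply]
        module
    _ ≤ _ := eLpNorm_add_le m1.1 m2.1 hr
    _ = _ := by
        rw [eLpNorm_const_smul, eLpNorm_const_smul, ← ofReal_norm, ← ofReal_norm]

theorem LpTendsto.congr (hf : LpTendsto r μ f F) (h : ∀ n x, g n x = f n x)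
    (hF : ∀ x, G x = F x) : LpTendsto r μ g G := by
  obtain rfl : g = f := funext fun n => funext (h n)
  obtain rfl : G = F := funext hF
  exact hf

/-- Multiplication by uniformly small functions. -/
theorem LpTendsto.of_le_mul (hF : MemLp F r μ) {a : ℕ → α → ℝ}
    (ha : ∀ n, AEStronglyMeasurable (a n) μ)
    {c : ℕ → ℝ} (hc : Tendsto c atTop (𝓝 0)) (hle : ∀ n x, |a n x| ≤ c n) :
    LpTendsto r μ (fun n x => a n x • F x) (fun _ => 0) := by
  have hb : ∀ n, ∀ᵐ x ∂μ, ‖a n x • F x‖ ≤ c n * ‖F x‖ := fun n =>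
    Eventually.of_forall fun x => by
      rw [norm_smul, Real.norm_eq_abs]
      gcongr
      exact hle n x
  refine ⟨fun n => hF.of_le_mul ((ha n).smul hF.1) (hb n), MemLp.zero', ?_⟩
  have h0 : Tendsto (fun n => ENNReal.ofReal (c n) * eLpNorm F r μ) atTop (𝓝 0) := by
    have := ENNReal.Tendsto.mul_const (ENNReal.tendsto_ofReal hc) (Or.inr hF.2.ne)
    simpa using this
  refine tendsto_of_tendsto_of_tendsto_of_le_of_le tendsto_const_nhds h0 (fun _ => zero_le)
    fun n => ?_
  simp only [sub_zero]
  exact eLpNorm_le_mul_eLpNorm_of_ae_le_mul (hb n) r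

/-- Dominated convergence for multiplication by cutoffs. -/
theorem LpTendsto.of_cutoff (hF : MemLp F 2 μ) {a : ℕ → α → ℝ}
    (ha : ∀ n, AEStronglyMeasurable (a n) μ) (hle : ∀ n x, |a n x| ≤ 1)
    (hlim : ∀ x, Tendsto (fun n => a n x) atTop (𝓝 1)) :
    LpTendsto 2 μ (fun n x => a n x • F x) F := by
  refine ⟨fun n => ?_, hF, ?_⟩
  · refine hF.of_le ((ha n).smul hF.1) (Eventually.of_forall fun x => ?_)
    rw [norm_smul, Real.norm_eq_abs]
    exact mul_le_of_le_one_left (norm_nonneg _) (hle n x)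
  have hfin : ∫⁻ x, (2 * ‖F x‖ₑ) ^ 2 ∂μ ≠ ⊤ := by
    simp only [mul_pow]
    rw [lintegral_const_mul' _ _ (by simp), ← eLpNorm_two_sq]
    exact ENNReal.mul_ne_top (by simp) (ENNReal.pow_ne_top hF.2.ne)
  have h2 : Tendsto (fun n => ∫⁻ x, ‖a n x • F x - F x‖ₑ ^ 2 ∂μ) atTop (𝓝 (∫⁻ _, 0 ∂μ)) := by
    refine tendsto_lintegral_of_dominated_convergence' (fun x => (2 * ‖F x‖ₑ) ^ 2)
      (fun n => ((((ha n).smul hF.1).sub hF.1).enorm.pow_const 2)) (fun n => ?_) hfin ?_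
    · refine Eventually.of_forall fun x => ?_
      dsimp only
      gcongr
      calc ‖a n x • F x - F x‖ₑ ≤ ‖a n x • F x‖ₑ + ‖F x‖ₑ := enorm_sub_le
        _ ≤ ‖F x‖ₑ + ‖F x‖ₑ := by
            gcongr
            rw [← ofReal_norm, ← ofReal_norm]
            refine ENNReal.ofReal_le_ofReal ?_
            rw [norm_smul, Real.norm_eq_abs]
            exact mul_le_of_le_one_left (norm_nonneg _) (hle n x)
        _ = 2 * ‖F x‖ₑ := by ring
    · refine Eventually.of_forall fun x => ?_
      have h3 : Tendsto (fun n => a n x • F x - F x) atTop (𝓝 0) := by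
        simpa using ((hlim x).smul_const (F x)).sub_const (F x)
      have := ((ENNReal.continuous_pow 2).tendsto _).comp h3.enorm
      simpa [Function.comp_def] using this
  rw [lintegral_zero] at h2
  have h3 := ((ENNReal.continuous_rpow_const (y := 1 / 2)).tendsto 0).comp h2
  rw [ENNReal.zero_rpow_of_pos (by norm_num)] at h3
  refine h3.congr fun n => ?_
  simp only [Function.comp]
  rw [← eLpNorm_two_sq μ fun x => a n x • F x - F x, ← ENNReal.rpow_natCast, ← ENNReal.rpow_mul]
  norm_num

theorem integral_norm_pow_eq {k : ℕ} (hk : k ≠ 0) (hF : MemLp F k μ) :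
    ∫ x, ‖F x‖ ^ k ∂μ = (eLpNorm F k μ).toReal ^ k := by
  have h0 : (0 : ℝ) ≤ ∫ x, ‖F x‖ ^ k ∂μ := integral_nonneg fun x => by positivity
  have h1 := hF.eLpNorm_eq_integral_rpow_norm (by simpa using hk) (by simp)
  simp only [ENNReal.toReal_natCast, Real.rpow_natCast] at h1
  rw [h1, ENNReal.toReal_ofReal (by positivity), ← Real.rpow_natCast, ← Real.rpow_mul h0,
    inv_mul_cancel₀ (by exact_mod_cast hk), Real.rpow_one]

theorem LpTendsto.tendsto_integral_norm_pow {k : ℕ} (hk : k ≠ 0) (hf : LpTendsto k μ f F) :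
    Tendsto (fun n => ∫ x, ‖f n x‖ ^ k ∂μ) atTop (𝓝 (∫ x, ‖F x‖ ^ k ∂μ)) := by
  have : Fact ((1 : ℝ≥0∞) ≤ k) := ⟨by exact_mod_cast Nat.one_le_iff_ne_zero.2 hk⟩
  have h1 := (Lp.tendsto_Lp_iff_tendsto_eLpNorm'' f hf.memLp F hf.memLp_lim).2 hf.tendsto
  have h2 := (h1.norm.pow k)
  simp only [Lp.norm_toLp] at h2
  simpa only [integral_norm_pow_eq hk (hf.memLp _), integral_norm_pow_eq hk hf.memLp_lim] using h2

end LpTendsto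

/-! ### Periodicity and mollification on a cell -/

section Periodic

instance isAddHaarMeasure_volume_prod : (volume : Measure (ℝ × ℝ)).IsAddHaarMeasure :=
  inferInstanceAs ((volume : Measure ℝ).prod (volume : Measure ℝ)).IsAddHaarMeasure

instance isAddHaarMeasure_volume_prod_prod : (volume : Measure (ℝ × ℝ × ℝ)).IsAddHaarMeasure :=
  inferInstanceAs ((volume : Measure ℝ).prod (volume : Measure (ℝ × ℝ))).IsAddHaarMeasure

theorem HasWeakDeriv.ae_periodic {u v : ℝ × ℝ × ℝ → ℂ} {e a : ℝ × ℝ × ℝ}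
    (h : HasWeakDeriv u e v) (hu : (fun p => u (p + a)) =ᵐ[volume] u) :
    (fun p => v (p + a)) =ᵐ[volume] v :=
  ((h.comp_add_right a).congr hu (Eventually.of_forall fun _ => rfl)).ae_unique h

theorem mollify_add_of_ae_periodic (φ : ContDiffBump (0 : ℝ × ℝ × ℝ)) {u : ℝ × ℝ × ℝ → ℂ}
    {a : ℝ × ℝ × ℝ} (hu : (fun p => u (p + a)) =ᵐ[volume] u) (x : ℝ × ℝ × ℝ) :
    mollify φ u (x + a) = mollify φ u x := by
  rw [mollify_apply, mollify_apply]
  have h := (quasiMeasurePreserving_sub_left (volume : Measure (ℝ × ℝ × ℝ)) x).ae hu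
  refine integral_congr_ae ?_
  filter_upwards [h] with t ht
  rw [show x + a - t = x - t + a by abel, ht]

/-- A square integrable periodic function is square integrable on three consecutive cells. -/
theorem memLp_three_cells {L : ℝ} {u : ℝ × ℝ × ℝ → ℂ}
    (hm : AEStronglyMeasurable u volume)
    (hu : (fun p => u (p + (0, 0, L))) =ᵐ[volume] u)
    (h : MemLp u 2 (volume.restrict (cell3 L))) :
    MemLp u 2 (volume.restrict (cell3 (3 * L))) := by
  have hqmp : Measure.QuasiMeasurePreserving (fun p : ℝ × ℝ × ℝ => p.2.2) volume volume := by
    rw [Measure.volume_eq_prod, Measure.volume_eq_prod]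
    exact Measure.quasiMeasurePreserving_snd.comp Measure.quasiMeasurePreserving_snd
  have hae : {p : ℝ × ℝ × ℝ | p.2.2 ∈ Icc (-(L / 2)) (L / 2)} =ᵐ[volume] cell3 L :=
    hqmp.preimage_ae_eq Ioo_ae_eq_Icc.symm
  set S : ℝ → Set (ℝ × ℝ × ℝ) := fun s => {p | p.2.2 ∈ Icc (s - L / 2) (s + L / 2)} with hS
  have hS0 : S 0 = {p : ℝ × ℝ × ℝ | p.2.2 ∈ Icc (-(L / 2)) (L / 2)} := by
    simp only [hS, zero_sub, zero_add]
  set G : ℝ × ℝ × ℝ → ℝ := fun p => ‖u p‖ ^ 2 with hG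
  have hGu : (fun p => G (p + (0, 0, L))) =ᵐ[volume] G := by
    filter_upwards [hu] with p hp
    simp only [hG, hp]
  have i0 : IntegrableOn G (S 0) := by
    rw [hS0]
    have h1 : IntegrableOn G (cell3 L) := integrable_norm_sq h
    exact h1.congr_set_ae hae
  have hshift : ∀ s, IntegrableOn G (S s) ↔ IntegrableOn G (S (s - L)) := by
    intro s
    have h1 := ((measurePreserving_add_right (volume : Measure (ℝ × ℝ × ℝ))
      (0, 0, L)).integrableOn_comp_preimage (measurableEmbedding_addRight _) (f := G) (s := S s))
    rw [← h1]
    have h2 : (fun p : ℝ × ℝ × ℝ => p + (0, 0, L)) ⁻¹' (S s) = S (s - L) := by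
      ext p
      simp only [hS, mem_preimage, mem_ofPred_eq, mem_Icc, Prod.snd_add]
      constructor <;> rintro ⟨h3, h4⟩ <;> constructor <;> linarith
    rw [h2]
    exact integrable_congr (ae_restrict_of_ae hGu)
  have i1 : IntegrableOn G (S L) := (hshift L).2 (by rwa [sub_self])
  have i2 : IntegrableOn G (S (0 - L)) := (hshift 0).1 i0
  have hsub : cell3 (3 * L) ⊆ S (0 - L) ∪ S 0 ∪ S L := by
    rintro p ⟨h1, h2⟩
    simp only [hS, mem_union, mem_ofPred_eq, mem_Icc]
    rcases le_total p.2.2 (-(L / 2)) with h3 | h3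
    · left; left; constructor <;> linarith
    · rcases le_total p.2.2 (L / 2) with h4 | h4
      · left; right; constructor <;> linarith
      · right; constructor <;> linarith
  rw [memLp_two_iff_integrable_sq_norm hm.restrict]
  exact ((i2.union i0).union i1).mono_set hsub

/-- Mollifications of a periodic function converge in `L²` of a cell. -/
theorem exists_forall_eLpNorm_mollify_sub_cell3_le {L : ℝ} (hL : 0 < L) {u : ℝ × ℝ × ℝ → ℂ}
    (hl : LocallyIntegrable u) (hu : (fun p => u (p + (0, 0, L))) =ᵐ[volume] u)
    (h : MemLp u 2 (volume.restrict (cell3 L))) {η : ℝ≥0∞} (hη : 0 < η) :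
    ∃ r : ℝ, 0 < r ∧ ∀ φ : ContDiffBump (0 : ℝ × ℝ × ℝ), φ.rOut ≤ r →
      eLpNorm (fun p => mollify φ u p - u p) 2 (volume.restrict (cell3 L)) ≤ η := by
  have h3 := memLp_three_cells hl.aestronglyMeasurable hu h
  have hm3 := measurableSet_cell3 (3 * L)
  have hind : MemLp ((cell3 (3 * L)).indicator u) 2 volume :=
    (memLp_indicator_iff_restrict hm3).2 h3
  obtain ⟨r, hr, hb⟩ := exists_forall_eLpNorm_mollify_sub_le hind hη
  refine ⟨min r L, lt_min hr hL, fun φ hφ => le_trans ?_ (hb φ (hφ.trans (min_le_left _ _)))⟩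
  refine le_trans (le_of_eq ?_) (eLpNorm_mono_measure _ (Measure.restrict_le_self (s := cell3 L)))
  refine eLpNorm_congr_ae ?_
  filter_upwards [ae_restrict_mem (measurableSet_cell3 L)] with x hx
  rw [Pi.sub_apply]
  have hx3 : x ∈ cell3 (3 * L) := by
    obtain ⟨h1, h2⟩ := hx
    exact ⟨by linarith, by linarith⟩
  rw [indicator_of_mem hx3]
  congr 1
  rw [mollify_apply, mollify_apply]
  congr 1
  funext t
  by_cases ht : t ∈ Metric.ball (0 : ℝ × ℝ × ℝ) φ.rOut
  · have h1 : ‖t‖ < L := (mem_ball_zero_iff.1 ht).trans_le (hφ.trans (min_le_right _ _))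
    have h2 : |t.2.2| < L := ((norm_snd_le t.2).trans (norm_snd_le t)).trans_lt h1
    rw [abs_lt] at h2
    rw [indicator_of_mem]
    obtain ⟨h4, h5⟩ := hx
    constructor <;> simp only [Prod.snd_sub] <;> linarith [h2.1, h2.2]
  · have : φ.normed volume t = 0 := by
      rw [← φ.support_normed_eq (μ := volume)] at ht
      exact Function.notMem_support.1 ht
    simp [this]

theorem mollify_eq_zero_of_vanish {R : ℝ} {u : ℝ × ℝ × ℝ → ℂ}
    (h0 : ∀ p : ℝ × ℝ × ℝ, R < |p.1| ∨ R < |p.2.1| → u p = 0)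
    (φ : ContDiffBump (0 : ℝ × ℝ × ℝ)) (hφ : φ.rOut ≤ 1) (p : ℝ × ℝ × ℝ)
    (hp : R + 1 < |p.1| ∨ R + 1 < |p.2.1|) : mollify φ u p = 0 := by
  rw [mollify_apply]
  refine (integral_congr_ae (Eventually.of_forall fun t => ?_)).trans (integral_zero _ _)
  by_cases ht : t ∈ Metric.ball (0 : ℝ × ℝ × ℝ) φ.rOut
  · have h1 : ‖t‖ < 1 := (mem_ball_zero_iff.1 ht).trans_le hφ
    have h2 : |t.1| < 1 := (norm_fst_le t).trans_lt h1
    have h3 : |t.2.1| < 1 := ((norm_fst_le t.2).trans (norm_snd_le t)).trans_lt h1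
    rw [h0, smul_zero]
    refine hp.imp (fun h => ?_) (fun h => ?_)
    · have := abs_sub_abs_le_abs_sub p.1 t.1
      simp only [Prod.fst_sub]; linarith
    · have := abs_sub_abs_le_abs_sub p.2.1 t.2.1
      simp only [Prod.fst_sub, Prod.snd_sub]; linarith
  · have : φ.normed volume t = 0 := by
      rw [← φ.support_normed_eq (μ := volume)] at ht
      exact Function.notMem_support.1 ht
    simp [this]

end Periodic

/-! ### Density of smooth functions in the form domain -/

/-- Membership in the form domain with given weak derivatives; the weight is split into its two
components. -/
structure FormData (L : ℝ) (f fx fy fz : ℝ × ℝ × ℝ → ℂ) : Prop where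
  periodic : (fun p => f (p + (0, 0, L))) =ᵐ[volume] f
  deriv_x : HasWeakDeriv f (1, 0, 0) fx
  deriv_y : HasWeakDeriv f (0, 1, 0) fy
  deriv_z : HasWeakDeriv f (0, 0, 1) fz
  memLp : MemLp f 2 (volume.restrict (cell3 L))
  memLp_x : MemLp fx 2 (volume.restrict (cell3 L))
  memLp_y : MemLp fy 2 (volume.restrict (cell3 L))
  memLp_z : MemLp fz 2 (volume.restrict (cell3 L))
  memLp_wx : MemLp (fun p => p.1 • f p) 2 (volume.restrict (cell3 L))
  memLp_wy : MemLp (fun p => p.2.1 • f p) 2 (volume.restrict (cell3 L))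

/-- Convergence in the form domain: of the functions, their first derivatives and the weighted
functions in `L²` of a cell. -/
structure FormTendsto (L : ℝ) (f fx fy fz : ℕ → ℝ × ℝ × ℝ → ℂ) (F Fx Fy Fz : ℝ × ℝ × ℝ → ℂ) :
    Prop where
  self : LpTendsto 2 (volume.restrict (cell3 L)) f F
  x : LpTendsto 2 (volume.restrict (cell3 L)) fx Fx
  y : LpTendsto 2 (volume.restrict (cell3 L)) fy Fy
  z : LpTendsto 2 (volume.restrict (cell3 L)) fz Fz
  wx : LpTendsto 2 (volume.restrict (cell3 L)) (fun n p => p.1 • f n p) (fun p => p.1 • F p)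
  wy : LpTendsto 2 (volume.restrict (cell3 L)) (fun n p => p.2.1 • f n p) (fun p => p.2.1 • F p)

section Density

variable {L : ℝ} {f fx fy fz : ℝ × ℝ × ℝ → ℂ}

/-- Smooth approximation of a function of the form domain with bounded transverse support. -/
theorem FormData.exists_nice (hL : 0 < L) (h : FormData L f fx fy fz) {R : ℝ}
    (h0 : ∀ p : ℝ × ℝ × ℝ, R < |p.1| ∨ R < |p.2.1| → f p = 0) {η : ℝ≥0∞} (hη : 0 < η) :
    ∃ Φ : ℝ × ℝ × ℝ → ℂ, Nice L Φ ∧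
      eLpNorm (fun p => Φ p - f p) 2 (volume.restrict (cell3 L)) ≤ η ∧
      eLpNorm (fun p => fderiv ℝ Φ p (1, 0, 0) - fx p) 2 (volume.restrict (cell3 L)) ≤ η ∧
      eLpNorm (fun p => fderiv ℝ Φ p (0, 1, 0) - fy p) 2 (volume.restrict (cell3 L)) ≤ η ∧
      eLpNorm (fun p => fderiv ℝ Φ p (0, 0, 1) - fz p) 2 (volume.restrict (cell3 L)) ≤ η ∧
      eLpNorm (fun p => p.1 • Φ p - p.1 • f p) 2 (volume.restrict (cell3 L)) ≤ η ∧
      eLpNorm (fun p => p.2.1 • Φ p - p.2.1 • f p) 2 (volume.restrict (cell3 L)) ≤ η := by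
  set C : ℝ := |R| + 1 with hC
  have hC1 : 1 ≤ C := by have := abs_nonneg R; linarith
  have hη' : 0 < η / ENNReal.ofReal C := ENNReal.div_pos hη.ne' ENNReal.ofReal_ne_top
  obtain ⟨r0, hr0, b0⟩ := exists_forall_eLpNorm_mollify_sub_cell3_le hL h.deriv_x.1 h.periodic
    h.memLp hη'
  obtain ⟨r1, hr1, b1⟩ := exists_forall_eLpNorm_mollify_sub_cell3_le hL h.deriv_x.2.1
    (h.deriv_x.ae_periodic h.periodic) h.memLp_x hη
  obtain ⟨r2, hr2, b2⟩ := exists_forall_eLpNorm_mollify_sub_cell3_le hL h.deriv_y.2.1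
    (h.deriv_y.ae_periodic h.periodic) h.memLp_y hη
  obtain ⟨r3, hr3, b3⟩ := exists_forall_eLpNorm_mollify_sub_cell3_le hL h.deriv_z.2.1
    (h.deriv_z.ae_periodic h.periodic) h.memLp_z hη
  obtain ⟨r, hr, hr1', hr0', hr1'', hr2', hr3'⟩ : ∃ r : ℝ, 0 < r ∧ r ≤ 1 ∧ r ≤ r0 ∧ r ≤ r1 ∧
      r ≤ r2 ∧ r ≤ r3 :=
    ⟨min 1 (min r0 (min r1 (min r2 r3))), by positivity, by simp, by simp, by simp, by simp,
      by simp⟩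
  let φ : ContDiffBump (0 : ℝ × ℝ × ℝ) := ⟨r / 2, r, by positivity, by linarith⟩
  have hvan := mollify_eq_zero_of_vanish h0 φ hr1'
  have e0 := b0 φ hr0'
  have hw : ∀ a : ℝ × ℝ × ℝ → ℝ, (∀ p, C < |a p| → mollify φ f p = 0 ∧ f p = 0) →
      eLpNorm (fun p => a p • mollify φ f p - a p • f p) 2 (volume.restrict (cell3 L)) ≤ η := by
    intro a ha
    refine le_trans (eLpNorm_le_mul_eLpNorm_of_ae_le_mul (c := C)
      (g := fun p => mollify φ f p - f p) (Eventually.of_forall fun p => ?_) 2) ?_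
    · rw [← smul_sub, norm_smul, Real.norm_eq_abs]
      by_cases hp : C < |a p|
      · obtain ⟨h1, h2⟩ := ha p hp
        simp [h1, h2]
      · gcongr
        exact not_lt.1 hp
    · calc ENNReal.ofReal C * _ ≤ ENNReal.ofReal C * (η / ENNReal.ofReal C) := by gcongr
        _ ≤ η := ENNReal.mul_div_le
  have hRC : R + 1 ≤ C := by have := le_abs_self R; linarith
  refine ⟨mollify φ f, ⟨contDiff_mollify φ h.deriv_x.1, fun p => ?_, R + 1, hvan⟩, ?_, ?_, ?_, ?_,
    ?_, ?_⟩
  · rw [← mollify_add_of_ae_periodic φ h.periodic p]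
    congr 1
    ext <;> simp
  · refine e0.trans ?_
    rw [ENNReal.div_le_iff (by simp; linarith) ENNReal.ofReal_ne_top]
    exact le_mul_of_one_le_right zero_le (by simpa using hC1)
  · simp only [fderiv_mollify φ h.deriv_x]; exact b1 φ hr1''
  · simp only [fderiv_mollify φ h.deriv_y]; exact b2 φ hr2'
  · simp only [fderiv_mollify φ h.deriv_z]; exact b3 φ hr3'
  · exact hw (fun p => p.1) fun p hp => ⟨hvan p (Or.inl (hRC.trans_lt hp)),
      h0 p (Or.inl (by linarith))⟩
  · exact hw (fun p => p.2.1) fun p hp => ⟨hvan p (Or.inr (hRC.trans_lt hp)),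
      h0 p (Or.inr (by linarith))⟩

end Density

section Density

variable {L : ℝ} {f fx fy fz : ℝ × ℝ × ℝ → ℂ}

/-- The transverse dilation by the factor `1 / (n + 1)`, on which the cutoffs depend. -/
def cutoffMap (n : ℕ) : ℝ × ℝ × ℝ →L[ℝ] ℝ × ℝ :=
  (1 / ((n : ℝ) + 1)) • (ContinuousLinearMap.fst ℝ ℝ (ℝ × ℝ)).prod
    ((ContinuousLinearMap.fst ℝ ℝ ℝ).comp (ContinuousLinearMap.snd ℝ ℝ (ℝ × ℝ)))

theorem cutoffMap_apply (n : ℕ) (p : ℝ × ℝ × ℝ) :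
    cutoffMap n p = (1 / ((n : ℝ) + 1)) • (p.1, p.2.1) := rfl

/-- A smooth cutoff in the transverse variables, equal to `1` on the square of half side `n + 1`
and vanishing off the square of half side `2 (n + 1)`. -/
def cutoff (n : ℕ) (p : ℝ × ℝ × ℝ) : ℝ :=
  (⟨1, 2, one_pos, one_lt_two⟩ : ContDiffBump (0 : ℝ × ℝ)) (cutoffMap n p)

theorem contDiff_cutoff (n : ℕ) : ContDiff ℝ ∞ (cutoff n) :=
  (ContDiffBump.contDiff _).comp (cutoffMap n).contDiff

theorem abs_cutoff_le (n : ℕ) (p : ℝ × ℝ × ℝ) : |cutoff n p| ≤ 1 := by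
  unfold cutoff
  rw [abs_of_nonneg (ContDiffBump.nonneg _)]
  exact ContDiffBump.le_one _

theorem tendsto_cutoffMap (p : ℝ × ℝ × ℝ) : Tendsto (fun n => cutoffMap n p) atTop (𝓝 0) := by
  have h := (tendsto_one_div_add_atTop_nhds_zero_nat (𝕜 := ℝ)).smul_const (p.1, p.2.1)
  rw [zero_smul] at h
  exact h

theorem tendsto_cutoff (p : ℝ × ℝ × ℝ) : Tendsto (fun n => cutoff n p) atTop (𝓝 1) := by
  refine tendsto_const_nhds.congr' ?_
  filter_upwards [(tendsto_cutoffMap p).eventually (Metric.closedBall_mem_nhds 0 one_pos)]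
    with n hn
  exact (ContDiffBump.one_of_mem_closedBall _ hn).symm

theorem cutoff_eq_zero (n : ℕ) (p : ℝ × ℝ × ℝ)
    (hp : 2 * ((n : ℝ) + 1) < |p.1| ∨ 2 * ((n : ℝ) + 1) < |p.2.1|) :
    cutoff n p = 0 := by
  refine ContDiffBump.zero_of_le_dist _ ?_
  rw [dist_zero_right, cutoffMap_apply, norm_smul, Prod.norm_def,
    Real.norm_of_nonneg (by positivity), one_div, ← div_eq_inv_mul, le_div_iff₀ (by positivity)]
  rcases hp with h | h
  · exact h.le.trans (le_max_left _ _)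
  · exact h.le.trans (le_max_right _ _)

theorem exists_fderiv_cutoff_le (e : ℝ × ℝ × ℝ) :
    ∃ c : ℕ → ℝ, Tendsto c atTop (𝓝 0) ∧ ∀ n p, |fderiv ℝ (cutoff n) p e| ≤ c n := by
  let b : ContDiffBump (0 : ℝ × ℝ) := ⟨1, 2, one_pos, one_lt_two⟩
  have hb : ContDiff ℝ 1 b := b.contDiff
  obtain ⟨B, hB⟩ := (b.hasCompactSupport.fderiv ℝ).exists_bound_of_continuous
    (hb.continuous_fderiv (by simp))
  refine ⟨fun n => B * ‖cutoffMap n e‖, ?_, fun n p => ?_⟩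
  · simpa using ((tendsto_cutoffMap e).norm.const_mul B)
  · have h1 : HasFDerivAt (cutoff n) ((fderiv ℝ b (cutoffMap n p)).comp (cutoffMap n)) p :=
      (hb.differentiable (by simp) _).hasFDerivAt.comp p (cutoffMap n).hasFDerivAt
    rw [h1.fderiv, ← Real.norm_eq_abs]
    exact ((fderiv ℝ b (cutoffMap n p)).le_opNorm _).trans
      (mul_le_mul_of_nonneg_right (hB _) (norm_nonneg _))

theorem memLp_continuous_smul_of_bound {a : ℝ × ℝ × ℝ → ℝ} (ha : Continuous a) {c : ℝ}
    (hc : ∀ p, |a p| ≤ c) {μ : Measure (ℝ × ℝ × ℝ)} (hf : MemLp f 2 μ) :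
    MemLp (fun p => a p • f p) 2 μ :=
  hf.of_le_mul (c := c) (ha.aestronglyMeasurable.smul hf.1) (Eventually.of_forall fun p => by
    rw [norm_smul, Real.norm_eq_abs]; gcongr; exact hc p)

theorem cutoff_add_period (n : ℕ) (p : ℝ × ℝ × ℝ) : cutoff n (p + (0, 0, L)) = cutoff n p := by
  simp [cutoff, cutoffMap_apply]

theorem FormData.cutoff_smul (h : FormData L f fx fy fz) (n : ℕ) :
    FormData L (fun p => cutoff n p • f p)
      (fun p => cutoff n p • fx p + fderiv ℝ (cutoff n) p (1, 0, 0) • f p)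
      (fun p => cutoff n p • fy p + fderiv ℝ (cutoff n) p (0, 1, 0) • f p)
      (fun p => cutoff n p • fz p + fderiv ℝ (cutoff n) p (0, 0, 1) • f p) := by
  have hc := (contDiff_cutoff n).continuous
  have m0 : ∀ {u : ℝ × ℝ × ℝ → ℂ}, MemLp u 2 (volume.restrict (cell3 L)) →
      MemLp (fun p => cutoff n p • u p) 2 (volume.restrict (cell3 L)) := fun hu =>
    memLp_continuous_smul_of_bound hc (abs_cutoff_le n) hu
  have m1 : ∀ e : ℝ × ℝ × ℝ,
      MemLp (fun p => fderiv ℝ (cutoff n) p e • f p) 2 (volume.restrict (cell3 L)) := by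
    intro e
    obtain ⟨c, -, hle⟩ := exists_fderiv_cutoff_le e
    exact memLp_continuous_smul_of_bound
      (((contDiff_cutoff n).continuous_fderiv (by simp)).clm_apply continuous_const) (hle n) h.memLp
  refine ⟨?_, h.deriv_x.smul_contDiff (contDiff_cutoff n),
    h.deriv_y.smul_contDiff (contDiff_cutoff n),
    h.deriv_z.smul_contDiff (contDiff_cutoff n), m0 h.memLp, (m0 h.memLp_x).add (m1 _),
    (m0 h.memLp_y).add (m1 _), (m0 h.memLp_z).add (m1 _), ?_, ?_⟩
  · filter_upwards [h.periodic] with p hp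
    rw [hp, cutoff_add_period]
  · exact (m0 h.memLp_wx).ae_eq (Eventually.of_forall fun p => smul_comm _ _ _)
  · exact (m0 h.memLp_wy).ae_eq (Eventually.of_forall fun p => smul_comm _ _ _)

theorem FormData.formTendsto_cutoff (h : FormData L f fx fy fz) :
    FormTendsto L (fun n p => cutoff n p • f p)
      (fun n p => cutoff n p • fx p + fderiv ℝ (cutoff n) p (1, 0, 0) • f p)
      (fun n p => cutoff n p • fy p + fderiv ℝ (cutoff n) p (0, 1, 0) • f p)
      (fun n p => cutoff n p • fz p + fderiv ℝ (cutoff n) p (0, 0, 1) • f p) f fx fy fz := by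
  have t0 : ∀ {u : ℝ × ℝ × ℝ → ℂ}, MemLp u 2 (volume.restrict (cell3 L)) →
      LpTendsto 2 (volume.restrict (cell3 L)) (fun n p => cutoff n p • u p) u := fun hu =>
    LpTendsto.of_cutoff hu (fun n => (contDiff_cutoff n).continuous.aestronglyMeasurable)
      abs_cutoff_le tendsto_cutoff
  have t1 : ∀ e : ℝ × ℝ × ℝ, LpTendsto 2 (volume.restrict (cell3 L))
      (fun n p => fderiv ℝ (cutoff n) p e • f p) (fun _ => 0) := by
    intro e
    obtain ⟨c, hc, hle⟩ := exists_fderiv_cutoff_le e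
    exact LpTendsto.of_le_mul h.memLp (fun n => (((contDiff_cutoff n).continuous_fderiv
      (by simp)).clm_apply continuous_const).aestronglyMeasurable) hc hle
  have t2 : ∀ {u : ℝ × ℝ × ℝ → ℂ}, MemLp u 2 (volume.restrict (cell3 L)) → ∀ e : ℝ × ℝ × ℝ,
      LpTendsto 2 (volume.restrict (cell3 L))
        (fun n p => cutoff n p • u p + fderiv ℝ (cutoff n) p e • f p) u := fun hu e =>
    ((t0 hu).add (by norm_num) (t1 e)).congr (fun _ _ => rfl) fun p => (add_zero _).symm
  exact ⟨t0 h.memLp, t2 h.memLp_x _, t2 h.memLp_y _, t2 h.memLp_z _,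
    (t0 h.memLp_wx).congr (fun n p => smul_comm _ _ _) fun _ => rfl,
    (t0 h.memLp_wy).congr (fun n p => smul_comm _ _ _) fun _ => rfl⟩

/-- Smooth functions with bounded transverse support are dense in the form domain. -/
theorem FormData.exists_formTendsto (hL : 0 < L) (h : FormData L f fx fy fz) :
    ∃ Φ : ℕ → ℝ × ℝ × ℝ → ℂ, (∀ n, Nice L (Φ n)) ∧
      FormTendsto L Φ (fun n p => fderiv ℝ (Φ n) p (1, 0, 0))
        (fun n p => fderiv ℝ (Φ n) p (0, 1, 0)) (fun n p => fderiv ℝ (Φ n) p (0, 0, 1))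
        f fx fy fz := by
  have hη : ∀ n : ℕ, (0 : ℝ≥0∞) < (n : ℝ≥0∞)⁻¹ := fun n => by simp
  have h1 := fun n => (h.cutoff_smul n).exists_nice hL (R := 2 * ((n : ℝ) + 1))
    (fun p hp => by rw [cutoff_eq_zero n p hp, zero_smul]) (hη n)
  choose Φ hΦ e0 ex ey ez ewx ewy using h1
  have ht := h.formTendsto_cutoff
  have hr : (1 : ℝ≥0∞) ≤ 2 := by norm_num
  have hlim := ENNReal.tendsto_inv_nat_nhds_zero
  exact ⟨Φ, hΦ, ht.self.of_le hr (fun n => (hΦ n).regular.memLp) hlim e0,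
    ht.x.of_le hr (fun n => (hΦ n).regular.memLp_x) hlim ex,
    ht.y.of_le hr (fun n => (hΦ n).regular.memLp_y) hlim ey,
    ht.z.of_le hr (fun n => (hΦ n).regular.memLp_z) hlim ez,
    ht.wx.of_le hr (fun n => (hΦ n).regular.memLp_wx) hlim ewx,
    ht.wy.of_le hr (fun n => (hΦ n).regular.memLp_wy) hlim ewy⟩

end Density

/-! ### Convergence of the energy -/

section FormEnergy

variable {L : ℝ} {f fx fy fz : ℕ → ℝ × ℝ × ℝ → ℂ} {F Fx Fy Fz : ℝ × ℝ × ℝ → ℂ}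

theorem memLp_four_of_integrable {α : Type*} [MeasurableSpace α] {μ : Measure α} {u : α → ℂ}
    (hu : AEStronglyMeasurable u μ) (h : Integrable (fun x => ‖u x‖ ^ 4) μ) : MemLp u 4 μ := by
  refine (integrable_norm_rpow_iff hu (by norm_num) (by norm_num)).1 ?_
  simpa using h

theorem MemLp.integrable_pow_four {α : Type*} [MeasurableSpace α] {μ : Measure α} {u : α → ℂ}
    (h : MemLp u 4 μ) : Integrable (fun x => ‖u x‖ ^ 4) μ := by
  simpa using h.integrable_norm_rpow (by norm_num) (by norm_num)

theorem integral_norm_sub_sq_le {α : Type*} [MeasurableSpace α] {μ : Measure α} {u v U : α → ℂ}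
    (hu : MemLp u 2 μ) (hv : MemLp v 2 μ) (hU : MemLp U 2 μ) :
    ∫ x, ‖u x - v x‖ ^ 2 ∂μ ≤ 2 * (∫ x, ‖u x - U x‖ ^ 2 ∂μ) + 2 * ∫ x, ‖v x - U x‖ ^ 2 ∂μ := by
  have i1 := integrable_norm_sq (hu.sub hU)
  have i2 := integrable_norm_sq (hv.sub hU)
  simp only [Pi.sub_apply] at i1 i2
  rw [← integral_const_mul, ← integral_const_mul, ← integral_add (i1.const_mul 2) (i2.const_mul 2)]
  refine integral_mono (integrable_norm_sq (hu.sub hv)) ((i1.const_mul 2).add (i2.const_mul 2))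
    fun x => ?_
  have h1 : ‖u x - v x‖ ≤ ‖u x - U x‖ + ‖v x - U x‖ := by
    rw [show u x - v x = (u x - U x) - (v x - U x) by ring]
    exact norm_sub_le _ _
  change ‖u x - v x‖ ^ 2 ≤ 2 * ‖u x - U x‖ ^ 2 + 2 * ‖v x - U x‖ ^ 2
  nlinarith [norm_nonneg (u x - v x), sq_nonneg (‖u x - U x‖ - ‖v x - U x‖),
    mul_self_le_mul_self (norm_nonneg (u x - v x)) h1]

theorem LpTendsto.tendsto_integral_sub_sq {α : Type*} [MeasurableSpace α] {μ : Measure α}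
    {u : ℕ → α → ℂ} {U : α → ℂ} (h : LpTendsto 2 μ u U) :
    Tendsto (fun n => ∫ x, ‖u n x - U x‖ ^ 2 ∂μ) atTop (𝓝 0) := by
  have h1 := ((ENNReal.tendsto_toReal (by simp)).comp h.tendsto).pow 2
  simp only [ENNReal.toReal_zero, ne_eq, OfNat.ofNat_ne_zero, not_false_eq_true, zero_pow] at h1
  refine h1.congr fun n => ?_
  exact (integral_norm_pow_eq (k := 2) (by norm_num) ((h.memLp n).sub h.memLp_lim)).symm

/-- The inequality `Regular.pow_four` for differences upgrades convergence in the form domain to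
convergence in `L⁴`. -/
theorem FormTendsto.pow_four (hL : 0 < L) (h : FormTendsto L f fx fy fz F Fx Fy Fz)
    (hreg : ∀ n, Regular L (f n) (fx n) (fy n) (fz n)) :
    LpTendsto 4 (volume.restrict (cell3 L)) f F := by
  set μ := (volume : Measure (ℝ × ℝ × ℝ)).restrict (cell3 L) with hμ
  set D : ℕ → ℝ := fun n => (∫ p, ‖f n p - F p‖ ^ 2 ∂μ) + (∫ p, ‖fx n p - Fx p‖ ^ 2 ∂μ)
    + (∫ p, ‖fy n p - Fy p‖ ^ 2 ∂μ) + ∫ p, ‖fz n p - Fz p‖ ^ 2 ∂μ with hD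
  have hD0 : Tendsto D atTop (𝓝 0) := by
    simpa using ((h.self.tendsto_integral_sub_sq.add h.x.tendsto_integral_sub_sq).add
      h.y.tendsto_integral_sub_sq).add h.z.tendsto_integral_sub_sq
  have hpos : ∀ u : ℝ × ℝ × ℝ → ℂ, 0 ≤ ∫ p, ‖u p‖ ^ 2 ∂μ := fun u =>
    integral_nonneg fun p => by positivity
  have hle : ∀ n m, ∫ p, ‖f n p - f m p‖ ^ 4 ∂μ ≤ 16 * (1 / L + 2) * (D n + D m) ^ 2 := by
    intro n m
    have h4 := (((hreg n).sub (hreg m)).pow_four hL one_pos).2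
    have a0 := integral_norm_sub_sq_le (hreg n).memLp (hreg m).memLp h.self.memLp_lim
    have ax := integral_norm_sub_sq_le (hreg n).memLp_x (hreg m).memLp_x h.x.memLp_lim
    have ay := integral_norm_sub_sq_le (hreg n).memLp_y (hreg m).memLp_y h.y.memLp_lim
    have az := integral_norm_sub_sq_le (hreg n).memLp_z (hreg m).memLp_z h.z.memLp_lim
    have p1 := fun n => hpos fun p => f n p - F p
    have p2 := fun n => hpos fun p => fx n p - Fx p
    have p3 := fun n => hpos fun p => fy n p - Fy p
    have p4 := fun n => hpos fun p => fz n p - Fz p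
    have q1 := hpos fun p => f n p - f m p
    have q2 := hpos fun p => fx n p - fx m p
    have q3 := hpos fun p => fy n p - fy m p
    have q4 := hpos fun p => fz n p - fz m p
    have s0 : 0 ≤ D n + D m := by
      simp only [hD]
      have := p1 n; have := p2 n; have := p3 n; have := p4 n
      have := p1 m; have := p2 m; have := p3 m; have := p4 m
      positivity
    have b0 : ∫ p, ‖f n p - f m p‖ ^ 2 ∂μ ≤ 2 * (D n + D m) := by
      simp only [hD]
      linarith [p1 n, p2 n, p3 n, p4 n, p1 m, p2 m, p3 m, p4 m]
    have bz : ∫ p, ‖fz n p - fz m p‖ ^ 2 ∂μ ≤ 2 * (D n + D m) := by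
      simp only [hD]
      linarith [p1 n, p2 n, p3 n, p4 n, p1 m, p2 m, p3 m, p4 m]
    have bxy : (∫ p, ‖fx n p - fx m p‖ ^ 2 ∂μ) + ∫ p, ‖fy n p - fy m p‖ ^ 2 ∂μ
        ≤ 2 * (D n + D m) := by
      simp only [hD]
      linarith [p1 n, p2 n, p3 n, p4 n, p1 m, p2 m, p3 m, p4 m]
    refine h4.trans ?_
    calc _ ≤ 4 * ((1 / L + 1) * (2 * (D n + D m)) + 1 / 1 * (2 * (D n + D m)))
          * (2 * (D n + D m)) := by gcongr
      _ = _ := by ring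
  have hmem : ∀ n, MemLp (f n) 4 μ := fun n =>
    memLp_four_of_integrable (hreg n).memLp.1 ((hreg n).pow_four hL one_pos).1
  have hG : Tendsto (fun q : ℕ × ℕ =>
      ENNReal.ofReal ((16 * (1 / L + 2) * (D q.1 + D q.2) ^ 2) ^ (4⁻¹ : ℝ))) atTop (𝓝 0) := by
    rw [← prod_atTop_atTop_eq]
    have h1 : Tendsto (fun q : ℕ × ℕ => D q.1 + D q.2) (atTop ×ˢ atTop) (𝓝 (0 + 0)) :=
      (hD0.comp tendsto_fst).add (hD0.comp tendsto_snd)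
    have h2 := ((h1.pow 2).const_mul (16 * (1 / L + 2))).rpow_const (p := 4⁻¹)
      (Or.inr (by norm_num))
    have h3 := ENNReal.tendsto_ofReal h2
    simpa using h3
  -- the sequence is a Cauchy sequence in `L⁴`
  have hcauchy : ∀ δ : ℝ≥0∞, 0 < δ → ∃ n₀, ∀ n m, n₀ ≤ n → n₀ ≤ m →
      eLpNorm (fun p => f n p - f m p) 4 μ ≤ δ := by
    intro δ hδ
    obtain ⟨n₀, hn₀⟩ := eventually_atTop_prod_self.1 (hG.eventually (ge_mem_nhds hδ))
    refine ⟨n₀, fun n m hn hm => le_trans ?_ (hn₀ n m hn hm)⟩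
    have hsub : MemLp (fun p => f n p - f m p) 4 μ := (hmem n).sub (hmem m)
    rw [hsub.eLpNorm_eq_integral_rpow_norm (by norm_num) (by norm_num)]
    simp only [ENNReal.toReal_ofNat, Real.rpow_ofNat]
    gcongr
    exact hle n m
  obtain ⟨ns, hns, hae⟩ := (tendstoInMeasure_of_tendsto_eLpNorm (p := 2) (by norm_num)
    (fun n => (hreg n).memLp.1) h.self.memLp_lim.1 h.self.tendsto).exists_seq_tendsto_ae
  have hfatou : ∀ δ : ℝ≥0∞, 0 < δ → ∃ n₀, ∀ n, n₀ ≤ n →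
      eLpNorm (fun p => f n p - F p) 4 μ ≤ δ := by
    intro δ hδ
    obtain ⟨n₀, hn₀⟩ := hcauchy δ hδ
    refine ⟨n₀, fun n hn => ?_⟩
    refine Lp.eLpNorm_le_of_ae_tendsto (u := atTop) (f := fun k p => f n p - f (ns k) p) ?_
      (fun k => ((hmem n).sub (hmem _)).1) ?_
    · filter_upwards [hns.tendsto_atTop.eventually_ge_atTop n₀] with k hk
      exact hn₀ n (ns k) hn hk
    · filter_upwards [hae] with p hp
      exact hp.const_sub _
  refine ⟨hmem, ?_, ENNReal.tendsto_atTop_zero.2 hfatou⟩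
  obtain ⟨n₀, hn₀⟩ := hfatou 1 one_pos
  have h1 : MemLp (fun p => f n₀ p - F p) 4 μ :=
    ⟨(hreg n₀).memLp.1.sub h.self.memLp_lim.1, (hn₀ n₀ le_rfl).trans_lt ENNReal.one_lt_top⟩
  have h2 : MemLp (fun p => f n₀ p - (f n₀ p - F p)) 4 μ := (hmem n₀).sub h1
  simpa using h2

theorem FormData.memLp_four {f fx fy fz : ℝ × ℝ × ℝ → ℂ} (hL : 0 < L)
    (h : FormData L f fx fy fz) : MemLp f 4 (volume.restrict (cell3 L)) := by
  obtain ⟨Φ, hΦ, ht⟩ := h.exists_formTendsto hL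
  exact (ht.pow_four hL fun n => (hΦ n).regular).memLp_lim

/-- The energy of a function of the form domain in terms of its weak derivatives. -/
def formEnergy (w : ℝ → ℝ) (L ε om Om g : ℝ) (f fx fy fz : ℝ × ℝ × ℝ → ℂ) : ℝ :=
  (∫ p in cell3 L, transverseDensity om Om (f p) (fx p) (fy p) p.1 p.2.1)
    + 1 / 2 * (∫ p in cell3 L, ‖fz p‖ ^ 2)
    + (∫ p in cell3 L, latticePotential w ε p.2.2 * ‖f p‖ ^ 2)
    + g * ∫ p in cell3 L, ‖f p‖ ^ 4

section Magnetic

variable {u ux uy : ℝ × ℝ × ℝ → ℂ} {μ : Measure (ℝ × ℝ × ℝ)}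

theorem memLp_magnetic_x (hx : MemLp ux 2 μ) (hw : MemLp (fun p => p.2.1 • u p) 2 μ) (Om : ℝ) :
    MemLp (fun p => ux p - Complex.I * (Om * (-p.2.1) : ℝ) * u p) 2 μ := by
  refine (hx.add (hw.const_mul (Complex.I * Om))).ae_eq (Eventually.of_forall fun p => ?_)
  simp only [Pi.add_apply, Complex.real_smul]
  push_cast
  ring

theorem memLp_magnetic_y (hy : MemLp uy 2 μ) (hw : MemLp (fun p => p.1 • u p) 2 μ) (Om : ℝ) :
    MemLp (fun p => uy p - Complex.I * (Om * p.1 : ℝ) * u p) 2 μ := by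
  refine (hy.add (hw.const_mul (-(Complex.I * Om)))).ae_eq (Eventually.of_forall fun p => ?_)
  simp only [Pi.add_apply, Complex.real_smul]
  push_cast
  ring

theorem transverseDensity_eq (om Om : ℝ) (a b c : ℂ) (x y : ℝ) :
    transverseDensity om Om a b c x y
      = 1 / 2 * (‖b - Complex.I * (Om * (-y) : ℝ) * a‖ ^ 2 + ‖c - Complex.I * (Om * x : ℝ) * a‖ ^ 2)
        + 1 / 2 * (om ^ 2 - Om ^ 2) * (‖x • a‖ ^ 2 + ‖y • a‖ ^ 2) := by
  simp only [transverseDensity, norm_smul, mul_pow, Real.norm_eq_abs, sq_abs]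
  ring

theorem integrable_transverseDensity (om Om : ℝ) (hx : MemLp ux 2 μ) (hy : MemLp uy 2 μ)
    (hwx : MemLp (fun p => p.1 • u p) 2 μ) (hwy : MemLp (fun p => p.2.1 • u p) 2 μ) :
    Integrable (fun p => transverseDensity om Om (u p) (ux p) (uy p) p.1 p.2.1) μ := by
  simp only [transverseDensity_eq]
  exact (((integrable_norm_sq (memLp_magnetic_x hx hwy Om)).add
    (integrable_norm_sq (memLp_magnetic_y hy hwx Om))).const_mul _).add
    (((integrable_norm_sq hwx).add (integrable_norm_sq hwy)).const_mul _)

theorem integral_transverseDensity (om Om : ℝ) (hx : MemLp ux 2 μ) (hy : MemLp uy 2 μ)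
    (hwx : MemLp (fun p => p.1 • u p) 2 μ) (hwy : MemLp (fun p => p.2.1 • u p) 2 μ) :
    ∫ p, transverseDensity om Om (u p) (ux p) (uy p) p.1 p.2.1 ∂μ
      = 1 / 2 * ((∫ p, ‖ux p - Complex.I * (Om * (-p.2.1) : ℝ) * u p‖ ^ 2 ∂μ)
          + ∫ p, ‖uy p - Complex.I * (Om * p.1 : ℝ) * u p‖ ^ 2 ∂μ)
        + 1 / 2 * (om ^ 2 - Om ^ 2) * ((∫ p, ‖p.1 • u p‖ ^ 2 ∂μ) + ∫ p, ‖p.2.1 • u p‖ ^ 2 ∂μ) := by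
  have i1 := integrable_norm_sq (memLp_magnetic_x hx hwy Om)
  have i2 := integrable_norm_sq (memLp_magnetic_y hy hwx Om)
  have i3 := integrable_norm_sq hwx
  have i4 := integrable_norm_sq hwy
  simp only [transverseDensity_eq]
  rw [integral_add (by exact (i1.add i2).const_mul _) (by exact (i3.add i4).const_mul _),
    integral_const_mul, integral_const_mul, integral_add i1 i2, integral_add i3 i4]

end Magnetic

/-- The integral defining the energy splits into its parts, since functions of the form domain
are in `L⁴`. -/
theorem FormData.energy3_eq {w : ℝ → ℝ} (hw : Continuous w) {ε om Om g : ℝ} (hL : 0 < L)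
    {f fx fy fz : ℝ × ℝ × ℝ → ℂ} (h : FormData L f fx fy fz) :
    energy3 w L ε om Om g f = formEnergy w L ε om Om g f fx fy fz := by
  have i4 := (MemLp.integrable_pow_four (h.memLp_four hL)).const_mul g
  have iT := integrable_transverseDensity om Om h.memLp_x h.memLp_y h.memLp_wx h.memLp_wy
  have iz := (integrable_norm_sq h.memLp_z).const_mul (1 / 2)
  have iW := integrable_weight_mul (continuous_latticePotential hw ε) (integrable_norm_sq h.memLp)
  rw [formEnergy, ← integral_const_mul, ← integral_const_mul, ← integral_add iT iz,
    ← integral_add (by exact iT.add iz) iW,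
    ← integral_add (by exact (iT.add iz).add iW) i4, energy3]
  refine integral_congr_ae ?_
  filter_upwards [ae_restrict_of_ae h.deriv_x.weakDeriv_ae_eq,
    ae_restrict_of_ae h.deriv_y.weakDeriv_ae_eq, ae_restrict_of_ae h.deriv_z.weakDeriv_ae_eq]
    with p hx hy hz
  rw [magneticKinetic, hx, hy, hz, transverseDensity]
  ring

theorem LpTendsto.tendsto_integral_sq {α : Type*} [MeasurableSpace α] {μ : Measure α}
    {u : ℕ → α → ℂ} {U : α → ℂ} (h : LpTendsto 2 μ u U) :
    Tendsto (fun n => ∫ x, ‖u n x‖ ^ 2 ∂μ) atTop (𝓝 (∫ x, ‖U x‖ ^ 2 ∂μ)) :=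
  LpTendsto.tendsto_integral_norm_pow (k := 2) (by norm_num) h

/-- The energy is continuous along sequences converging in the form domain and in `L⁴`. -/
theorem FormTendsto.tendsto_formEnergy {w : ℝ → ℝ} (hwc : Continuous w) (hw : ∀ z, 0 ≤ w z)
    {ε om Om g : ℝ} (h : FormTendsto L f fx fy fz F Fx Fy Fz)
    (h4 : LpTendsto 4 (volume.restrict (cell3 L)) f F) :
    Tendsto (fun n => formEnergy w L ε om Om g (f n) (fx n) (fy n) (fz n)) atTop
      (𝓝 (formEnergy w L ε om Om g F Fx Fy Fz)) := by
  set μ := (volume : Measure (ℝ × ℝ × ℝ)).restrict (cell3 L) with hμ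
  have hWc := continuous_latticePotential hwc ε
  have tx : LpTendsto 2 μ (fun n p => fx n p - Complex.I * (Om * (-p.2.1) : ℝ) * f n p)
      (fun p => Fx p - Complex.I * (Om * (-p.2.1) : ℝ) * F p) :=
    (h.x.add (by norm_num) (h.wy.const_mul (Complex.I * Om))).congr
      (fun n p => by simp only [Complex.real_smul]; push_cast; ring)
      (fun p => by simp only [Complex.real_smul]; push_cast; ring)
  have ty : LpTendsto 2 μ (fun n p => fy n p - Complex.I * (Om * p.1 : ℝ) * f n p)
      (fun p => Fy p - Complex.I * (Om * p.1 : ℝ) * F p) :=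
    (h.y.add (by norm_num) (h.wx.const_mul (-(Complex.I * Om)))).congr
      (fun n p => by simp only [Complex.real_smul]; push_cast; ring)
      (fun p => by simp only [Complex.real_smul]; push_cast; ring)
  have tW : Tendsto (fun n => ∫ p, latticePotential w ε p.2.2 * ‖f n p‖ ^ 2 ∂μ) atTop
      (𝓝 (∫ p, latticePotential w ε p.2.2 * ‖F p‖ ^ 2 ∂μ)) := by
    have hsc : Continuous fun z => √(latticePotential w ε z) := hWc.sqrt
    obtain ⟨M, hM⟩ := (isCompact_Icc (a := -(L / 2)) (b := L / 2)).exists_bound_of_continuousOn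
      hsc.continuousOn
    have t1 := (h.self.bdd_mul (a := fun p => (√(latticePotential w ε p.2.2) : ℂ)) (c := M)
      (by fun_prop : Continuous fun p : ℝ × ℝ × ℝ =>
        (√(latticePotential w ε p.2.2) : ℂ)).aestronglyMeasurable (by
        filter_upwards [ae_restrict_mem (measurableSet_cell3 L)] with p hp
        rw [Complex.norm_real]
        exact hM _ (Ioo_subset_Icc_self hp))).tendsto_integral_sq
    have e : ∀ (u : ℂ) (z : ℝ), ‖(√(latticePotential w ε z) : ℂ) * u‖ ^ 2
        = latticePotential w ε z * ‖u‖ ^ 2 := by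
      intro u z
      rw [norm_mul, mul_pow, Complex.norm_real, Real.norm_eq_abs, sq_abs,
        Real.sq_sqrt (latticePotential_nonneg hw ε z)]
    simpa only [e] using t1
  have tT : Tendsto (fun n => ∫ p, transverseDensity om Om (f n p) (fx n p) (fy n p) p.1 p.2.1 ∂μ)
      atTop (𝓝 (∫ p, transverseDensity om Om (F p) (Fx p) (Fy p) p.1 p.2.1 ∂μ)) := by
    rw [integral_transverseDensity om Om h.x.memLp_lim h.y.memLp_lim h.wx.memLp_lim h.wy.memLp_lim]
    refine Tendsto.congr (fun n => (integral_transverseDensity om Om (h.x.memLp n) (h.y.memLp n)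
      (h.wx.memLp n) (h.wy.memLp n)).symm) ?_
    exact ((tx.tendsto_integral_sq.add ty.tendsto_integral_sq).const_mul _).add
      ((h.wx.tendsto_integral_sq.add h.wy.tendsto_integral_sq).const_mul _)
  exact ((tT.add (h.z.tendsto_integral_sq.const_mul _)).add tW).add
    ((LpTendsto.tendsto_integral_norm_pow (k := 4) (by norm_num) h4).const_mul g)

theorem FormTendsto.seq_smul (h : FormTendsto L f fx fy fz F Fx Fy Fz) {c : ℕ → ℝ}
    (hc : Tendsto c atTop (𝓝 1)) :
    FormTendsto L (fun n p => c n • f n p) (fun n p => c n • fx n p) (fun n p => c n • fy n p)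
      (fun n p => c n • fz n p) F Fx Fy Fz := by
  have hr : (1 : ℝ≥0∞) ≤ 2 := by norm_num
  exact ⟨h.self.seq_smul hr hc, h.x.seq_smul hr hc, h.y.seq_smul hr hc, h.z.seq_smul hr hc,
    (h.wx.seq_smul hr hc).congr (fun n p => smul_comm _ _ _) fun _ => rfl,
    (h.wy.seq_smul hr hc).congr (fun n p => smul_comm _ _ _) fun _ => rfl⟩

theorem Nice.smul {Φ : ℝ × ℝ × ℝ → ℂ} (h : Nice L Φ) (c : ℝ) : Nice L (fun p => c • Φ p) := by
  obtain ⟨R, hR⟩ := h.vanish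
  exact ⟨h.smooth.const_smul c, fun p => by rw [h.periodic], R, fun p hp => by
    rw [hR p hp, smul_zero]⟩

/-- A lower bound for the energy of normalized smooth functions extends to the form domain. -/
theorem FormData.le_formEnergy {w : ℝ → ℝ} (hwc : Continuous w) (hw : ∀ z, 0 ≤ w z)
    {ε om Om g : ℝ} (hL : 0 < L) {B : ℝ}
    (hB : ∀ Φ : ℝ × ℝ × ℝ → ℂ, Nice L Φ → ∫ p in cell3 L, ‖Φ p‖ ^ 2 = 1 →
      B ≤ formEnergy w L ε om Om g Φ (fun p => fderiv ℝ Φ p (1, 0, 0))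
        (fun p => fderiv ℝ Φ p (0, 1, 0)) (fun p => fderiv ℝ Φ p (0, 0, 1)))
    {f fx fy fz : ℝ × ℝ × ℝ → ℂ} (h : FormData L f fx fy fz)
    (h1 : ∫ p in cell3 L, ‖f p‖ ^ 2 = 1) :
    B ≤ formEnergy w L ε om Om g f fx fy fz := by
  obtain ⟨Φ, hΦ, ht⟩ := h.exists_formTendsto hL
  have hn := ht.self.tendsto_integral_sq
  rw [h1] at hn
  set s : ℕ → ℝ := fun n => ∫ p in cell3 L, ‖Φ n p‖ ^ 2 with hs
  set c : ℕ → ℝ := fun n => (√(s n))⁻¹ with hc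
  have hc1 : Tendsto c atTop (𝓝 1) := by
    simpa using (hn.sqrt).inv₀ (by simp)
  have hd : ∀ n p (e : ℝ × ℝ × ℝ),
      fderiv ℝ (fun p => c n • Φ n p) p e = c n • fderiv ℝ (Φ n) p e := by
    intro n p e
    rw [fderiv_fun_const_smul ((hΦ n).smooth.differentiable (by simp) p)]
    rfl
  have ht' := ht.seq_smul hc1
  have hreg : ∀ n, Regular L (fun p => c n • Φ n p) (fun p => c n • fderiv ℝ (Φ n) p (1, 0, 0))
      (fun p => c n • fderiv ℝ (Φ n) p (0, 1, 0)) (fun p => c n • fderiv ℝ (Φ n) p (0, 0, 1)) := by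
    intro n
    simpa only [hd] using ((hΦ n).smul (c n)).regular
  refine ge_of_tendsto (ht'.tendsto_formEnergy hwc hw (ht'.pow_four hL hreg)) ?_
  filter_upwards [hn.eventually (lt_mem_nhds one_pos)] with n hpos
  have h2 := hB _ ((hΦ n).smul (c n)) (by
    simp only [norm_smul, mul_pow]
    rw [integral_const_mul, Real.norm_eq_abs, sq_abs, hc, inv_pow, Real.sq_sqrt hpos.le]
    exact inv_mul_cancel₀ hpos.ne')
  simpa only [hd] using h2

theorem MemFormDomain3.exists_formData {Ψ : ℝ × ℝ × ℝ → ℂ} (h : MemFormDomain3 L Ψ) :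
    ∃ vx vy vz, FormData L Ψ vx vy vz := by
  obtain ⟨vx, hx, lx⟩ := h.deriv_x
  obtain ⟨vy, hy, ly⟩ := h.deriv_y
  obtain ⟨vz, hz, lz⟩ := h.deriv_z
  have hw : ∀ a : ℝ × ℝ × ℝ → ℝ, Continuous a → (∀ p, |a p| ≤ √(p.1 ^ 2 + p.2.1 ^ 2)) →
      MemLp (fun p => a p • Ψ p) 2 (volume.restrict (cell3 L)) := by
    intro a ha hle
    refine h.weighted.of_le (ha.aestronglyMeasurable.smul h.memLp.1)
      (Eventually.of_forall fun p => ?_)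
    rw [norm_smul, norm_mul, Complex.norm_real, Real.norm_of_nonneg (Real.sqrt_nonneg _)]
    gcongr
    exact hle p
  refine ⟨vx, vy, vz, ?_, hx, hy, hz, h.memLp, lx, ly, lz, hw _ (by fun_prop) fun p => ?_,
    hw _ (by fun_prop) fun p => ?_⟩
  · filter_upwards [h.periodic] with p hp
    rw [← hp]
    congr 1
    ext <;> simp
  · exact Real.abs_le_sqrt (by nlinarith [sq_nonneg p.2.1])
  · exact Real.abs_le_sqrt (by nlinarith [sq_nonneg p.1])

end FormEnergy

/-! ### Weak derivatives of functions of one variable on a product -/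

section ProductDerivatives

variable {F : Type*} [NormedAddCommGroup F] [NormedSpace ℝ F] [MeasureSpace F] [BorelSpace F]
  [FiniteDimensional ℝ F] [SecondCountableTopology F] [(volume : Measure F).IsAddHaarMeasure]

theorem locallyIntegrable_comp_snd {u : F → ℂ} (hu : LocallyIntegrable u) :
    LocallyIntegrable fun p : ℝ × F => u p.2 := by
  rw [locallyIntegrable_iff]
  intro K hK
  have h1 : IsCompact (Prod.fst '' K) := hK.image continuous_fst
  have h2 : IsCompact (Prod.snd '' K) := hK.image continuous_snd
  have hsub : K ⊆ (Prod.fst '' K) ×ˢ (Prod.snd '' K) := fun p hp =>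
    ⟨mem_image_of_mem _ hp, mem_image_of_mem _ hp⟩
  refine IntegrableOn.mono_set ?_ hsub
  have hfin : IsFiniteMeasure (volume.restrict (Prod.fst '' K)) := ⟨by
    rw [Measure.restrict_apply_univ]; exact h1.measure_lt_top⟩
  have h3 := Integrable.comp_snd (hu.integrableOn_isCompact h2) (volume.restrict (Prod.fst '' K))
  rwa [Measure.prod_restrict] at h3

/-- Functions of the second variable inherit weak derivatives. -/
theorem HasWeakDeriv.comp_snd {u v : F → ℂ} {e : F} (h : HasWeakDeriv u e v) :
    HasWeakDeriv (fun p : ℝ × F => u p.2) (0, e) (fun p => v p.2) := by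
  have hu := locallyIntegrable_comp_snd h.1
  have hv := locallyIntegrable_comp_snd h.2.1
  refine ⟨hu, hv, fun χ hχ hc => ?_⟩
  have hχ' : Continuous fun p => fderiv ℝ χ p (0, e) :=
    (hχ.continuous_fderiv (by simp)).clm_apply continuous_const
  have i1 : Integrable fun p : ℝ × F => (fderiv ℝ χ p (0, e)) • u p.2 :=
    hu.integrable_smul_left_of_hasCompactSupport hχ' (hc.fderiv_apply (𝕜 := ℝ) _)
  have i2 : Integrable fun p : ℝ × F => χ p • v p.2 :=
    hv.integrable_smul_left_of_hasCompactSupport hχ.continuous hc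
  rw [Measure.volume_eq_prod] at i1 i2 ⊢
  rw [integral_prod _ i1, integral_prod _ i2, ← integral_neg]
  congr 1
  funext x
  have hx : ContDiff ℝ ∞ fun q => χ (x, q) := by fun_prop
  have hd : ∀ q, fderiv ℝ (fun q => χ (x, q)) q e = fderiv ℝ χ (x, q) (0, e) := by
    intro q
    have h1 : HasFDerivAt (fun q : F => (x, q))
        ((0 : F →L[ℝ] ℝ).prod (ContinuousLinearMap.id ℝ F)) q :=
      (hasFDerivAt_const x q).prodMk (hasFDerivAt_id q)
    have h2 : HasFDerivAt (fun q => χ (x, q)) _ q :=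
      (hχ.differentiable (by simp) (x, q)).hasFDerivAt.comp q h1
    rw [h2.fderiv]
    rfl
  have hcx : HasCompactSupport fun q => χ (x, q) :=
    HasCompactSupport.intro (hc.isCompact.image continuous_snd) fun q hq =>
      image_eq_zero_of_notMem_tsupport fun hmem => hq ⟨(x, q), hmem, rfl⟩
  have := h.2.2 _ hx hcx
  simpa only [hd] using this

/-- Functions of the second variable have vanishing derivative along the first one. -/
theorem hasWeakDeriv_comp_snd_zero {u : F → ℂ} (h : LocallyIntegrable u) :
    HasWeakDeriv (fun p : ℝ × F => u p.2) (1, 0) (fun _ => 0) := by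
  have hu := locallyIntegrable_comp_snd h
  refine ⟨hu, locallyIntegrable_zero, fun χ hχ hc => ?_⟩
  have hχ' : Continuous fun p => fderiv ℝ χ p (1, 0) :=
    (hχ.continuous_fderiv (by simp)).clm_apply continuous_const
  have i1 : Integrable fun p : ℝ × F => (fderiv ℝ χ p (1, 0)) • u p.2 :=
    hu.integrable_smul_left_of_hasCompactSupport hχ' (hc.fderiv_apply (𝕜 := ℝ) _)
  simp only [smul_zero, integral_zero, neg_zero]
  rw [Measure.volume_eq_prod] at i1 ⊢
  rw [integral_prod_symm _ i1]
  refine (integral_congr_ae (Eventually.of_forall fun q => ?_)).trans (integral_zero _ _)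
  have hsupp : ∀ {a : ℝ × F → ℝ}, HasCompactSupport a → HasCompactSupport fun x => a (x, q) :=
    fun ha => HasCompactSupport.intro (ha.isCompact.image continuous_fst) fun x hx =>
      image_eq_zero_of_notMem_tsupport fun hmem => hx ⟨(x, q), hmem, rfl⟩
  have hd : ∀ x, HasDerivAt (fun x => χ (x, q)) (fderiv ℝ χ (x, q) (1, 0)) x := fun x =>
    (hχ.differentiable (by simp) (x, q)).hasFDerivAt.comp_hasDerivAt x
      ((hasDerivAt_id x).prodMk (hasDerivAt_const x q))
  have hcd := hsupp (hc.fderiv_apply (𝕜 := ℝ) (1, 0))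
  have h0 : ∫ x, fderiv ℝ χ (x, q) (1, 0) = 0 :=
    integral_eq_zero_of_hasDerivAt_of_integrable hd
      ((by fun_prop : Continuous fun x => fderiv ℝ χ (x, q) (1, 0)).integrable_of_hasCompactSupport
        hcd)
      ((by have := hχ.continuous; fun_prop :
        Continuous fun x => χ (x, q)).integrable_of_hasCompactSupport
        (hsupp hc))
  dsimp only
  rw [integral_smul_const, h0, zero_smul]

end ProductDerivatives

/-! ### Trial functions for the upper bound -/

section Trial

variable {L om : ℝ} {φ v : ℝ → ℂ}

theorem contDiff_psiPerp (om : ℝ) : ContDiff ℝ ∞ (psiPerp om) := by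
  unfold psiPerp; fun_prop

theorem fderiv_psiPerp_comp (om : ℝ) (p e : ℝ × ℝ × ℝ) :
    fderiv ℝ (fun p : ℝ × ℝ × ℝ => psiPerp om (p.1, p.2.1)) p e
      = -(om * (p.1 * e.1 + p.2.1 * e.2.1)) * psiPerp om (p.1, p.2.1) := by
  have hx : HasFDerivAt (fun p : ℝ × ℝ × ℝ => p.1) (ContinuousLinearMap.fst ℝ ℝ (ℝ × ℝ)) p :=
    hasFDerivAt_fst
  have hy : HasFDerivAt (fun p : ℝ × ℝ × ℝ => p.2.1)
      ((ContinuousLinearMap.fst ℝ ℝ ℝ).comp (ContinuousLinearMap.snd ℝ ℝ (ℝ × ℝ))) p :=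
    hasFDerivAt_fst.comp p hasFDerivAt_snd
  have h := ((((hx.pow 2).add (hy.pow 2)).const_mul (-(om / 2))).exp).const_mul √(om / Real.pi)
  have h' : HasFDerivAt (fun p : ℝ × ℝ × ℝ => psiPerp om (p.1, p.2.1)) _ p := h
  rw [h'.fderiv]
  simp [psiPerp]
  ring

theorem MemH1Per.formData_gaussianMul (hom : 0 < om) (h : MemH1Per L φ) (hv : HasWeakDeriv φ 1 v)
    (hvL : MemLp v 2 (volume.restrict (Ioo (-(L / 2)) (L / 2)))) :
    FormData L (gaussianMul om φ) (fun p => -(om * p.1) • gaussianMul om φ p)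
      (fun p => -(om * p.2.1) • gaussianMul om φ p) (gaussianMul om v) := by
  have hsm : ContDiff ℝ ∞ fun p : ℝ × ℝ × ℝ => psiPerp om (p.1, p.2.1) :=
    (contDiff_psiPerp om).comp (by fun_prop)
  have hz : HasWeakDeriv (fun p : ℝ × ℝ × ℝ => φ p.2.2) (0, 0, 1) (fun p => v p.2.2) :=
    hv.comp_snd.comp_snd
  have hy : HasWeakDeriv (fun p : ℝ × ℝ × ℝ => φ p.2.2) (0, 1, 0) (fun _ => 0) :=
    (hasWeakDeriv_comp_snd_zero hv.1).comp_snd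
  have hx : HasWeakDeriv (fun p : ℝ × ℝ × ℝ => φ p.2.2) (1, 0, 0) (fun _ => 0) :=
    hasWeakDeriv_comp_snd_zero (locallyIntegrable_comp_snd hv.1)
  have hqmp : Measure.QuasiMeasurePreserving (fun p : ℝ × ℝ × ℝ => p.2.2) volume volume := by
    rw [Measure.volume_eq_prod, Measure.volume_eq_prod]
    exact Measure.quasiMeasurePreserving_snd.comp Measure.quasiMeasurePreserving_snd
  have wx : MemLp (fun p => (-om) • (p.1 • gaussianMul om φ p)) 2 (volume.restrict (cell3 L)) :=
    (memLp_gaussianMul_wx hom h.memLp).const_smul (-om)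
  have wy : MemLp (fun p => (-om) • (p.2.1 • gaussianMul om φ p)) 2 (volume.restrict (cell3 L)) :=
    (memLp_gaussianMul_wy hom h.memLp).const_smul (-om)
  refine ⟨?_, (hx.smul_contDiff hsm).congr (Eventually.of_forall fun _ => rfl)
      (Eventually.of_forall fun p => ?_), (hy.smul_contDiff hsm).congr
      (Eventually.of_forall fun _ => rfl) (Eventually.of_forall fun p => ?_),
    (hz.smul_contDiff hsm).congr (Eventually.of_forall fun _ => rfl)
      (Eventually.of_forall fun p => ?_), memLp_gaussianMul hom h.memLp, ?_, ?_,
    memLp_gaussianMul hom hvL, memLp_gaussianMul_wx hom h.memLp, memLp_gaussianMul_wy hom h.memLp⟩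
  · filter_upwards [hqmp.ae h.periodic] with p hp
    simp [gaussianMul, hp]
  · simp [fderiv_psiPerp_comp, gaussianMul, mul_assoc]
  · simp [fderiv_psiPerp_comp, gaussianMul, mul_assoc]
  · simp [fderiv_psiPerp_comp, gaussianMul]
  · simpa only [smul_smul, neg_mul] using wx
  · simpa only [smul_smul, neg_mul] using wy

theorem FormData.memFormDomain3 {f fx fy fz : ℝ × ℝ × ℝ → ℂ} (h : FormData L f fx fy fz) :
    MemFormDomain3 L f := by
  refine ⟨?_, h.memLp, ⟨fx, h.deriv_x, h.memLp_x⟩, ⟨fy, h.deriv_y, h.memLp_y⟩,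
    ⟨fz, h.deriv_z, h.memLp_z⟩, ?_⟩
  · filter_upwards [h.periodic] with p hp
    rw [← hp]
    congr 1
    ext <;> simp
  · refine (h.memLp_wx.norm.add h.memLp_wy.norm).of_le
      ((by fun_prop : Continuous fun p : ℝ × ℝ × ℝ =>
        (√(p.1 ^ 2 + p.2.1 ^ 2) : ℂ)).aestronglyMeasurable.mul h.memLp.1)
      (Eventually.of_forall fun p => ?_)
    have h1 : √(p.1 ^ 2 + p.2.1 ^ 2) ≤ |p.1| + |p.2.1| := by
      rw [Real.sqrt_le_left (by positivity)]
      nlinarith [sq_abs p.1, sq_abs p.2.1, mul_nonneg (abs_nonneg p.1) (abs_nonneg p.2.1)]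
    rw [norm_mul, Complex.norm_real, Real.norm_of_nonneg (Real.sqrt_nonneg _), Pi.add_apply,
      norm_smul, norm_smul, ← add_mul, Real.norm_of_nonneg (by positivity)]
    gcongr
    exact h1

/-- Functions in `H¹` of the circle are in `L⁴`; this is read off from the product with a
Gaussian. -/
theorem MemH1Per.integrable_pow_four (hL : 0 < L) (h : MemH1Per L φ) :
    Integrable (fun z => ‖φ z‖ ^ 4) (volume.restrict (Ioo (-(L / 2)) (L / 2))) := by
  obtain ⟨v, hv, hvL⟩ := h.deriv
  have h4 := MemLp.integrable_pow_four
    ((h.formData_gaussianMul one_pos hv hvL).memLp_four hL)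
  rw [restrict_cell3] at h4
  obtain ⟨x, hx⟩ := h4.prod_right_ae.exists
  obtain ⟨y, hy⟩ := hx.prod_right_ae.exists
  have hpos : 0 < psiOne 1 x * psiOne 1 y := mul_pos (psiOne_pos one_pos x) (psiOne_pos one_pos y)
  have hpos4 : (psiOne 1 x * psiOne 1 y) ^ 4 ≠ 0 := (pow_pos hpos 4).ne'
  refine (hy.const_mul ((psiOne 1 x * psiOne 1 y) ^ 4)⁻¹).congr (Eventually.of_forall fun z => ?_)
  simp only [gaussianMul_eq, norm_smul, mul_pow _ ‖φ z‖, Real.norm_of_nonneg hpos.le]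
  exact inv_mul_cancel_left₀ hpos4 _

theorem integral_gaussianMul_sq (hom : 0 < om) (W : ℝ → ℝ) (φ : ℝ → ℂ) :
    ∫ p in cell3 L, W p.2.2 * ‖gaussianMul om φ p‖ ^ 2
      = ∫ z in Ioo (-(L / 2)) (L / 2), W z * ‖φ z‖ ^ 2 := by
  have h := integral_tensor L (fun x => psiOne om x ^ 2) (fun y => psiOne om y ^ 2)
    fun z => W z * ‖φ z‖ ^ 2
  rw [integral_psiOne_sq hom, one_mul, one_mul] at h
  rw [← h]
  refine integral_congr_ae (Eventually.of_forall fun p => ?_)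
  simp only [gaussianMul_eq, norm_smul, norm_mul, mul_pow, Real.norm_eq_abs, sq_abs]
  ring

theorem integral_gaussianMul_wx_sq (hom : 0 < om) (φ : ℝ → ℂ) :
    om * ∫ p in cell3 L, ‖p.1 • gaussianMul om φ p‖ ^ 2
      = 1 / 2 * ∫ z in Ioo (-(L / 2)) (L / 2), ‖φ z‖ ^ 2 := by
  have h := integral_tensor L (fun x => (x * psiOne om x) ^ 2) (fun y => psiOne om y ^ 2)
    fun z => ‖φ z‖ ^ 2
  rw [integral_psiOne_sq hom, mul_one] at h
  rw [← integral_sq_mul_psiOne_sq hom, mul_assoc, ← h]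
  congr 1
  refine integral_congr_ae (Eventually.of_forall fun p => ?_)
  simp only [gaussianMul_eq, norm_smul, norm_mul, mul_pow, Real.norm_eq_abs, sq_abs]
  ring

theorem integral_gaussianMul_wy_sq (hom : 0 < om) (φ : ℝ → ℂ) :
    om * ∫ p in cell3 L, ‖p.2.1 • gaussianMul om φ p‖ ^ 2
      = 1 / 2 * ∫ z in Ioo (-(L / 2)) (L / 2), ‖φ z‖ ^ 2 := by
  have h := integral_tensor L (fun x => psiOne om x ^ 2) (fun y => (y * psiOne om y) ^ 2)
    fun z => ‖φ z‖ ^ 2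
  rw [integral_psiOne_sq hom, one_mul] at h
  rw [← integral_sq_mul_psiOne_sq hom, mul_assoc, ← h]
  congr 1
  refine integral_congr_ae (Eventually.of_forall fun p => ?_)
  simp only [gaussianMul_eq, norm_smul, norm_mul, mul_pow, Real.norm_eq_abs, sq_abs]
  ring

theorem transverseDensity_gaussian (om Om : ℝ) (u : ℂ) (x y : ℝ) :
    transverseDensity om Om u (-(om * x) • u) (-(om * y) • u) x y
      = om ^ 2 * (‖x • u‖ ^ 2 + ‖y • u‖ ^ 2) := by
  have key : ∀ a b : ℝ, ‖-a • u - Complex.I * (b : ℝ) * u‖ ^ 2 = (a ^ 2 + b ^ 2) * ‖u‖ ^ 2 := by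
    intro a b
    rw [show -a • u - Complex.I * (b : ℝ) * u = (-(a : ℂ) - Complex.I * b) * u by
      rw [Complex.real_smul]; push_cast; ring, norm_mul, mul_pow, Complex.sq_norm,
      Complex.normSq_apply]
    congr 1
    simp
    ring
  rw [transverseDensity_eq, key, key]
  simp only [norm_smul, mul_pow, Real.norm_eq_abs, sq_abs]
  ring

/-- The energy of a trial function is the sum of the energies of its factors. -/
theorem formEnergy_gaussianMul (w : ℝ → ℝ) (ε Om g : ℝ) (hom : 0 < om)
    (h : MemLp φ 2 (volume.restrict (Ioo (-(L / 2)) (L / 2)))) :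
    formEnergy w L ε om Om g (gaussianMul om φ) (fun p => -(om * p.1) • gaussianMul om φ p)
      (fun p => -(om * p.2.1) • gaussianMul om φ p) (gaussianMul om v)
      = om * (∫ z in Ioo (-(L / 2)) (L / 2), ‖φ z‖ ^ 2)
        + 1 / 2 * (∫ z in Ioo (-(L / 2)) (L / 2), ‖v z‖ ^ 2)
        + (∫ z in Ioo (-(L / 2)) (L / 2), latticePotential w ε z * ‖φ z‖ ^ 2)
        + gHat g om * ∫ z in Ioo (-(L / 2)) (L / 2), ‖φ z‖ ^ 4 := by
  have hvv := integral_gaussianMul_sq (L := L) hom (fun _ => 1) v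
  simp only [one_mul] at hvv
  rw [formEnergy, integral_gaussianMul_pow_four, integral_gaussianMul_sq hom, hvv]
  simp only [transverseDensity_gaussian]
  rw [integral_const_mul, integral_add (integrable_norm_sq (memLp_gaussianMul_wx hom h))
    (integrable_norm_sq (memLp_gaussianMul_wy hom h))]
  have hx := integral_gaussianMul_wx_sq (L := L) hom φ
  have hy := integral_gaussianMul_wy_sq (L := L) hom φ
  have e : om ^ 2 * ((∫ p in cell3 L, ‖p.1 • gaussianMul om φ p‖ ^ 2)
      + ∫ p in cell3 L, ‖p.2.1 • gaussianMul om φ p‖ ^ 2)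
      = om * (om * (∫ p in cell3 L, ‖p.1 • gaussianMul om φ p‖ ^ 2)
        + om * ∫ p in cell3 L, ‖p.2.1 • gaussianMul om φ p‖ ^ 2) := by ring
  rw [e, hx, hy]
  ring

end Trial

/-! ### Bounds for the ground state energy -/

section GroundState

variable {w : ℝ → ℝ} {T : ℝ} {N : ℕ} {ε om Om g : ℝ}

theorem exists_normalized_memH1Per (hL : 0 < N * T) :
    ∃ φ : ℝ → ℂ, MemH1Per (N * T) φ ∧ ∫ z in Ioo (-(N * T / 2)) (N * T / 2), ‖φ z‖ ^ 2 = 1 := by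
  set L : ℝ := N * T with hLdef
  set a : ℂ := (((√L)⁻¹ : ℝ) : ℂ) with ha
  have hd := HasWeakDeriv.of_contDiff (contDiff_const (c := a) : ContDiff ℝ 1 fun _ : ℝ => a) 1
  refine ⟨fun _ => a, ⟨Eventually.of_forall fun _ => rfl, memLp_Ioo_of_continuous continuous_const,
    ⟨_, hd, ?_⟩⟩, ?_⟩
  · simp only [fderiv_fun_const, Pi.zero_apply, zero_apply]
    exact memLp_Ioo_of_continuous continuous_const
  · rw [setIntegral_const, ha, Complex.norm_real, Real.norm_eq_abs, sq_abs, inv_pow,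
      Real.sq_sqrt hL.le, Real.volume_real_Ioo_of_le (by linarith), smul_eq_mul]
    field_simp
    ring

/-- The product of the transverse ground state with a normalized profile is admissible and has
energy `om + energyA φ`. -/
theorem MemH1Per.energy3_gaussianMul (hw : Continuous w) (hL : 0 < N * T) (hom : 0 < om)
    {φ : ℝ → ℂ} (h : MemH1Per (N * T) φ)
    (h1 : ∫ z in Ioo (-(N * T / 2)) (N * T / 2), ‖φ z‖ ^ 2 = 1) :
    (MemFormDomain3 (N * T) (gaussianMul om φ)
      ∧ ∫ p in cell3 (N * T), ‖gaussianMul om φ p‖ ^ 2 = 1)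
    ∧ energy3 w (N * T) ε om Om g (gaussianMul om φ) = om + energyA w (N * T) ε (gHat g om) φ := by
  obtain ⟨v, hv, hvL⟩ := h.deriv
  have hF := h.formData_gaussianMul hom hv hvL
  refine ⟨⟨hF.memFormDomain3, ?_⟩, ?_⟩
  · have := integral_gaussianMul_sq (L := N * T) hom (fun _ => 1) φ
    simp only [one_mul] at this
    rw [this, h1]
  · rw [hF.energy3_eq hw hL, formEnergy_gaussianMul w ε Om g hom h.memLp, h1,
      energyA_eq hw hv h.memLp hvL (h.integrable_pow_four hL)]
    ring

/-- A lower bound for the energy of normalized smooth functions bounds the ground state energy. -/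
theorem le_groundEnergy3 (hwc : Continuous w) (hw : ∀ z, 0 ≤ w z) (hL : 0 < N * T) (hom : 0 < om)
    {B : ℝ}
    (hB : ∀ Φ : ℝ × ℝ × ℝ → ℂ, Nice (N * T) Φ → ∫ p in cell3 (N * T), ‖Φ p‖ ^ 2 = 1 →
      B ≤ formEnergy w (N * T) ε om Om g Φ (fun p => fderiv ℝ Φ p (1, 0, 0))
        (fun p => fderiv ℝ Φ p (0, 1, 0)) (fun p => fderiv ℝ Φ p (0, 0, 1))) :
    (∀ Ψ, MemFormDomain3 (N * T) Ψ → ∫ p in cell3 (N * T), ‖Ψ p‖ ^ 2 = 1 →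
      B ≤ energy3 w (N * T) ε om Om g Ψ) ∧ B ≤ groundEnergy3 w T N ε om Om g := by
  have h : ∀ Ψ, MemFormDomain3 (N * T) Ψ → ∫ p in cell3 (N * T), ‖Ψ p‖ ^ 2 = 1 →
      B ≤ energy3 w (N * T) ε om Om g Ψ := by
    intro Ψ hΨ h1
    obtain ⟨vx, vy, vz, hF⟩ := hΨ.exists_formData
    rw [hF.energy3_eq hwc hL]
    exact hF.le_formEnergy hwc hw hL hB h1
  refine ⟨h, ?_⟩
  obtain ⟨φ, hφ, h1⟩ := exists_normalized_memH1Per hL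
  have hne := (hφ.energy3_gaussianMul (w := w) (ε := ε) (Om := Om) (g := g) hwc hL hom h1).1
  refine le_csInf ⟨_, _, hne, rfl⟩ ?_
  rintro _ ⟨Ψ, ⟨hΨ, h2⟩, rfl⟩
  exact h Ψ hΨ h2

/-- The trivial bound, from which the energy is seen to be bounded below. -/
theorem Nice.om_le_formEnergy (hw : ∀ z, 0 ≤ w z) (hOm : 0 ≤ Om) (hlt : Om < om)
    (hg : 0 ≤ g) {L : ℝ} {Φ : ℝ × ℝ × ℝ → ℂ} (h : Nice L Φ)
    (h1 : ∫ p in cell3 L, ‖Φ p‖ ^ 2 = 1) :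
    om ≤ formEnergy w L ε om Om g Φ (fun p => fderiv ℝ Φ p (1, 0, 0))
        (fun p => fderiv ℝ Φ p (0, 1, 0)) (fun p => fderiv ℝ Φ p (0, 0, 1)) := by
  have hom : 0 < om := hOm.trans_lt hlt
  have hT := h.transverse_lower_bound hom hOm
  rw [h1, mul_one] at hT
  have a1 : 0 ≤ (om - Om) / om * (1 / 2 * ∫ p in cell3 L,
      (‖fderiv ℝ Φ p (1, 0, 0) + (om * p.1) • Φ p‖ ^ 2
        + ‖fderiv ℝ Φ p (0, 1, 0) + (om * p.2.1) • Φ p‖ ^ 2)) := by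
    have : 0 ≤ om - Om := by linarith
    have : 0 ≤ ∫ p in cell3 L, (‖fderiv ℝ Φ p (1, 0, 0) + (om * p.1) • Φ p‖ ^ 2
        + ‖fderiv ℝ Φ p (0, 1, 0) + (om * p.2.1) • Φ p‖ ^ 2) :=
      integral_nonneg fun p => by positivity
    positivity
  have a2 : 0 ≤ ∫ p in cell3 L, ‖fderiv ℝ Φ p (0, 0, 1)‖ ^ 2 :=
    integral_nonneg fun p => by positivity
  have a3 : 0 ≤ ∫ p in cell3 L, latticePotential w ε p.2.2 * ‖Φ p‖ ^ 2 :=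
    integral_nonneg fun p => mul_nonneg (latticePotential_nonneg hw _ _) (by positivity)
  have a4 : 0 ≤ g * ∫ p in cell3 L, ‖Φ p‖ ^ 4 :=
    mul_nonneg hg (integral_nonneg fun p => by positivity)
  rw [formEnergy]
  linarith

theorem om_le_groundEnergy3 (hwc : Continuous w) (hw : ∀ z, 0 ≤ w z) (hL : 0 < N * T)
    (hOm : 0 ≤ Om) (hlt : Om < om) (hg : 0 ≤ g) : om ≤ groundEnergy3 w T N ε om Om g :=
  (le_groundEnergy3 hwc hw hL (hOm.trans_lt hlt) fun _ hΦ h1 =>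
    hΦ.om_le_formEnergy hw hOm hlt hg h1).2

theorem groundEnergy3_le (hwc : Continuous w) (hw : ∀ z, 0 ≤ w z) (hL : 0 < N * T)
    (hOm : 0 ≤ Om) (hlt : Om < om) (hg : 0 ≤ g) :
    groundEnergy3 w T N ε om Om g ≤ om + mA w T N ε (gHat g om) := by
  have hom := hOm.trans_lt hlt
  have hbdd := (le_groundEnergy3 (N := N) (T := T) (ε := ε) hwc hw hL hom fun _ hΦ h1 =>
    hΦ.om_le_formEnergy hw hOm hlt hg h1).1
  rw [← sub_le_iff_le_add']
  obtain ⟨φ, hφ, h1⟩ := exists_normalized_memH1Per hL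
  refine le_csInf ⟨_, _, ⟨hφ, h1⟩, rfl⟩ ?_
  rintro _ ⟨φ, ⟨hφ, h1⟩, rfl⟩
  obtain ⟨hadm, he⟩ := hφ.energy3_gaussianMul (ε := ε) (Om := Om) (g := g) hwc hL hom h1
  rw [sub_le_iff_le_add', ← he]
  refine csInf_le ⟨om, ?_⟩ ⟨_, hadm, rfl⟩
  rintro _ ⟨Ψ, ⟨hΨ, h2⟩, rfl⟩
  exact hbdd Ψ hΨ h2

theorem lower_bound_groundEnergy3 (hwc : Continuous w) (hw : ∀ z, 0 ≤ w z) (hL : 0 < N * T)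
    (hOm : 0 ≤ Om) (hlt : Om < om) (hg : 0 ≤ g) {t : ℝ} (ht : 0 < t) (ht1 : t ≤ 1) :
    om + mA w T N ε (gHat g om) * (1 - 16 * (mA w T N ε (gHat g om) / (om - Om)) - 7 * t
      - 5760 / t ^ 3 * (g * om * mA w T N ε (gHat g om) / ((om - Om) * √(om - Om))
        * (1 + 1 / (√(om - Om) * (N * T))))) ≤ groundEnergy3 w T N ε om Om g :=
  (le_groundEnergy3 hwc hw hL (hOm.trans_lt hlt) fun _ hΦ h1 =>
    hΦ.lower_bound hwc hw hL hOm hlt hg h1 ht ht1).2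

/-- By the Cauchy-Schwarz inequality, a normalized profile has quartic energy at least
`gHat g om / (N T)`. -/
theorem gHat_le_mul_mA (hwc : Continuous w) (hw : ∀ z, 0 ≤ w z) (hL : 0 < N * T) (hg : 0 ≤ g) :
    gHat g om ≤ N * T * mA w T N ε (gHat g om) := by
  have hgh := gHat_nonneg hg om
  rw [mul_comm, ← div_le_iff₀ hL]
  obtain ⟨φ, hφ, h1⟩ := exists_normalized_memH1Per hL
  refine le_csInf ⟨_, _, ⟨hφ, h1⟩, rfl⟩ ?_
  rintro _ ⟨φ, ⟨hφ, h1⟩, rfl⟩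
  obtain ⟨v, hv, hvL⟩ := hφ.deriv
  have i4 := hφ.integrable_pow_four hL
  have i2 := integrable_norm_sq hφ.memLp
  rw [energyA_eq hwc hv hφ.memLp hvL i4]
  set L : ℝ := N * T with hLdef
  have a1 : 0 ≤ ∫ z in Ioo (-(L / 2)) (L / 2), ‖v z‖ ^ 2 := integral_nonneg fun z => by positivity
  have a2 : 0 ≤ ∫ z in Ioo (-(L / 2)) (L / 2), latticePotential w ε z * ‖φ z‖ ^ 2 :=
    integral_nonneg fun z => mul_nonneg (latticePotential_nonneg hw _ _) (by positivity)
  have i0 : Integrable (fun _ : ℝ => (1 / L) ^ 2) (volume.restrict (Ioo (-(L / 2)) (L / 2))) :=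
    integrable_const _
  have a4 : 1 / L ≤ ∫ z in Ioo (-(L / 2)) (L / 2), ‖φ z‖ ^ 4 := by
    have e : ∫ z in Ioo (-(L / 2)) (L / 2), (2 / L * ‖φ z‖ ^ 2 - (1 / L) ^ 2) = 1 / L := by
      rw [integral_sub (i2.const_mul _) i0, integral_const_mul, h1, setIntegral_const,
        Real.volume_real_Ioo_of_le (by linarith), smul_eq_mul]
      field_simp
      ring
    rw [← e]
    refine integral_mono ((i2.const_mul _).sub i0) i4 fun z => ?_
    have := sq_nonneg (‖φ z‖ ^ 2 - 1 / L)
    have e2 : 2 / L = 2 * (1 / L) := by ring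
    simp only [e2]
    nlinarith
  have a5 : gHat g om / L ≤ gHat g om * ∫ z in Ioo (-(L / 2)) (L / 2), ‖φ z‖ ^ 4 := by
    rw [div_eq_mul_one_div]
    gcongr
  linarith

end GroundState

/-! ### Choice of the parameter -/

/-- Optimization over `t`, where `q` is the scale of the fourth root of `Z`: the choice `t = q` is
admissible for `0 < q ≤ 1`, and for `q > 1` the claim is weaker than `om ≤ E`. -/
theorem le_of_forall_lower_bound {E om m Y Z A q : ℝ} (hm : 0 ≤ m) (hY : 0 ≤ Y) (hA : 0 ≤ A)
    (hq : 0 ≤ q) (hZ : Z ≤ A * q ^ 4) (hE : om ≤ E)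
    (h : ∀ t, 0 < t → t ≤ 1 → om + m * (1 - 16 * Y - 7 * t - 5760 / t ^ 3 * Z) ≤ E) :
    om + m * (1 - (23 + 5760 * A) * (q + Y)) ≤ E := by
  rcases hq.eq_or_lt with h0 | hpos
  · -- for `q = 0` the parameter `t` is sent to zero
    subst h0
    have hZ0 : Z ≤ 0 := by simpa using hZ
    have h1 : ∀ t, 0 < t → t ≤ 1 → om + m * (1 - 16 * Y - 7 * t) ≤ E := by
      intro t ht ht1
      refine le_trans ?_ (h t ht ht1)
      have : 5760 / t ^ 3 * Z ≤ 0 := mul_nonpos_of_nonneg_of_nonpos (by positivity) hZ0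
      refine add_le_add le_rfl (mul_le_mul_of_nonneg_left ?_ hm)
      linarith
    have h2 : om + m * (1 - 16 * Y - 7 * 0) ≤ E := by
      have hc : Tendsto (fun t : ℝ => om + m * (1 - 16 * Y - 7 * t)) (𝓝[>] 0)
          (𝓝 (om + m * (1 - 16 * Y - 7 * 0))) :=
        ((by fun_prop : Continuous fun t : ℝ => om + m * (1 - 16 * Y - 7 * t)).tendsto 0).mono_left
          nhdsWithin_le_nhds
      refine le_of_tendsto hc ?_
      filter_upwards [Ioc_mem_nhdsGT (zero_lt_one' ℝ)] with t ht
      exact h1 t ht.1 ht.2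
    refine le_trans ?_ h2
    refine add_le_add le_rfl (mul_le_mul_of_nonneg_left ?_ hm)
    nlinarith [mul_nonneg hA hY]
  · rcases le_or_gt q 1 with hq1 | hq1
    · refine le_trans ?_ (h q hpos hq1)
      have h3 : 5760 / q ^ 3 * Z ≤ 5760 * A * q := by
        calc 5760 / q ^ 3 * Z ≤ 5760 / q ^ 3 * (A * q ^ 4) := by gcongr
          _ = 5760 * A * q := by field_simp
      refine add_le_add le_rfl (mul_le_mul_of_nonneg_left ?_ hm)
      nlinarith [mul_nonneg hA hY]
    · refine le_trans ?_ hE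
      have h4 : 1 ≤ (23 + 5760 * A) * (q + Y) := by
        nlinarith [mul_nonneg hA hY, mul_nonneg hA hq]
      nlinarith

end

end OpticalLattice

open OpticalLattice
theorem mainTheorem1 (T : ℝ) (hT : 0 < T) (N : ℕ) (hN : 1 ≤ N) (w : ℝ → ℝ)
    (hw : IsLatticeProfile T w) :
    -- the asymptotic statement
    (∀ ε₀ : ℝ, 0 < ε₀ → ∀ η : ℝ, 0 < η → ∃ κ : ℝ, 0 < κ ∧
      ∀ ε om Om g : ℝ, 0 < ε → ε ≤ ε₀ → 0 ≤ Om → Om < om → 0 ≤ g →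
        mA w T N ε (gHat g om) / (om - Om) ≤ κ →
        g * (2 * om - Om) * mA w T N ε (gHat g om) * (om - Om) ^ (-(3 / 2) : ℝ) ≤ κ →
        |groundEnergy3 w T N ε om Om g - (om + mA w T N ε (gHat g om))| ≤
          η * mA w T N ε (gHat g om)) ∧
    -- the quantitative statement
    (∃ C : ℝ, 0 < C ∧
      ∀ ε om Om g : ℝ, 0 < ε → ε ≤ 1 → 0 ≤ Om → 1 ≤ om - Om → 0 ≤ g →
        ∃ r : ℝ, 0 ≤ r ∧
          r ≤ g ^ (1 / 4 : ℝ) * (om - Om) ^ (-(1 / 8) : ℝ)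
                * (((om - Om) + om) / (om - Om)) ^ (1 / 4 : ℝ)
                * mA w T N ε (gHat g om) ^ (1 / 4 : ℝ)
              + mA w T N ε (gHat g om) / (om - Om) ∧
          groundEnergy3 w T N ε om Om g =
            om + mA w T N ε (gHat g om) * (1 - C * r)) := by
  have hwc : Continuous w := hw.smooth.continuous
  have hw0 := hw.nonneg
  have hL : (0 : ℝ) < N * T := mul_pos (by exact_mod_cast hN) hT
  refine ⟨fun ε₀ _ η hη => ?_, 23 + 5760 * (1 + 1 / (N * T)), by positivity, ?_⟩
  · -- half of `η` is spent on the term `7 t`, the other half on the terms controlled by `κ`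
    set t : ℝ := min 1 (η / 14) with ht
    have ht0 : 0 < t := by positivity
    have ht1 : t ≤ 1 := min_le_left _ _
    have ht2 : 7 * t ≤ η / 2 := by have := min_le_right 1 (η / 14); linarith
    refine ⟨min 1 (t ^ 3 * η / 92192), by positivity, ?_⟩
    intro ε om Om g _ _ hOm hlt hg hY hX
    set κ : ℝ := min 1 (t ^ 3 * η / 92192) with hκ
    have hκ1 : κ ≤ 1 := min_le_left _ _
    have hκ0 : 0 < κ := by positivity
    have hκ2 : κ ≤ t ^ 3 * η / 92192 := min_le_right _ _
    have hom : 0 < om := hOm.trans_lt hlt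
    have hd : 0 < om - Om := sub_pos.2 hlt
    have hsd : 0 < √(om - Om) := Real.sqrt_pos.2 hd
    have hup := groundEnergy3_le (ε := ε) hwc hw0 hL hOm hlt hg
    have hlow := lower_bound_groundEnergy3 (ε := ε) hwc hw0 hL hOm hlt hg ht0 ht1
    have hgm := gHat_le_mul_mA (ε := ε) (om := om) hwc hw0 hL hg
    have hm := mA_nonneg (T := T) (N := N) (ε := ε) hw0 (gHat_nonneg hg om)
    set m := mA w T N ε (gHat g om) with hmdef
    have hrpow : (om - Om) ^ (-(3 / 2) : ℝ) = 1 / ((om - Om) * √(om - Om)) := by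
      rw [Real.rpow_neg hd.le, Real.sqrt_eq_rpow, one_div]
      congr 1
      nth_rewrite 2 [← Real.rpow_one (om - Om)]
      rw [← Real.rpow_add hd]
      norm_num
    rw [hrpow] at hX
    rw [gHat_eq g om hom, div_le_iff₀ (by positivity)] at hgm
    have hY0 : 0 ≤ m / (om - Om) := by positivity
    -- `m ≥ gHat / L` absorbs the contribution of the finite length of the cell
    have hZ : g * om * m / ((om - Om) * √(om - Om)) * (1 + 1 / (√(om - Om) * (N * T))) ≤ 8 * κ := by
      have e1 : g * om * m / ((om - Om) * √(om - Om)) ≤ κ := by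
        refine le_trans ?_ hX
        rw [mul_one_div]
        gcongr
        linarith
      have e2 : g * om * m / ((om - Om) * √(om - Om)) * (1 / (√(om - Om) * (N * T)))
          ≤ 7 * κ := by
        calc g * om * m / ((om - Om) * √(om - Om)) * (1 / (√(om - Om) * (N * T)))
            = g * om * m / ((om - Om) * (√(om - Om) * √(om - Om)) * (N * T)) := by
              field_simp
          _ = g * om * m / ((om - Om) * (om - Om) * (N * T)) := by
              rw [Real.mul_self_sqrt hd.le]
          _ ≤ N * T * m * (2 * Real.pi) * m / ((om - Om) * (om - Om) * (N * T)) := by gcongr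
          _ = 2 * Real.pi * (m / (om - Om)) * (m / (om - Om)) := by field_simp
          _ ≤ 2 * Real.pi * κ * 1 := by
              have := hY.trans hκ1
              gcongr
          _ ≤ 7 * κ := by nlinarith [Real.pi_lt_d2]
      rw [mul_add, mul_one]
      linarith
    have hZ' : 5760 / t ^ 3 * (g * om * m / ((om - Om) * √(om - Om))
        * (1 + 1 / (√(om - Om) * (N * T)))) ≤ 46080 / t ^ 3 * κ := by
      calc _ ≤ 5760 / t ^ 3 * (8 * κ) := by gcongr
        _ = _ := by ring
    have hκ3 : 16 * κ + 46080 / t ^ 3 * κ ≤ η / 2 := by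
      have h3 : t ^ 3 ≤ 1 := pow_le_one₀ ht0.le ht1
      have h4 : 16 * κ ≤ 16 / t ^ 3 * κ := by
        gcongr
        rw [le_div_iff₀ (by positivity)]
        linarith
      have h5 : 46096 / t ^ 3 * κ ≤ 46096 / t ^ 3 * (t ^ 3 * η / 92192) := by gcongr
      have h6 : 46096 / t ^ 3 * (t ^ 3 * η / 92192) = η / 2 := by field_simp; norm_num
      have h7 : 16 / t ^ 3 * κ + 46080 / t ^ 3 * κ = 46096 / t ^ 3 * κ := by ring
      linarith
    have hfin : m * (1 - η) ≤ m * (1 - 16 * (m / (om - Om)) - 7 * t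
        - 5760 / t ^ 3 * (g * om * m / ((om - Om) * √(om - Om))
        * (1 + 1 / (√(om - Om) * (N * T))))) := by
      refine mul_le_mul_of_nonneg_left ?_ hm
      linarith
    rw [abs_le]
    constructor <;> nlinarith
  · intro ε om Om g _ _ hOm hd1 hg
    have hlt : Om < om := by linarith
    have hom : 0 < om := hOm.trans_lt hlt
    have hd : 0 < om - Om := sub_pos.2 hlt
    have hsd1 : 1 ≤ √(om - Om) := by rw [Real.one_le_sqrt]; exact hd1
    have hup := groundEnergy3_le (ε := ε) hwc hw0 hL hOm hlt hg
    have hE := om_le_groundEnergy3 (ε := ε) hwc hw0 hL hOm hlt hg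
    have hlow := fun t ht ht1 =>
      lower_bound_groundEnergy3 (ε := ε) (t := t) hwc hw0 hL hOm hlt hg ht ht1
    have hm := mA_nonneg (T := T) (N := N) (ε := ε) hw0 (gHat_nonneg hg om)
    set m := mA w T N ε (gHat g om) with hmdef
    set q : ℝ := g ^ (1 / 4 : ℝ) * (om - Om) ^ (-(1 / 8) : ℝ)
      * (((om - Om) + om) / (om - Om)) ^ (1 / 4 : ℝ) * m ^ (1 / 4 : ℝ) with hq
    have hratio : 0 ≤ ((om - Om) + om) / (om - Om) := by positivity
    have hq0 : 0 ≤ q := by positivity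
    have hroot : ∀ a : ℝ, 0 ≤ a → (a ^ (1 / 4 : ℝ)) ^ 4 = a := fun a ha => by
      rw [← Real.rpow_natCast, ← Real.rpow_mul ha]
      norm_num
    have hq4 : q ^ 4 = g * (1 / √(om - Om)) * (((om - Om) + om) / (om - Om)) * m := by
      have e1 : ((om - Om) ^ (-(1 / 8) : ℝ)) ^ 4 = 1 / √(om - Om) := by
        rw [← Real.rpow_natCast, ← Real.rpow_mul hd.le, Real.sqrt_eq_rpow,
          one_div ((om - Om) ^ (1 / 2 : ℝ)), ← Real.rpow_neg hd.le]
        norm_num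
      rw [hq, mul_pow, mul_pow, mul_pow, hroot g hg, hroot _ hratio, hroot m hm, e1]
    have hZ : g * om * m / ((om - Om) * √(om - Om)) * (1 + 1 / (√(om - Om) * (N * T)))
        ≤ (1 + 1 / (N * T)) * q ^ 4 := by
      have e1 : 1 / (√(om - Om) * (N * T)) ≤ 1 / (N * T) := by
        exact one_div_le_one_div_of_le hL (le_mul_of_one_le_left hL.le hsd1)
      have e2 : g * om * m / ((om - Om) * √(om - Om)) ≤ q ^ 4 := by
        rw [hq4]
        calc g * om * m / ((om - Om) * √(om - Om))
            ≤ g * ((om - Om) + om) * m / ((om - Om) * √(om - Om)) := by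
              gcongr
              linarith
          _ = _ := by field_simp
      rw [mul_comm]
      gcongr
    have hmain := le_of_forall_lower_bound (Y := m / (om - Om)) hm (by positivity)
      (by positivity) hq0 hZ hE hlow
    set C : ℝ := 23 + 5760 * (1 + 1 / (N * T)) with hC
    have hC0 : 0 < C := by positivity
    set E := groundEnergy3 w T N ε om Om g with hEdef
    -- for `m = 0` both bounds give `E = om`, and this quotient is `0`
    refine ⟨(om + m - E) / (C * m), div_nonneg (by linarith) (by positivity), ?_, ?_⟩
    · rcases hm.eq_or_lt with h0 | hpos
      · rw [← h0, mul_zero, div_zero]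
        positivity
      · rw [div_le_iff₀ (by positivity)]
        linarith
    · rcases hm.eq_or_lt with h0 | hpos
      · rw [← h0] at hup ⊢
        linarith
      · field_simp
        ring
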